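/- **Setting.** Let $F$ be a field of characteristic $\neq 2$ and let $V$ be a two-dimensional $F$-vector space with a nonzero alternating bilinear form $\langle\cdot|\cdot\rangle$. Put $\gamma_{a,b}=\langle a|\cdot\rangle b+\langle b|\cdot\rangle a\in\mathfrak{sp}(V)$ for $a,b\in V$. *The split para-octonions.* $S_8=V\otimes V\,\oplus\,V\otimes V$, with product $$(a\otimes b,c\otimes d)\bullet(a'\otimes b',c'\otimes d')=\bigl(\langle b|a'\rangle b'\otimes a-\langle d|d'\rangle c\otimes c',\,-\langle a|c'\rangle b\otimes d'-\langle c|b'\rangle a'\otimes d\bigr)$$ and with the norm $q$ whose polar form is $q\bigl((a\otimes b,c\otimes d),(a'\otimes b',c'\otimes d')\bigr)=\langle a|a'\rangle\langle b|b'\rangle+\langle c|c'\rangle\langle d|d'\rangle$, is a symmetric composition algebra. *The algebra $\mathfrak g(S,S')$.* For a symmetric composition algebra $(S,*,q)$ let $\mathfrak{tri}(S)$ be the Lie algebra of the triples $(d_0,d_1,d_2)\in\mathfrak o(S,q)^3$ with $d_0(x*y)=d_1(x)*y+x*d_2(y)$, let $\theta(d_0,d_1,d_2)=(d_2,d_0,d_1)$,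 and let $t_{x,y}=\bigl(q(x,\cdot)y-q(y,\cdot)x,\ \tfrac12q(x,y)\mathrm{id}-r_xl_y,\ \tfrac12q(x,y)\mathrm{id}-l_xr_y\bigr)\in\mathfrak{tri}(S)$, where $l_xz=x*z$ and $r_xz=z*x$. Then $\mathfrak g(S,S')=\mathfrak{tri}(S)\oplus\mathfrak{tri}(S')\oplus\bigoplus_{i=0}^2\iota_i(S\otimes S')$, with the anticommutative product for which $\mathfrak{tri}(S)\oplus\mathfrak{tri}(S')$ is a Lie subalgebra, $[(d_0,d_1,d_2),\iota_i(a\otimes x)]=\iota_i(d_i(a)\otimes x)$, $[(d_0',d_1',d_2'),\iota_i(a\otimes x)]=\iota_i(a\otimes d_i'(x))$, $[\iota_i(a\otimes x),\iota_{i+1}(b\otimes y)]=\iota_{i+2}((a*b)\otimes(x*y))$ (indices modulo $3$) and $[\iota_i(a\otimes x),\iota_i(b\otimes y)]=q'(x,y)\theta^i(t_{a,b})+q(a,b)\theta'^i(t'_{x,y})$. Let $\mathfrak e_8=\mathfrak g(S_8,S_8)$. *The modules $V(\sigma)$ and the maps $\varphi_{\sigma,\tau}$.* For $\sigma\subseteq\{1,\dots,8\}$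 let $V(\emptyset)=\mathfrak{sp}(V)^8$ and $V(\sigma)=\bigotimes_{i\in\sigma}V_i$ for $\sigma\ne\emptyset$, where the $V_i$ are copies of $V$. Let $\sigma+\tau$ be the symmetric difference. The bilinear maps $\varphi_{\sigma,\tau}:V(\sigma)\times V(\tau)\to V(\sigma+\tau)$ are as follows: $\varphi_{\emptyset,\emptyset}$ is the Lie bracket; $\varphi_{\emptyset,\tau}$ is the natural action of $\mathfrak{sp}(V)^8$ on $V(\tau)$ (the $j$-th component acting on $V_j$), and $\varphi_{\sigma,\emptyset}(x,s)=-\varphi_{\emptyset,\sigma}(s,x)$, for $\sigma,\tau\neq\emptyset$; if $\emptyset\ne\sigma\ne\tau\ne\emptyset$, $$\varphi_{\sigma,\tau}\Bigl(\bigotimes_{i\in\sigma}v_i,\bigotimes_{i\in\tau}w_i\Bigr)=\Bigl(\prod_{k\in\sigma\cap\tau}\langle v_k|w_k\rangle\Bigr)\bigotimes_{i\in\sigma\setminus\tau}v_i\otimes\bigotimes_{i\in\tau\setminus\sigma}w_i ;$$ and for $\sigma\ne\emptyset$ $$\varphi_{\sigma,\sigma}\Bigl(\bigotimes_{i\in\sigma}v_i,\bigotimes_{i\in\sigma}w_i\Bigr)=-\frac12\sum_{j\in\sigma}\Bigl(\prod_{k\in\sigma,\,k\neq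 j}\langle v_k|w_k\rangle\Bigr)\nu_j(\gamma_{v_j,w_j}),$$ with $\nu_j:\mathfrak{sp}(V)\to\mathfrak{sp}(V)^8$ the inclusion of the $j$-th component. *The index set and the signs.* Let $\mathcal S=\mathcal S_{\mathfrak e_8}$ consist of the following fifteen sets, where $1256$ stands for $\{1,2,5,6\}$, and so on: $$\emptyset,\ 1256,\ 2367,\ 1357,\ 1234,\ 3456,\ 1467,\ 2457,\ 3478,\ 1458,\ 2468,\ 5678,\ 1278,\ 2358,\ 1368.$$ Let $\varepsilon=\varepsilon_{\mathfrak e_8}$ be given by the following table, with rows $\sigma$ and columns $\tau$ in this order ($\pm$ stands for $\pm1$, and a dot for a blank entry; the blank entries are those with $\sigma+\tau=\{1,\dots,8\}$): $$\begin{array}{c|ccccccccccccccc} \emptyset&+&+&+&+&+&+&+&+&+&+&+&+&+&+&+\\ 1256&+&-&+&-&+&-&-&+&\cdot&+&-&+&-&-&+\\ 2367&+&-&-&+&+&+&-&-&-&\cdot&+&+&+&-&-\\ 1357&+&+&-&-&+&-&+&-&+&-&\cdot&+&-&+&-\\ 1234&+&-&-&-&-&+&+&+&+&+&+&\cdot&-&-&-\\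 3456&+&+&-&+&-&-&-&+&-&+&-&+&\cdot&+&-\\ 1467&+&+&+&-&-&+&-&-&-&-&+&+&-&\cdot&+\\ 2457&+&-&+&+&-&-&+&-&+&-&-&+&+&-&\cdot\\ 3478&+&\cdot&+&-&-&+&+&-&-&+&-&-&+&+&-\\ 1458&+&-&\cdot&+&-&-&+&+&-&-&+&-&-&+&+\\ 2468&+&+&-&\cdot&-&+&-&+&+&-&-&-&+&-&+\\ 5678&+&-&-&-&\cdot&-&-&-&+&+&+&-&+&+&+\\ 1278&+&+&-&+&+&\cdot&+&-&-&+&-&-&-&-&+\\ 2358&+&+&+&-&+&-&\cdot&+&-&-&+&-&+&-&-\\ 1368&+&-&+&+&+&+&-&\cdot&+&-&-&-&-&+&- \end{array}$$ Let $\chi_4:\mathbb Z_2^4\to\mathbb Z_2^8$ be the linear map $$\chi_4(x_1,\dots,x_4)=(x_1+x_3+x_4,\ x_1+x_2+x_3+x_4,\ x_2+x_3+x_4,\ x_3+x_4,\ x_1+x_4,\ x_1+x_2+x_4,\ x_2+x_4,\ x_4);$$ its values are viewed as subsets of $\{1,\dots,8\}$. Let $$g(x,y)=\sum_{1\le j\le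 i\le3}x_iy_j+x_3y_4+x_4y_3+x_1y_2y_3+x_2y_1y_3+x_3y_1y_2\in\mathbb Z_2 .$$ **Theorem.** 1. Identify $1,\dots,8$ with the points $(1,0,1),(1,1,1),(0,1,1),(0,0,1),(1,0,0),(1,1,0),(0,1,0),(0,0,0)$ of $\mathbb F_2^3$, in this order. Then $\mathcal S$ consists of $\emptyset$ and of the affine planes of $\mathbb F_2^3$, of which there are $14$. 2. The map $\chi_4$ is injective, and $\mathcal S=\chi_4\bigl(\mathbb Z_2^4\setminus\{(0,0,0,1)\}\bigr)$. 3. $\varepsilon(\sigma,\tau)=(-1)^{g(\chi_4^{-1}(\sigma),\chi_4^{-1}(\tau))}$ for all $\sigma,\tau\in\mathcal S$ with $\sigma+\tau\in\mathcal S$. 4. Let $\mathbb O=\mathbb H\oplus\mathbb Hl$ be the real octonions, with product $(a+bl)(a'+b'l)=(aa'-\overline{b'}b)+(b'a+b\overline{a'})l$, and let $\mathbb R[\epsilon]=\mathbb R1\oplus\mathbb R\epsilon$ with $\epsilon^2=1$. For $x\in\mathbb Z_2^4$ put $b_x=s_x\,(i^{x_1}j^{x_2})l^{x_3}\otimes\epsilon^{x_4}\in\mathbb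 O\otimes_{\mathbb R}\mathbb R[\epsilon]$, where $s_x=-1$ if $x_3=x_4=1$ and $s_x=1$ otherwise (here $ij=k$). Then $(b_x)$ is an $\mathbb R$-basis, with $b_xb_y=(-1)^{g(x,y)}b_{x+y}$. If $\chi_4(x)$, $\chi_4(y)$ and $\chi_4(x)+\chi_4(y)$ belong to $\mathcal S$, then $\chi_4(x+y)=\chi_4(x)+\chi_4(y)$ and $b_xb_y=\varepsilon(\chi_4(x),\chi_4(y))\,b_{x+y}$; that is, the signs in the table are those of the multiplication table of $\mathbb O\otimes\mathbb R[\epsilon]$ in this basis. 5. $\mathfrak e_8$ is a Lie algebra: $[X,X]=0$ and the Jacobi identity holds. 6. $\mathfrak e_8=\bigoplus_{\sigma\in\mathcal S}V(\sigma)$, that is, there is a linear isomorphism $\Psi:\bigoplus_{\sigma\in\mathcal S}V(\sigma)\to\mathfrak e_8$ with the following values. Let $\pi_0,\pi_1,\pi_2$ be the sequences $1234$, $2314$, $3124$. - For $s\in V(\emptyset)=\mathfrak{sp}(V)^8$, $\Psi(s)$ is the element $(d,d')$ of $\mathfrak{tri}(S_8)\oplus\mathfrak{tri}(S_8)$ with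 $d_k=\rho\bigl((s_{\pi_k(j)})_{1\le j\le 4}\bigr)$ and $d'_k=\rho\bigl((s_{4+\pi_k(j)})_{1\le j\le4}\bigr)$, for $k=0,1,2$; here $\rho(u_1,\dots,u_4)$ is the endomorphism of $S_8$ in which $u_i\in\mathfrak{sp}(V)$ acts on the $i$-th of the four copies of $V$ in $V\otimes V\oplus V\otimes V$. - For $\sigma=\{1,2,3,4\}$, $\Psi(\bigotimes v_i)$ is the element $d$ of the first $\mathfrak{tri}(S_8)$ with $d_k=\rho(v_{\pi_k(1)}\otimes v_{\pi_k(2)}\otimes v_{\pi_k(3)}\otimes v_{\pi_k(4)})$, and similarly for $\{5,6,7,8\}$, with the second $\mathfrak{tri}(S_8)$ and the indices $4+\pi_k(j)$; here $\rho(v_1\otimes v_2\otimes v_3\otimes v_4)$ is the endomorphism $(w_1\otimes w_2,w_3\otimes w_4)\mapsto\bigl(\langle v_3|w_3\rangle\langle v_4|w_4\rangle v_1\otimes v_2,\,-\langle v_1|w_1\rangle\langle v_2|w_2\rangle v_3\otimes v_4\bigr)$ of $S_8$. - Each of the other twelve nonempty $\sigma\in\mathcal S$ is $\{p,p',4+r,4+r'\}$,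 where, for some $k\in\{0,1,2\}$, each of $(p,p')$ and $(r,r')$ is either $(\pi_k(1),\pi_k(2))$ or $(\pi_k(3),\pi_k(4))$; for each such choice, $\Psi(\bigotimes v_i)=\iota_k(A\otimes B)$ with $A=(v_p\otimes v_{p'},0)$ in the first case and $A=(0,v_p\otimes v_{p'})$ in the second one, and similarly for $B$, with $v_{4+r}\otimes v_{4+r'}$. For all $\sigma,\tau\in\mathcal S$, $x_\sigma\in V(\sigma)$ and $y_\tau\in V(\tau)$, under this identification, $$[x_\sigma,y_\tau]=\varepsilon_{\mathfrak e_8}(\sigma,\tau)\,\varphi_{\sigma,\tau}(x_\sigma,y_\tau)\quad\text{if }\sigma+\tau\in\mathcal S,$$ and otherwise $\sigma+\tau=\{1,\dots,8\}$ and $[x_\sigma,y_\tau]=0$. -/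

import Mathlib

open scoped TensorProduct DirectSum

set_option linter.unusedSectionVars false
set_option linter.unnecessarySeqFocus false

namespace E8Model

/-! ### Symmetric composition algebras, triality Lie algebras and the construction `𝔤(S, S')` -/

/-- A symmetric composition algebra structure `(S, *, q)` on the vector space `S`: a bilinear
product, and a regular quadratic form (the norm) that is multiplicative and whose polar form
satisfies `q(x * y, z) = q(x, y * z)`. -/
structure SymmetricComposition (F S : Type*) [Field F] [AddCommGroup S] [Module F S] where
  /-- the product `x * y` -/
  mul : S →ₗ[F] S →ₗ[F] S
  /-- the norm -/
  norm : QuadraticForm F S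
  norm_regular : ∀ x, (∀ y, norm.polarBilin x y = 0) → x = 0
  norm_mul : ∀ x y, norm (mul x y) = norm x * norm y
  polar_mul : ∀ x y z, norm.polarBilin (mul x y) z = norm.polarBilin x (mul y z)

namespace SymmetricComposition

variable {F S S' : Type*} [Field F] [AddCommGroup S] [Module F S] [AddCommGroup S'] [Module F S']
variable (A : SymmetricComposition F S) (A' : SymmetricComposition F S')

/-- The polar form `q(x, y) = q(x + y) - q(x) - q(y)` of the norm. -/
abbrev q : LinearMap.BilinForm F S := A.norm.polarBilin

theorem q_comm (x y : S) : A.q x y = A.q y x := QuadraticMap.polar_comm _ _ _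

theorem ext_q {x y : S} (h : ∀ z, A.q x z = A.q y z) : x = y := by
  rw [← sub_eq_zero]
  exact A.norm_regular _ fun z => by
    rw [map_sub, LinearMap.sub_apply, sub_eq_zero]; exact h z

theorem norm_add (x y : S) : A.norm (x + y) = A.norm x + A.norm y + A.q x y := by
  simp [QuadraticMap.polar]

theorem q_mul_mul_left (x y z : S) : A.q (A.mul x y) (A.mul x z) = A.norm x * A.q y z := by
  have h := A.norm_mul x (y + z)
  rw [map_add, norm_add, norm_add, A.norm_mul, A.norm_mul] at h
  linear_combination h

theorem q_mul_mul (x y w z : S) :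
    A.q (A.mul x y) (A.mul w z) + A.q (A.mul w y) (A.mul x z) = A.q x w * A.q y z := by
  have h := A.q_mul_mul_left (x + w) y z
  simp only [map_add, LinearMap.add_apply, norm_add, A.q_mul_mul_left] at h
  linear_combination h

theorem mul_mul_left (x y z : S) :
    A.mul (A.mul x y) z + A.mul (A.mul z y) x = A.q x z • y := by
  refine A.ext_q fun w => ?_
  have h := A.q_mul_mul x y z w
  simp only [map_add, LinearMap.add_apply, map_smul, LinearMap.smul_apply, smul_eq_mul,
    A.polar_mul (A.mul x y), A.polar_mul (A.mul z y)]
  exact h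

theorem mul_mul_right (x y z : S) :
    A.mul x (A.mul y z) + A.mul z (A.mul y x) = A.q x z • y := by
  refine A.ext_q fun w => ?_
  have h := A.q_mul_mul w x y z
  simp only [map_add, LinearMap.add_apply, map_smul, LinearMap.smul_apply, smul_eq_mul]
  rw [A.q_comm _ w, A.q_comm _ w, ← A.polar_mul w, ← A.polar_mul w, A.q_comm (A.mul w z),
    h, A.q_comm w y, mul_comm]

/-- The triality Lie algebra `tri(S, *, q)` (its bracket is `triLie` below): triples `(d₀, d₁, d₂)`
of elements of the orthogonal Lie algebra `𝔬(S, q)` with `d₀ (x * y) = d₁ x * y + x * d₂ y`. -/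
def tri : Submodule F (Fin 3 → Module.End F S) where
  carrier := {d | (∀ i x y, A.q (d i x) y + A.q x (d i y) = 0) ∧
    ∀ x y, d 0 (A.mul x y) = A.mul (d 1 x) y + A.mul x (d 2 y)}
  zero_mem' := by constructor <;> simp
  add_mem' := by
    rintro a b ⟨ha, ha'⟩ ⟨hb, hb'⟩
    refine ⟨fun i x y => ?_, fun x y => ?_⟩
    · simp only [Pi.add_apply, LinearMap.add_apply, map_add]
      linear_combination ha i x y + hb i x y
    · simp only [Pi.add_apply, LinearMap.add_apply, map_add, ha', hb']
      abel
  smul_mem' := by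
    rintro c a ⟨ha, ha'⟩
    refine ⟨fun i x y => ?_, fun x y => ?_⟩
    · simp only [Pi.smul_apply, LinearMap.smul_apply, map_smul, smul_eq_mul]
      linear_combination c * ha i x y
    · simp only [Pi.smul_apply, LinearMap.smul_apply, map_smul, ha', smul_add]

theorem lie_mem_tri {a b : Fin 3 → Module.End F S} (h : a ∈ A.tri) (h' : b ∈ A.tri) :
    (fun i => a i * b i - b i * a i) ∈ A.tri := by
  obtain ⟨ha, ha'⟩ := h
  obtain ⟨hb, hb'⟩ := h'
  refine ⟨fun i x y => ?_, fun x y => ?_⟩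
  · simp only [LinearMap.sub_apply, Module.End.mul_apply, map_sub]
    linear_combination ha i (b i x) y - hb i (a i x) y - hb i x (a i y) + ha i x (b i y)
  · simp only [LinearMap.sub_apply, Module.End.mul_apply, map_sub, ha', hb', map_add]
    abel

/-- The Lie bracket of the triality Lie algebra, the componentwise commutator. -/
def triLie : A.tri →ₗ[F] A.tri →ₗ[F] A.tri :=
  LinearMap.mk₂ F (fun d e => ⟨fun i => d.1 i * e.1 i - e.1 i * d.1 i, A.lie_mem_tri d.2 e.2⟩)
    (fun d d' e => Subtype.ext <| funext fun i => by
      change (d.1 i + d'.1 i) * e.1 i - e.1 i * (d.1 i + d'.1 i) = (_ - _) + (_ - _)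
      noncomm_ring)
    (fun c d e => Subtype.ext <| funext fun i => by
      change (c • d.1 i) * e.1 i - e.1 i * (c • d.1 i) = c • (_ - _)
      rw [smul_mul_assoc, mul_smul_comm, smul_sub])
    (fun d e e' => Subtype.ext <| funext fun i => by
      change d.1 i * (e.1 i + e'.1 i) - (e.1 i + e'.1 i) * d.1 i = (_ - _) + (_ - _)
      noncomm_ring)
    (fun c d e => Subtype.ext <| funext fun i => by
      change d.1 i * (c • e.1 i) - (c • e.1 i) * d.1 i = c • (_ - _)
      rw [smul_mul_assoc, mul_smul_comm, smul_sub])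

/-- The triality automorphism `θ (d₀, d₁, d₂) = (d₂, d₀, d₁)`. -/
def theta : A.tri →ₗ[F] A.tri where
  toFun d := ⟨fun i => d.1 (i + 2), fun i => d.2.1 (i + 2), fun x y => by
    obtain ⟨d, hd, hd'⟩ := d
    refine A.ext_q fun z => ?_
    have h1 := hd 2 (A.mul x y) z
    have h2 := hd 0 x (A.mul y z)
    rw [hd' y z, map_add, ← A.polar_mul x y, ← A.polar_mul x] at h2
    rw [← A.polar_mul (d 0 x)] at h2
    simp only [map_add, LinearMap.add_apply]
    change A.q (d 2 (A.mul x y)) z = A.q (A.mul (d 0 x) y) z + A.q (A.mul x (d 1 y)) z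
    linear_combination h1 - h2⟩
  map_add' _ _ := rfl
  map_smul' _ _ := rfl

variable [NeZero (2 : F)]

/-- The triple `t_{x,y} = (σ_{x,y}, ½ q(x,y) id - r_x l_y, ½ q(x,y) id - l_x r_y)` of endomorphisms,
where `σ_{x,y} z = q(x,z) y - q(y,z) x`, `r_x z = z * x` and `l_x z = x * z`. -/
def tTriple (x y : S) : Fin 3 → Module.End F S :=
  ![(A.q x).smulRight y - (A.q y).smulRight x,
    ((2⁻¹ : F) * A.q x y) • LinearMap.id - A.mul.flip x ∘ₗ A.mul y,
    ((2⁻¹ : F) * A.q x y) • LinearMap.id - A.mul x ∘ₗ A.mul.flip y]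

theorem tTriple_mem (x y : S) : A.tTriple x y ∈ A.tri := by
  have h2 : (2⁻¹ : F) * 2 = 1 := inv_mul_cancel₀ (NeZero.ne 2)
  refine ⟨fun i z w => ?_, fun u v => ?_⟩
  · fin_cases i
    · simp only [tTriple, Fin.zero_eta, Matrix.cons_val_zero, LinearMap.sub_apply,
        LinearMap.smulRight_apply, map_sub, map_smul, LinearMap.smul_apply, smul_eq_mul]
      rw [A.q_comm z y, A.q_comm z x]
      ring
    · simp only [tTriple, Fin.mk_one, Matrix.cons_val_one, Matrix.cons_val_zero,
        LinearMap.sub_apply, LinearMap.smul_apply, LinearMap.id_apply, LinearMap.comp_apply,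
        LinearMap.flip_apply, map_sub, map_smul, smul_eq_mul]
      have h := A.q_mul_mul y z x w
      have e1 := A.polar_mul (A.mul y z) x w
      have e2 := A.polar_mul (A.mul y w) x z
      rw [e1, A.q_comm z (A.mul _ _), e2]
      rw [A.q_comm (A.mul x z)] at h
      rw [A.q_comm y x] at h
      linear_combination (A.q x y * A.q z w) * h2 - h
    · simp only [tTriple, Fin.reduceFinMk, Matrix.cons_val,
        LinearMap.sub_apply, LinearMap.smul_apply, LinearMap.id_apply, LinearMap.comp_apply,
        LinearMap.flip_apply, map_sub, map_smul, smul_eq_mul]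
      have h := A.q_mul_mul z y w x
      have e1 := A.polar_mul w x (A.mul z y)
      have e2 := A.polar_mul z x (A.mul w y)
      rw [A.q_comm (A.mul x (A.mul z y)) w]
      erw [← e1, ← e2]
      rw [A.q_comm (A.mul z y), A.q_comm (A.mul w y)] at h
      rw [A.q_comm y x] at h
      linear_combination (A.q x y * A.q z w) * h2 - h
  · simp only [tTriple, Matrix.cons_val, Matrix.cons_val_zero, Matrix.cons_val_one,
      LinearMap.sub_apply, LinearMap.smul_apply,
      LinearMap.smulRight_apply, LinearMap.id_apply, LinearMap.comp_apply, LinearMap.flip_apply,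
      map_sub, map_smul]
    have e1 := A.mul_mul_left (A.mul y u) x v
    have e2 := A.mul_mul_right u x (A.mul v y)
    have e4 := A.mul_mul_left x u y
    have e5 := A.mul_mul_left (A.mul x u) y v
    have e6 := congrArg (fun s => A.mul s v) e4
    simp only [map_add, LinearMap.add_apply, map_smul, LinearMap.smul_apply] at e6
    rw [A.polar_mul] at e1
    rw [A.q_comm u, A.polar_mul, A.q_comm v, A.polar_mul] at e2
    rw [A.polar_mul] at e5
    have h2' : A.q x y • A.mul u v = (2⁻¹ * A.q x y) • A.mul u v + (2⁻¹ * A.q x y) • A.mul u v := by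
      rw [← add_smul]; congr 1; linear_combination (-A.q x y) * h2
    linear_combination (norm := module) (-1 : F) • e5 + e2 + e6 + h2'

/-- `t_{x,y}` as a bilinear map into the triality Lie algebra. -/
def t : S →ₗ[F] S →ₗ[F] A.tri :=
  LinearMap.mk₂ F (fun x y => ⟨A.tTriple x y, A.tTriple_mem x y⟩)
    (fun x x' y => by
      ext i : 2; ext z
      fin_cases i <;> simp [tTriple, add_smul, mul_add] <;> abel)
    (fun c x y => by
      ext i : 2; ext z
      fin_cases i <;> simp [tTriple, smul_smul, smul_sub, mul_left_comm, mul_comm])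
    (fun x y y' => by
      ext i : 2; ext z
      fin_cases i <;> simp [tTriple, add_smul, mul_add] <;> abel)
    (fun c x y => by
      ext i : 2; ext z
      fin_cases i <;> simp [tTriple, smul_smul, smul_sub, mul_left_comm, mul_comm])

/-- The underlying vector space of `𝔤(S, S')`:
`(tri(S) ⊕ tri(S')) ⊕ ι₀(S ⊗ S') ⊕ ι₁(S ⊗ S') ⊕ ι₂(S ⊗ S')`. -/
def Magic (A : SymmetricComposition F S) (A' : SymmetricComposition F S') : Type _ :=
  (A.tri × A'.tri) × (Fin 3 → S ⊗[F] S')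

namespace Magic

instance : AddCommGroup (Magic A A') :=
  Prod.instAddCommGroup (G := A.tri × A'.tri) (H := Fin 3 → S ⊗[F] S')

instance : Module F (Magic A A') :=
  Prod.instModule (M := A.tri × A'.tri) (N := Fin 3 → S ⊗[F] S')

variable {A A'}

/-- The element of `𝔤(S, S')` with component `p` in `tri(S) ⊕ tri(S')`. -/
def ofTri : (A.tri × A'.tri) →ₗ[F] Magic A A' := LinearMap.inl F _ _

/-- The embedding `ι_i` of `S ⊗ S'` into `𝔤(S, S')`. -/
def iota (i : Fin 3) : S ⊗[F] S' →ₗ[F] Magic A A' :=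
  LinearMap.inr F (A.tri × A'.tri) (Fin 3 → S ⊗[F] S') ∘ₗ
    LinearMap.single F (fun _ : Fin 3 => S ⊗[F] S') i

variable (A A') in
/-- `(a ⊗ x, b ⊗ y) ↦ q'(x, y) t_{a,b}`. -/
def tLeft : S ⊗[F] S' →ₗ[F] S ⊗[F] S' →ₗ[F] A.tri :=
  (TensorProduct.map₂ A.t A'.q).compr₂ (TensorProduct.rid F A.tri).toLinearMap

variable (A A') in
/-- `(a ⊗ x, b ⊗ y) ↦ q(a, b) t'_{x,y}`. -/
def tRight : S ⊗[F] S' →ₗ[F] S ⊗[F] S' →ₗ[F] A'.tri :=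
  (TensorProduct.map₂ A.q A'.t).compr₂ (TensorProduct.lid F A'.tri).toLinearMap

/-- The action of `((d₀, d₁, d₂), (d₀', d₁', d₂'))` on `ι_i(S ⊗ S')`:
`a ⊗ x ↦ d_i a ⊗ x + a ⊗ d_i' x`. -/
def act (i : Fin 3) : (A.tri × A'.tri) →ₗ[F] S ⊗[F] S' →ₗ[F] S ⊗[F] S' where
  toFun d := (d.1.1 i).rTensor S' + (d.2.1 i).lTensor S
  map_add' d e := by
    change ((d.1.1 + e.1.1) i).rTensor S' + ((d.2.1 + e.2.1) i).lTensor S = _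
    simp only [Pi.add_apply, LinearMap.rTensor_add, LinearMap.lTensor_add]
    abel
  map_smul' c d := by
    change ((c • d.1.1) i).rTensor S' + ((c • d.2.1) i).lTensor S = _
    simp [LinearMap.rTensor_smul, LinearMap.lTensor_smul]

variable (A A') in
/-- The component in `tri(S) ⊕ tri(S')`. -/
def triPart : Magic A A' →ₗ[F] A.tri × A'.tri := LinearMap.fst F _ _

variable (A A') in
/-- The component `u` in `ι_i(S ⊗ S')`. -/
def iotaPart (i : Fin 3) : Magic A A' →ₗ[F] S ⊗[F] S' :=
  LinearMap.proj i ∘ₗ LinearMap.snd F (A.tri × A'.tri) (Fin 3 → S ⊗[F] S')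

/-- The Lie bracket of `tri(S) ⊕ tri(S')`. -/
def triLie₂ : (A.tri × A'.tri) →ₗ[F] (A.tri × A'.tri) →ₗ[F] (A.tri × A'.tri) :=
  (A.triLie.compl₁₂ (LinearMap.fst F A.tri A'.tri) (LinearMap.fst F A.tri A'.tri)).compr₂
      (LinearMap.inl F A.tri A'.tri) +
    (A'.triLie.compl₁₂ (LinearMap.snd F A.tri A'.tri) (LinearMap.snd F A.tri A'.tri)).compr₂
      (LinearMap.inr F A.tri A'.tri)

/-- `(u, w) ↦ [ι_i u, ι_i w]`, given by
`(a ⊗ x, b ⊗ y) ↦ q'(x, y) θ^i(t_{a,b}) + q(a, b) θ'^i(t'_{x,y})`. -/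
def iotaSame (i : Fin 3) : S ⊗[F] S' →ₗ[F] S ⊗[F] S' →ₗ[F] (A.tri × A'.tri) :=
  (tLeft A A').compr₂ (LinearMap.inl F A.tri A'.tri ∘ₗ A.theta ^ (i : ℕ)) +
    (tRight A A').compr₂ (LinearMap.inr F A.tri A'.tri ∘ₗ A'.theta ^ (i : ℕ))

variable (A A') in
/-- `(a ⊗ x, b ⊗ y) ↦ (a * b) ⊗ (x * y)`. -/
def tensorMul : S ⊗[F] S' →ₗ[F] S ⊗[F] S' →ₗ[F] S ⊗[F] S' :=
  TensorProduct.map₂ A.mul A'.mul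

/-- The product of `𝔤(S, S')`, the sum of its bihomogeneous parts (indices `i` modulo `3`):
the bracket of `tri(S) ⊕ tri(S')`; `[ι_i u, ι_i w]`; `[d, ι_i w] = ι_i (d w)`;
`[ι_i u, e] = -ι_i (e u)`; `[ι_i u, ι_{i+1} w] = ι_{i+2} (u w)`; and
`[ι_{i+1} u, ι_i w] = -ι_{i+2} (w u)`. -/
def bracket : Magic A A' →ₗ[F] Magic A A' →ₗ[F] Magic A A' :=
  (triLie₂.compl₁₂ (triPart A A') (triPart A A')).compr₂ ofTri +
  ∑ i : Fin 3,
    (((iotaSame i).compl₁₂ (iotaPart A A' i) (iotaPart A A' i)).compr₂ ofTri +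
    ((act i).compl₁₂ (triPart A A') (iotaPart A A' i)).compr₂ (iota i) -
    ((act i).compl₁₂ (triPart A A') (iotaPart A A' i)).flip.compr₂ (iota i) +
    ((tensorMul A A').compl₁₂ (iotaPart A A' i) (iotaPart A A' (i + 1))).compr₂ (iota (i + 2)) -
    ((tensorMul A A').compl₁₂ (iotaPart A A' i) (iotaPart A A' (i + 1))).flip.compr₂ (iota (i + 2)))

instance : Bracket (Magic A A') (Magic A A') := ⟨fun X Y => bracket X Y⟩

theorem lie_def (X Y : Magic A A') : ⁅X, Y⁆ = bracket X Y := rfl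

@[simp] theorem triPart_ofTri (d : A.tri × A'.tri) : triPart A A' (ofTri d) = d := rfl

@[simp] theorem iotaPart_ofTri (i : Fin 3) (d : A.tri × A'.tri) :
    iotaPart A A' i (ofTri d) = 0 := rfl

@[simp] theorem triPart_iota (i : Fin 3) (u : S ⊗[F] S') : triPart A A' (iota i u) = 0 := rfl

theorem iotaPart_iota (i j : Fin 3) (u : S ⊗[F] S') :
    iotaPart A A' j (iota i u) = if i = j then u else 0 := by
  change (Pi.single i u : Fin 3 → S ⊗[F] S') j = _
  simp [Pi.single_apply, eq_comm]

theorem lie_eq (X Y : Magic A A') : ⁅X, Y⁆ =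
    ofTri (triLie₂ (triPart A A' X) (triPart A A' Y)) + ∑ i : Fin 3,
      (ofTri (iotaSame i (iotaPart A A' i X) (iotaPart A A' i Y)) +
        iota i (act i (triPart A A' X) (iotaPart A A' i Y)) -
        iota i (act i (triPart A A' Y) (iotaPart A A' i X)) +
        iota (i + 2) (tensorMul A A' (iotaPart A A' i X) (iotaPart A A' (i + 1) Y)) -
        iota (i + 2) (tensorMul A A' (iotaPart A A' i Y) (iotaPart A A' (i + 1) X))) := by
  simp only [lie_def, bracket, LinearMap.add_apply, LinearMap.sum_apply, LinearMap.sub_apply,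
    LinearMap.compr₂_apply, LinearMap.flip_apply, LinearMap.compl₁₂_apply]

theorem lie_ofTri_ofTri (d e : A.tri × A'.tri) :
    ⁅(ofTri d : Magic A A'), (ofTri e : Magic A A')⁆ =
      ofTri (A.triLie d.1 e.1, A'.triLie d.2 e.2) := by
  simp [lie_eq, triLie₂]

theorem lie_ofTri_iota (d : A.tri × A'.tri) (i : Fin 3) (a : S) (x : S') :
    ⁅(ofTri d : Magic A A'), (iota i (a ⊗ₜ[F] x) : Magic A A')⁆ =
      iota i ((d.1.1 i a) ⊗ₜ[F] x + a ⊗ₜ[F] (d.2.1 i x)) := by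
  rw [lie_eq, Finset.sum_eq_single i] <;> simp +contextual [iotaPart_iota, act, eq_comm]

theorem lie_iota_iota_succ (i : Fin 3) (a b : S) (x y : S') :
    ⁅(iota i (a ⊗ₜ[F] x) : Magic A A'), (iota (i + 1) (b ⊗ₜ[F] y) : Magic A A')⁆ =
      iota (i + 2) (A.mul a b ⊗ₜ[F] A'.mul x y) := by
  have hij : ∀ i j : Fin 3, j = i + 1 → i = j + 1 → False := by decide
  rw [lie_eq, Finset.sum_eq_single i]
  · simp [iotaPart_iota, tensorMul]
  · intro j _ hj
    by_cases h1 : j = i + 1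
    · have h2 : ¬ i = j + 1 := fun h2 => hij i j h1 h2
      simp [iotaPart_iota, hj.symm, h2]
    · simp [iotaPart_iota, hj.symm, Ne.symm h1]
  · simp

theorem lie_iota_iota (i : Fin 3) (a b : S) (x y : S') :
    ⁅(iota i (a ⊗ₜ[F] x) : Magic A A'), (iota i (b ⊗ₜ[F] y) : Magic A A')⁆ =
      ofTri (A'.q x y • (A.theta ^ (i : ℕ)) (A.t a b),
        A.q a b • (A'.theta ^ (i : ℕ)) (A'.t x y)) := by
  have h1 : i + 1 ≠ i := by revert i; decide
  have key : iotaSame i (a ⊗ₜ[F] x) (b ⊗ₜ[F] y) =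
      (A'.q x y • (A.theta ^ (i : ℕ)) (A.t a b), A.q a b • (A'.theta ^ (i : ℕ)) (A'.t x y)) := by
    simp [iotaSame, tLeft, tRight]
  rw [lie_eq, Finset.sum_eq_single i, ← key]
  · simp only [triPart_iota, iotaPart_iota, if_true, if_neg h1.symm, map_zero,
      LinearMap.zero_apply, zero_add, add_zero, sub_zero]
  · intro j _ hj
    simp only [triPart_iota, iotaPart_iota, if_neg hj.symm, map_zero,
      LinearMap.zero_apply, add_zero, sub_zero]
  · exact fun h => absurd (Finset.mem_univ i) h

end Magic

end SymmetricComposition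

/-! ### The split para-octonions -/

/-- The data of a two-dimensional vector space `V` with a nonzero alternating bilinear form. -/
structure SymplecticPlane (F V : Type*) [Field F] [AddCommGroup V] [Module F V] where
  /-- the form `⟨a | b⟩` -/
  form : LinearMap.BilinForm F V
  finrank_eq_two : Module.finrank F V = 2
  alt : ∀ v, form v v = 0
  form_ne_zero : form ≠ 0

namespace SymplecticPlane

variable {F V : Type*} [Field F] [AddCommGroup V] [Module F V] (P : SymplecticPlane F V)

theorem neg_form (a b : V) : -P.form a b = P.form b a := LinearMap.IsAlt.neg P.alt a b

theorem exists_coords : ∃ (e f : V) (α β : V →ₗ[F] F), (∀ v, v = α v • e + β v • f) ∧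
    (∀ a b, P.form a b = α a * β b - β a * α b) ∧ α e = 1 ∧ β e = 0 ∧ α f = 0 ∧ β f = 1 := by
  obtain ⟨e, f, hef⟩ : ∃ e f, P.form e f ≠ 0 := by
    by_contra! h
    exact P.form_ne_zero (LinearMap.ext₂ h)
  obtain ⟨f, hf⟩ : ∃ f, P.form e f = 1 := ⟨(P.form e f)⁻¹ • f, by simp [hef]⟩
  have hfe : P.form f e = -1 := by rw [← P.neg_form, hf]
  have hli : LinearIndependent F ![e, f] := by
    rw [LinearIndependent.pair_iff]
    intro s t h
    have h1 := congrArg (P.form e) h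
    have h2 := congrArg (P.form f) h
    simp [P.alt, hf, hfe] at h1 h2
    exact ⟨h2, h1⟩
  have hsp := hli.span_eq_top_of_card_eq_finrank (by simp [P.finrank_eq_two])
  have key : ∀ v, v = (P.form.flip f v) • e + (P.form e v) • f := by
    intro v
    have hv : v ∈ Submodule.span F (Set.range ![e, f]) := hsp ▸ Submodule.mem_top
    simp only [Matrix.range_cons, Matrix.range_empty, Set.union_empty] at hv
    obtain ⟨s, t, rfl⟩ := Submodule.mem_span_pair.1 hv
    simp [P.alt, hf]
  refine ⟨e, f, P.form.flip f, P.form e, key, fun a b => ?_, by simp [hf], P.alt e,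
    by simp [P.alt], hf⟩
  have ha := congrArg (fun v => P.form v b) (key a)
  have hb := congrArg (fun v => P.form f v) (key b)
  simp only [map_add, map_smul, LinearMap.add_apply, LinearMap.smul_apply, smul_eq_mul,
    hfe, P.alt] at ha hb ⊢
  rw [ha, hb]
  ring

/-- The product of the split quaternion algebra `Q = V ⊗ V`. Under the identification of
`a ⊗ b` with the endomorphism `⟨a | ·⟩ b` it is the composition:
`(a ⊗ b)(c ⊗ d) = ⟨a | d⟩ c ⊗ b`. -/
def quatMul : V ⊗[F] V →ₗ[F] V ⊗[F] V →ₗ[F] V ⊗[F] V :=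
  ((TensorProduct.map₂ P.form (TensorProduct.mk F V V).flip).compr₂
    (TensorProduct.lid F (V ⊗[F] V)).toLinearMap).compl₂ (TensorProduct.comm F V V).toLinearMap

@[simp] theorem quatMul_tmul (a b c d : V) :
    P.quatMul (a ⊗ₜ b) (c ⊗ₜ d) = P.form a d • (c ⊗ₜ[F] b) := by
  simp [quatMul]

/-- The endomorphism `⟨a | ·⟩ b` of `V` corresponding to `a ⊗ b`. -/
def toEnd : V ⊗[F] V →ₗ[F] Module.End F V :=
  TensorProduct.lift (LinearMap.smulRightₗ.comp P.form)

theorem toEnd_tmul (a b v : V) : P.toEnd (a ⊗ₜ b) v = P.form a v • b := by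
  simp [toEnd]

theorem toEnd_quatMul (x y : V ⊗[F] V) : P.toEnd (P.quatMul x y) = P.toEnd x * P.toEnd y := by
  induction x with
  | zero => simp
  | add x x' hx hx' => simp [hx, hx', add_mul]
  | tmul a b =>
    induction y with
    | zero => simp
    | add y y' hy hy' => simp [hy, hy', mul_add]
    | tmul c d =>
      ext v
      simp [toEnd_tmul, smul_smul, mul_comm]

/-- The standard involution of the quaternion algebra: `a ⊗ b ↦ -b ⊗ a`. -/
def quatConj : V ⊗[F] V →ₗ[F] V ⊗[F] V := -(TensorProduct.comm F V V).toLinearMap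

@[simp] theorem quatConj_tmul (a b : V) : quatConj (a ⊗ₜ[F] b) = -(b ⊗ₜ[F] a) := by
  simp [quatConj]

/-- The polar form of the norm of the quaternion algebra:
`q(a ⊗ b, c ⊗ d) = ⟨a | c⟩⟨b | d⟩`. -/
def quatForm : LinearMap.BilinForm F (V ⊗[F] V) :=
  (TensorProduct.map₂ P.form P.form).compr₂ (TensorProduct.lid F F).toLinearMap

@[simp] theorem quatForm_tmul (a b c d : V) :
    P.quatForm (a ⊗ₜ b) (c ⊗ₜ d) = P.form a c * P.form b d := by
  simp [quatForm]

/-- The vector space `Q ⊕ Q = V ⊗ V ⊕ V ⊗ V` of the split Cayley algebra. -/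
abbrev Cayley (F V : Type*) [Field F] [AddCommGroup V] [Module F V] : Type _ :=
  (V ⊗[F] V) × (V ⊗[F] V)

/-- The Cayley-Dickson product `(x, y)(x', y') = (x x' - ȳ' y, y' x + y x̄')`. -/
def cayleyMul : Cayley F V →ₗ[F] Cayley F V →ₗ[F] Cayley F V :=
  LinearMap.mk₂ F
    (fun X Y => (P.quatMul X.1 Y.1 - P.quatMul (quatConj Y.2) X.2,
      P.quatMul Y.2 X.1 + P.quatMul X.2 (quatConj Y.1)))
    (fun X X' Y => by ext <;> simp <;> abel)
    (fun c X Y => by ext <;> simp [smul_sub])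
    (fun X Y Y' => by ext <;> simp <;> abel)
    (fun c X Y => by ext <;> simp [smul_sub])

/-- The standard involution `(x, y) ↦ (x̄, -y)` of the Cayley algebra. -/
def cayleyConj : Cayley F V →ₗ[F] Cayley F V := LinearMap.prodMap quatConj (-LinearMap.id)

/-- The polar form of the norm `q(x, y) = q(x) + q(y)` of the Cayley algebra. -/
def cayleyForm : LinearMap.BilinForm F (Cayley F V) :=
  P.quatForm.compl₁₂ (LinearMap.fst F _ _) (LinearMap.fst F _ _) +
    P.quatForm.compl₁₂ (LinearMap.snd F _ _) (LinearMap.snd F _ _)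

theorem cayleyForm_apply (X Y : Cayley F V) :
    P.cayleyForm X Y = P.quatForm X.1 Y.1 + P.quatForm X.2 Y.2 := rfl

/-- The para-Hurwitz product `X • Y = X̄ Ȳ`. -/
def paraMul : Cayley F V →ₗ[F] Cayley F V →ₗ[F] Cayley F V :=
  P.cayleyMul.compl₁₂ cayleyConj cayleyConj

theorem paraMul_apply (X Y : Cayley F V) :
    P.paraMul X Y = (P.quatMul (quatConj X.1) (quatConj Y.1) - P.quatMul (quatConj (-Y.2)) (-X.2),
      P.quatMul (-Y.2) (quatConj X.1) + P.quatMul (-X.2) (quatConj (quatConj Y.1))) := rfl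

theorem cayley_induction {p : Cayley F V → Prop} (X : Cayley F V) (h0 : p 0)
    (hadd : ∀ X Y, p X → p Y → p (X + Y)) (h1 : ∀ a b : V, p (a ⊗ₜ b, 0))
    (h2 : ∀ a b : V, p (0, a ⊗ₜ b)) : p X := by
  obtain ⟨x, y⟩ := X
  have hx : p (x, 0) := by
    induction x with
    | zero => exact h0
    | tmul a b => exact h1 a b
    | add x x' hx hx' => simpa using hadd _ _ hx hx'
  have hy : p (0, y) := by
    induction y with
    | zero => exact h0
    | tmul a b => exact h2 a b
    | add x x' hx hx' => simpa using hadd _ _ hx hx'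
  simpa using hadd _ _ hx hy

theorem form_plucker (a b c d : V) : P.form a b * P.form c d + P.form b c * P.form a d +
    P.form c a * P.form b d = 0 := by
  obtain ⟨e, f, α, β, -, h, -⟩ := P.exists_coords
  simp only [h]; ring

theorem cayleyForm_comm (X Y : Cayley F V) : P.cayleyForm X Y = P.cayleyForm Y X := by
  induction X using cayley_induction with
  | h0 => simp
  | hadd X X' h h' => simp [h, h']
  | h1 a b =>
    induction Y using cayley_induction with
    | h0 => simp
    | hadd X X' h h' => simp [h, h']
    | h1 c d => simp [cayleyForm_apply, ← P.neg_form a, ← P.neg_form b]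
    | h2 c d => simp [cayleyForm_apply]
  | h2 a b =>
    induction Y using cayley_induction with
    | h0 => simp
    | hadd X X' h h' => simp [h, h']
    | h1 c d => simp [cayleyForm_apply]
    | h2 c d => simp [cayleyForm_apply, ← P.neg_form a, ← P.neg_form b]

theorem cayleyForm_regular (X : Cayley F V) (h : ∀ Y, P.cayleyForm X Y = 0) : X = 0 := by
  obtain ⟨e, f, α, β, hv, hform, h1, h2, h3, h4⟩ := P.exists_coords
  have rec1 : ∀ x : V ⊗[F] V, x = P.quatForm x (f ⊗ₜ f) • (e ⊗ₜ e) - P.quatForm x (f ⊗ₜ e) • (e ⊗ₜ f)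
      - P.quatForm x (e ⊗ₜ f) • (f ⊗ₜ e) + P.quatForm x (e ⊗ₜ e) • (f ⊗ₜ[F] f) := by
    intro x
    induction x with
    | zero => simp
    | add x y hx hy =>
      nth_rw 1 [hx, hy]
      simp only [map_add, LinearMap.add_apply, add_smul]
      abel
    | tmul a b =>
      nth_rw 1 [hv a, hv b]
      simp only [quatForm_tmul, hform, h1, h2, h3, h4, TensorProduct.add_tmul,
        TensorProduct.tmul_add, ← TensorProduct.smul_tmul', TensorProduct.tmul_smul]
      module
  have hx : X.1 = 0 := by
    rw [rec1 X.1]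
    have := fun y => h (y, 0)
    simp only [cayleyForm_apply, map_zero, add_zero] at this
    simp [this]
  have hy : X.2 = 0 := by
    rw [rec1 X.2]
    have := fun y => h (0, y)
    simp only [cayleyForm_apply, map_zero, zero_add] at this
    simp [this]
  exact Prod.ext hx hy

theorem cayleyForm_paraMul (X Y Z : Cayley F V) :
    P.cayleyForm (P.paraMul X Y) Z = P.cayleyForm X (P.paraMul Y Z) := by
  obtain ⟨e, f, α, β, -, hform, -⟩ := P.exists_coords
  induction X using cayley_induction with
  | h0 => simp
  | hadd X X' h h' => simp [h, h']
  | h1 a b | h2 a b =>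
    induction Y using cayley_induction with
    | h0 => simp
    | hadd X X' h h' => simp [h, h']
    | h1 c d | h2 c d =>
      induction Z using cayley_induction with
      | h0 => simp
      | hadd X X' h h' => simp [h, h']
      | h1 u v | h2 u v =>
        simp [cayleyForm_apply, paraMul_apply]
        try (simp only [hform]; ring)

theorem paraMul_paraMul (X Y Z W : Cayley F V) :
    P.cayleyForm (P.paraMul (P.paraMul X Y) Z) W + P.cayleyForm (P.paraMul (P.paraMul Z Y) X) W =
      P.cayleyForm X Z * P.cayleyForm Y W := by
  obtain ⟨e, f, α, β, -, hform, -⟩ := P.exists_coords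
  have comb : ∀ {a b c d u v : F}, a + b = c → d + u = v → a + d + (b + u) = c + v := by
    intro a b c d u v h h'
    linear_combination h + h'
  induction X using cayley_induction with
  | h0 => simp
  | hadd X X' h h' =>
    simp only [map_add, LinearMap.add_apply, add_mul]; exact comb h h'
  | h1 a b | h2 a b =>
    induction Y using cayley_induction with
    | h0 => simp
    | hadd X X' h h' =>
      simp only [map_add, LinearMap.add_apply, mul_add]; exact comb h h'
    | h1 c d | h2 c d =>
      induction Z using cayley_induction with
      | h0 => simp
      | hadd X X' h h' =>
        simp only [map_add, LinearMap.add_apply, add_mul]; exact comb h h'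
      | h1 u v | h2 u v =>
        induction W using cayley_induction with
        | h0 => simp
        | hadd X X' h h' =>
          simp only [map_add, mul_add]; exact comb h h'
        | h1 s t | h2 s t =>
          simp [cayleyForm_apply, paraMul_apply]
          try (simp only [hform]; ring)

theorem polar_S8 [NeZero (2 : F)] (X Y : Cayley F V) :
    (LinearMap.BilinMap.toQuadraticMap ((2⁻¹ : F) • P.cayleyForm)).polarBilin X Y =
      P.cayleyForm X Y := by
  have h2 : (2⁻¹ : F) * 2 = 1 := inv_mul_cancel₀ (NeZero.ne 2)
  simp only [LinearMap.BilinMap.polarBilin_toQuadraticMap, LinearMap.add_apply,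
    LinearMap.flip_apply, LinearMap.smul_apply, smul_eq_mul, P.cayleyForm_comm Y X]
  linear_combination P.cayleyForm X Y * h2

/-- The split para-octonion algebra `S₈`, with norm `q(X) = ½ q(X, X)`. -/
def S8 [NeZero (2 : F)] : SymmetricComposition F (Cayley F V) where
  mul := P.paraMul
  norm := LinearMap.BilinMap.toQuadraticMap ((2⁻¹ : F) • P.cayleyForm)
  norm_regular X h := P.cayleyForm_regular X fun Y => by rw [← P.polar_S8]; exact h Y
  norm_mul X Y := by
    have h := P.paraMul_paraMul X Y X Y
    rw [P.cayleyForm_paraMul (P.paraMul X Y) X, ] at h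
    simp only [LinearMap.BilinMap.toQuadraticMap_apply, LinearMap.smul_apply, smul_eq_mul]
    have h2 : (2⁻¹ : F) * 2 = 1 := inv_mul_cancel₀ (NeZero.ne 2)
    linear_combination (2⁻¹ * 2⁻¹ : F) * h - 2⁻¹ * P.cayleyForm (P.paraMul X Y) (P.paraMul X Y) * h2
  polar_mul X Y Z := by
    rw [P.polar_S8, P.polar_S8, P.cayleyForm_paraMul]

/-! ### The modules `V(σ)` and the contractions `φ_{σ,τ}` -/

/-- The symplectic Lie algebra `sp(V)`, as a subspace of `End(V)`. -/
def sp : Submodule F (Module.End F V) := P.form.skewAdjointSubmodule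

theorem mem_sp {s : Module.End F V} :
    s ∈ P.sp ↔ ∀ v w, P.form (s v) w = -P.form v (s w) := by
  simp [sp, LinearMap.IsSkewAdjoint, LinearMap.IsAdjointPair]

theorem lie_mem_sp {s s' : Module.End F V} (h : s ∈ P.sp) (h' : s' ∈ P.sp) :
    s * s' - s' * s ∈ P.sp := by
  rw [mem_sp] at *
  intro v w
  simp [h, h']

/-- The Lie bracket (commutator) of `sp(V)`. -/
def spLie : P.sp →ₗ[F] P.sp →ₗ[F] P.sp :=
  LinearMap.mk₂ F (fun s s' => ⟨s.1 * s'.1 - s'.1 * s.1, P.lie_mem_sp s.2 s'.2⟩)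
    (fun _ _ _ => Subtype.ext <| by simp; noncomm_ring)
    (fun _ _ _ => Subtype.ext <| by simp [smul_sub])
    (fun _ _ _ => Subtype.ext <| by simp; noncomm_ring)
    (fun _ _ _ => Subtype.ext <| by simp [smul_sub])

theorem gamma_mem (a b : V) :
    (P.form a).smulRight b + (P.form b).smulRight a ∈ P.sp := by
  rw [mem_sp]
  intro v w
  simp only [LinearMap.add_apply, LinearMap.smulRight_apply, map_add, map_smul,
    LinearMap.smul_apply, smul_eq_mul]
  rw [← P.neg_form v a, ← P.neg_form v b]
  ring

/-- `γ_{a,b} = ⟨a | ·⟩ b + ⟨b | ·⟩ a`. -/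
def gamma : V →ₗ[F] V →ₗ[F] P.sp :=
  LinearMap.mk₂ F (fun a b => ⟨(P.form a).smulRight b + (P.form b).smulRight a, P.gamma_mem a b⟩)
    (fun _ _ _ => Subtype.ext <| LinearMap.ext fun _ => by simp [add_smul]; abel)
    (fun _ _ _ => Subtype.ext <| LinearMap.ext fun _ => by simp [smul_smul, mul_comm])
    (fun _ _ _ => Subtype.ext <| LinearMap.ext fun _ => by simp [add_smul]; abel)
    (fun _ _ _ => Subtype.ext <| LinearMap.ext fun _ => by simp [smul_smul, mul_comm])

/-- The bilinear map on `V^{⊗A} × V^{⊗B}` given by a multilinear map in the variables `A ⊔ B`. -/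
def biLift {A B N : Type*} [AddCommGroup N] [Module F N]
    (m : MultilinearMap F (fun _ : A ⊕ B => V) N) :
    (⨂[F] _ : A, V) →ₗ[F] (⨂[F] _ : B, V) →ₗ[F] N :=
  TensorProduct.curry (PiTensorProduct.lift m ∘ₗ (PiTensorProduct.tmulEquiv F V).toLinearMap)

theorem biLift_tprod {A B N : Type*} [AddCommGroup N] [Module F N]
    (m : MultilinearMap F (fun _ : A ⊕ B => V) N) (a : A → V) (b : B → V) :
    biLift m (PiTensorProduct.tprod F a) (PiTensorProduct.tprod F b) = m (Sum.elim a b) := by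
  simp [biLift]

/-- Given a family of variables `J = p(K) ⊔ q(K) ⊔ e(L)` and a multilinear map `G` in the variables
`L`, the multilinear map `u ↦ (∏_{k ∈ K} ⟨u_{p(k)} | u_{q(k)}⟩) G((u_{e(l)})_l)`. -/
def pairMap {J K L N : Type*} [Fintype K] [AddCommGroup N] [Module F N] (p q : K → J) (e : L → J)
    (h : Function.Bijective (Sum.elim (Sum.elim p q) e))
    (G : MultilinearMap F (fun _ : L => V) N) : MultilinearMap F (fun _ : J => V) N :=
  have key : ∀ [DecidableEq J] (j : J), ∃ (ψ : (J → V) → V →ₗ[F] N), ∀ u x,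
      (∏ k, P.form (Function.update u j x (p k)) (Function.update u j x (q k))) •
        G (fun l => Function.update u j x (e l)) = ψ u x := by
    classical
    intro _ j
    have hp : Function.Injective p := fun a b hab => by
      simpa using @h.1 (Sum.inl (Sum.inl a)) (Sum.inl (Sum.inl b)) (by simpa using hab)
    have hq : Function.Injective q := fun a b hab => by
      simpa using @h.1 (Sum.inl (Sum.inr a)) (Sum.inl (Sum.inr b)) (by simpa using hab)
    have he : Function.Injective e := fun a b hab => by
      simpa using @h.1 (Sum.inr a) (Sum.inr b) (by simpa using hab)
    have hpq : ∀ a b, p a ≠ q b := fun a b hab => by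
      simpa using @h.1 (Sum.inl (Sum.inl a)) (Sum.inl (Sum.inr b)) (by simpa using hab)
    have hpe : ∀ a b, p a ≠ e b := fun a b hab => by
      simpa using @h.1 (Sum.inl (Sum.inl a)) (Sum.inr b) (by simpa using hab)
    have hqe : ∀ a b, q a ≠ e b := fun a b hab => by
      simpa using @h.1 (Sum.inl (Sum.inr a)) (Sum.inr b) (by simpa using hab)
    obtain ⟨i, rfl⟩ := h.2 j
    rcases i with (k | k) | l
    · refine ⟨fun u => (P.form.flip (u (q k))).smulRight
        ((∏ i ∈ Finset.univ.erase k, P.form (u (p i)) (u (q i))) • G (fun l => u (e l))), ?_⟩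
      intro u x
      have h1 : (fun l => Function.update u (p k) x (e l)) = fun l => u (e l) :=
        funext fun l => Function.update_of_ne (hpe k l).symm _ _
      have h2 : ∀ i ∈ Finset.univ.erase k, P.form (Function.update u (p k) x (p i))
          (Function.update u (p k) x (q i)) = P.form (u (p i)) (u (q i)) := fun i hi => by
        rw [Function.update_of_ne (hp.ne (Finset.ne_of_mem_erase hi)),
          Function.update_of_ne (hpq k i).symm]
      simp only [Sum.elim_inl]
      rw [h1, ← Finset.mul_prod_erase _ _ (Finset.mem_univ k), Finset.prod_congr rfl h2,
        Function.update_self, Function.update_of_ne (hpq k k).symm, mul_smul]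
      rfl
    · refine ⟨fun u => (P.form (u (p k))).smulRight
        ((∏ i ∈ Finset.univ.erase k, P.form (u (p i)) (u (q i))) • G (fun l => u (e l))), ?_⟩
      intro u x
      have h1 : (fun l => Function.update u (q k) x (e l)) = fun l => u (e l) :=
        funext fun l => Function.update_of_ne (hqe k l).symm _ _
      have h2 : ∀ i ∈ Finset.univ.erase k, P.form (Function.update u (q k) x (p i))
          (Function.update u (q k) x (q i)) = P.form (u (p i)) (u (q i)) := fun i hi => by
        rw [Function.update_of_ne (hq.ne (Finset.ne_of_mem_erase hi)),
          Function.update_of_ne (hpq i k)]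
      simp only [Sum.elim_inl, Sum.elim_inr]
      rw [h1, ← Finset.mul_prod_erase _ _ (Finset.mem_univ k), Finset.prod_congr rfl h2,
        Function.update_self, Function.update_of_ne (hpq k k), mul_smul]
      rfl
    · refine ⟨fun u => (∏ i, P.form (u (p i)) (u (q i))) • G.toLinearMap (fun l => u (e l)) l, ?_⟩
      intro u x
      have h1 : (fun i => Function.update u (e l) x (e i)) =
          Function.update (fun i => u (e i)) l x :=
        Function.update_comp_eq_of_injective' u he l x
      have h2 : ∀ i ∈ Finset.univ, P.form (Function.update u (e l) x (p i))
          (Function.update u (e l) x (q i)) = P.form (u (p i)) (u (q i)) := fun i _ => by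
        rw [Function.update_of_ne (hpe i l), Function.update_of_ne (hqe i l)]
      simp only [Sum.elim_inr]
      rw [h1, Finset.prod_congr rfl h2]
      rfl
  { toFun := fun u => (∏ k, P.form (u (p k)) (u (q k))) • G (fun l => u (e l))
    map_update_add' := fun u j x y => by
      obtain ⟨ψ, hψ⟩ := key j
      rw [hψ, hψ, hψ, map_add]
    map_update_smul' := fun u j c x => by
      obtain ⟨ψ, hψ⟩ := key j
      rw [hψ, hψ, map_smul] }

theorem pairMap_apply {J K L N : Type*} [Fintype K] [AddCommGroup N] [Module F N] (p q : K → J)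
    (e : L → J) (h : Function.Bijective (Sum.elim (Sum.elim p q) e))
    (G : MultilinearMap F (fun _ : L => V) N) (u : J → V) :
    P.pairMap p q e h G u = (∏ k, P.form (u (p k)) (u (q k))) • G (fun l => u (e l)) := rfl

variable {n : ℕ}

/-- The index of the first copy of `i ∈ σ ∩ τ` in `σ ⊔ τ`. -/
def idxLeft (σ τ : Finset (Fin n)) (i : ↥(σ ∩ τ)) : σ ⊕ τ :=
  Sum.inl ⟨i, (Finset.mem_inter.1 i.2).1⟩

/-- The index of the second copy of `i ∈ σ ∩ τ` in `σ ⊔ τ`. -/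
def idxRight (σ τ : Finset (Fin n)) (i : ↥(σ ∩ τ)) : σ ⊕ τ :=
  Sum.inr ⟨i, (Finset.mem_inter.1 i.2).2⟩

/-- The index of `i ∈ σ + τ` in `σ ⊔ τ`. -/
def idxRest (σ τ : Finset (Fin n)) (i : ↥(symmDiff σ τ)) : σ ⊕ τ :=
  if hi : (i : Fin n) ∈ σ then Sum.inl ⟨i, hi⟩ else
    Sum.inr ⟨i, by have := Finset.mem_symmDiff.1 i.2; tauto⟩

theorem idx_bijective (σ τ : Finset (Fin n)) :
    Function.Bijective (Sum.elim (Sum.elim (idxLeft σ τ) (idxRight σ τ)) (idxRest σ τ)) := by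
  constructor
  · rintro ((⟨a, ha⟩ | ⟨a, ha⟩) | ⟨a, ha⟩) ((⟨b, hb⟩ | ⟨b, hb⟩) | ⟨b, hb⟩) hab <;>
      simp only [Sum.elim_inl, Sum.elim_inr, idxLeft, idxRight, idxRest] at hab <;>
      simp only [Finset.mem_inter, Finset.mem_symmDiff] at ha hb <;>
      (try split_ifs at hab) <;> simp_all <;> grind
  · rintro (⟨a, ha⟩ | ⟨a, ha⟩)
    · by_cases h : a ∈ τ
      · exact ⟨Sum.inl (Sum.inl ⟨a, Finset.mem_inter.2 ⟨ha, h⟩⟩), rfl⟩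
      · exact ⟨Sum.inr ⟨a, Finset.mem_symmDiff.2 (Or.inl ⟨ha, h⟩)⟩, by simp [idxRest, ha]⟩
    · by_cases h : a ∈ σ
      · exact ⟨Sum.inl (Sum.inr ⟨a, Finset.mem_inter.2 ⟨h, ha⟩⟩), rfl⟩
      · exact ⟨Sum.inr ⟨a, Finset.mem_symmDiff.2 (Or.inr ⟨ha, h⟩)⟩, by simp [idxRest, h]⟩

theorem pair_bijective {σ : Finset (Fin n)} (j : σ) : Function.Bijective
    (Sum.elim (Sum.elim (fun k : {k : σ // k ≠ j} => (Sum.inl k.1 : σ ⊕ σ))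
      (fun k : {k : σ // k ≠ j} => (Sum.inr k.1 : σ ⊕ σ))) ![Sum.inl j, Sum.inr j]) := by
  constructor
  · rintro ((⟨a, ha⟩ | ⟨a, ha⟩) | a) ((⟨b, hb⟩ | ⟨b, hb⟩) | b) hab <;>
      (try fin_cases a) <;> (try fin_cases b) <;> simp_all <;> exact hb hab.symm
  · rintro (a | a)
    · by_cases h : a = j
      · exact ⟨Sum.inr 0, by simp [h]⟩
      · exact ⟨Sum.inl (Sum.inl ⟨a, h⟩), rfl⟩
    · by_cases h : a = j
      · exact ⟨Sum.inr 1, by simp [h]⟩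
      · exact ⟨Sum.inl (Sum.inr ⟨a, h⟩), rfl⟩

/-- The contraction `⨂_{i ∈ σ} V_i × ⨂_{i ∈ τ} V_i → ⨂_{i ∈ σ + τ} V_i` by means of `⟨· | ·⟩` in the
indices `i ∈ σ ∩ τ`. -/
def contract (σ τ : Finset (Fin n)) : (⨂[F] _ : σ, V) →ₗ[F] (⨂[F] _ : τ, V) →ₗ[F]
    (⨂[F] _ : ↥(symmDiff σ τ), V) :=
  biLift (P.pairMap (idxLeft σ τ) (idxRight σ τ) (idxRest σ τ)
    (idx_bijective σ τ) (PiTensorProduct.tprod F))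

/-- `γ` as a multilinear map in two variables. -/
def gammaMultilinear : MultilinearMap F (fun _ : Fin 2 => V) P.sp where
  toFun u := P.gamma (u 0) (u 1)
  map_update_add' u i x y := by fin_cases i <;> simp
  map_update_smul' u i c x := by fin_cases i <;> simp

/-- The map `⨂_{i ∈ σ} V_i × ⨂_{i ∈ σ} V_i → sp(V)^n`,
`(v, w) ↦ -½ ∑_{j ∈ σ} (∏_{k ∈ σ, k ≠ j} ⟨v_k | w_k⟩) ν_j(γ_{v_j,w_j})`, where `ν_j` is the inclusion
of the `j`-th component. -/
def selfContract (σ : Finset (Fin n)) :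
    (⨂[F] _ : σ, V) →ₗ[F] (⨂[F] _ : σ, V) →ₗ[F] (Fin n → P.sp) :=
  (-(2⁻¹ : F)) • ∑ j : σ, (biLift (P.pairMap (K := {k : σ // k ≠ j}) (L := Fin 2)
    (fun k => Sum.inl k.1) (fun k => Sum.inr k.1) ![Sum.inl j, Sum.inr j]
    (pair_bijective j) P.gammaMultilinear)).compr₂ (LinearMap.single F (fun _ : Fin n => P.sp) j)

/-- The natural action of `sp(V)^n` on `⨂_{i ∈ σ} V_i`, where the `j`-th component acts on `V_j`. -/
def tensorAct (σ : Finset (Fin n)) :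
    (Fin n → P.sp) →ₗ[F] (⨂[F] _ : σ, V) →ₗ[F] (⨂[F] _ : σ, V) where
  toFun s := ∑ j : σ, PiTensorProduct.map (Function.update (fun _ => LinearMap.id) j (s j).1)
  map_add' s s' := by
    rw [← Finset.sum_add_distrib]
    refine Finset.sum_congr rfl fun j _ => ?_
    exact PiTensorProduct.map_update_add _ _ _ _
  map_smul' c s := by
    rw [RingHom.id_apply, Finset.smul_sum]
    refine Finset.sum_congr rfl fun j _ => ?_
    exact PiTensorProduct.map_update_smul _ _ _ _

/-- The identity `⨂_{i ∈ σ} V_i = ⨂_{i ∈ τ} V_i` for `σ = τ`. -/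
def castTensor {σ τ : Finset (Fin n)} (h : σ = τ) : (⨂[F] _ : σ, V) ≃ₗ[F] (⨂[F] _ : τ, V) :=
  PiTensorProduct.reindex F (fun _ => V) (Equiv.subtypeEquivRight fun i => by rw [h])

/-- The `sp(V)^n`-module `V(σ)`: it is `sp(V)^n` if `σ = ∅`, and `⨂_{i ∈ σ} V_i` otherwise.
(A function out of `PLift p` is a single value if `p` is true, and no data if `p` is false;
see `VMod.emptyEquiv` and `VMod.tensorEquiv`.) -/
abbrev VMod (σ : Finset (Fin n)) : Type _ :=
  (PLift (σ = ∅) → (Fin n → P.sp)) × (PLift (σ ≠ ∅) → ⨂[F] _ : σ, V)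

namespace VMod

/-- `V(∅) = sp(V)^n`. -/
def emptyEquiv : P.VMod (∅ : Finset (Fin n)) ≃ₗ[F] (Fin n → P.sp) where
  toFun x := x.1 ⟨rfl⟩
  map_add' _ _ := rfl
  map_smul' _ _ := rfl
  invFun s := (fun _ => s, 0)
  left_inv _ := Prod.ext rfl (funext fun h => absurd rfl h.down)
  right_inv _ := rfl

/-- `V(σ) = ⨂_{i ∈ σ} V_i` for `σ ≠ ∅`. -/
def tensorEquiv {σ : Finset (Fin n)} (hσ : σ ≠ ∅) : P.VMod σ ≃ₗ[F] (⨂[F] _ : σ, V) where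
  toFun x := x.2 ⟨hσ⟩
  map_add' _ _ := rfl
  map_smul' _ _ := rfl
  invFun t := (0, fun _ => t)
  left_inv _ := Prod.ext (funext fun h => absurd h.down hσ) rfl
  right_inv _ := rfl

/-- The canonical map `V(σ) → sp(V)^n` for `σ = ∅`. -/
def atEmpty {σ : Finset (Fin n)} (h : σ = ∅) : P.VMod σ →ₗ[F] (Fin n → P.sp) :=
  LinearMap.proj ⟨h⟩ ∘ₗ LinearMap.fst F _ _

/-- The canonical map `V(σ) → ⨂_{i ∈ σ} V_i` for `σ ≠ ∅`. -/
def atTensor {σ : Finset (Fin n)} (h : σ ≠ ∅) : P.VMod σ →ₗ[F] (⨂[F] _ : σ, V) :=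
  LinearMap.proj ⟨h⟩ ∘ₗ LinearMap.snd F _ _

/-- The element `s = (s_1, …, s_n)` of `V(∅) = sp(V)^n`. -/
def ofSp (s : Fin n → P.sp) : P.VMod (∅ : Finset (Fin n)) := (fun _ => s, 0)

/-- The element `⨂_{i ∈ σ} v_i` of `V(σ)`, for `σ ≠ ∅`. -/
def pure (σ : Finset (Fin n)) (v : Fin n → V) : P.VMod σ :=
  (0, fun _ => PiTensorProduct.tprod F fun i : σ => v i)

end VMod

theorem symmDiff_eq_empty {σ τ : Finset (Fin n)} : symmDiff σ τ = ∅ ↔ σ = τ := symmDiff_eq_bot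

/-- The Lie bracket of `sp(V)^n`. -/
def spPowLie : (Fin n → P.sp) →ₗ[F] (Fin n → P.sp) →ₗ[F] (Fin n → P.sp) :=
  LinearMap.mk₂ F (fun s s' i => P.spLie (s i) (s' i))
    (fun _ _ _ => funext fun _ => by simp) (fun _ _ _ => funext fun _ => by simp)
    (fun _ _ _ => funext fun _ => by simp) (fun _ _ _ => funext fun _ => by simp)

/-- The maps `φ_{σ,τ}` with values in `V(∅)`, that is, for `σ = τ`: the Lie bracket of `sp(V)^n` if
`σ = τ = ∅`, and `selfContract` if `σ = τ ≠ ∅`. -/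
def phiEmpty {σ τ : Finset (Fin n)} (h : σ = τ) :
    P.VMod σ →ₗ[F] P.VMod τ →ₗ[F] (Fin n → P.sp) :=
  if hσ : σ = ∅ then
    P.spPowLie.compl₁₂ (VMod.atEmpty P hσ) (VMod.atEmpty P (h.symm.trans hσ))
  else
    (P.selfContract σ).compl₁₂ (VMod.atTensor P hσ)
      ((castTensor h.symm).toLinearMap ∘ₗ VMod.atTensor P (fun hτ => hσ (h.trans hτ)))

/-- The maps `φ_{σ,τ}` for `σ ≠ τ`: the natural action of `sp(V)^n` on `V(τ)` if `σ = ∅`, minus the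
natural action on `V(σ)` if `τ = ∅`, and the contraction otherwise. -/
def phiTensor {σ τ : Finset (Fin n)} (h : σ ≠ τ) :
    P.VMod σ →ₗ[F] P.VMod τ →ₗ[F] (⨂[F] _ : ↥(symmDiff σ τ), V) :=
  if hσ : σ = ∅ then
    ((P.tensorAct τ).compl₁₂ (VMod.atEmpty P hσ)
      (VMod.atTensor P (fun hτ => h (hσ.trans hτ.symm)))).compr₂
        (castTensor (by rw [hσ]; exact (bot_symmDiff τ).symm)).toLinearMap
  else if hτ : τ = ∅ then
    -((P.tensorAct σ).compl₁₂ (VMod.atEmpty P hτ) (VMod.atTensor P hσ)).flip.compr₂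
        (castTensor (by rw [hτ]; exact (symmDiff_bot σ).symm)).toLinearMap
  else
    (P.contract σ τ).compl₁₂ (VMod.atTensor P hσ) (VMod.atTensor P hτ)

/-- The natural `sp(V)^n`-invariant maps `φ_{σ,τ} : V(σ) × V(τ) → V(σ + τ)`, where `σ + τ` is the
symmetric difference. -/
def phi (σ τ : Finset (Fin n)) : P.VMod σ →ₗ[F] P.VMod τ →ₗ[F] P.VMod (symmDiff σ τ) :=
  LinearMap.mk₂ F
    (fun x y => (fun h => P.phiEmpty (symmDiff_eq_empty.1 h.down) x y,
      fun h => P.phiTensor (fun h' => h.down (symmDiff_eq_empty.2 h')) x y))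
    (fun _ _ _ => Prod.ext (funext fun _ => by simp) (funext fun _ => by simp))
    (fun _ _ _ => Prod.ext (funext fun _ => by simp) (funext fun _ => by simp))
    (fun _ _ _ => Prod.ext (funext fun _ => by simp) (funext fun _ => by simp))
    (fun _ _ _ => Prod.ext (funext fun _ => by simp) (funext fun _ => by simp))

/-- `φ_{∅,∅}` is the Lie bracket of `sp(V)^n`. -/
theorem phi_ofSp_ofSp (s s' : Fin n → P.sp) (i : Fin n) :
    ((P.phi ∅ ∅ (VMod.ofSp P s) (VMod.ofSp P s')).1 ⟨symmDiff_self _⟩ i : Module.End F V) =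
      (s i).1 * (s' i).1 - (s' i).1 * (s i).1 := by
  simp only [phi, phiEmpty, LinearMap.mk₂_apply, dite_true]
  rfl

theorem castTensor_tprod {σ τ : Finset (Fin n)} (h : σ = τ) (v : Fin n → V) :
    castTensor h (PiTensorProduct.tprod F fun i : σ => v i) =
      PiTensorProduct.tprod F fun i : τ => v i := by
  simp only [castTensor]
  erw [PiTensorProduct.reindex_tprod]
  rfl

/-- `φ_{∅,σ}` is the natural action. -/
theorem phi_ofSp_pure {σ : Finset (Fin n)} (hσ : σ ≠ ∅) (s : Fin n → P.sp) (v : Fin n → V) :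
    P.phi ∅ σ (VMod.ofSp P s) (VMod.pure P σ v) =
      ∑ j ∈ σ, VMod.pure P (symmDiff ∅ σ) (Function.update v j ((s j).1 (v j))) := by
  refine Prod.ext (funext fun h => absurd (symmDiff_eq_empty.1 h.down) hσ.symm)
    (funext fun h => ?_)
  have h1 : (P.phi ∅ σ (VMod.ofSp P s) (VMod.pure P σ v)).2 h =
      castTensor (bot_symmDiff σ).symm
        (P.tensorAct σ s (PiTensorProduct.tprod F fun i : σ => v i)) := by
    simp only [phi, phiTensor, LinearMap.mk₂_apply, dite_true]
    rfl
  rw [h1, Prod.snd_sum, Finset.sum_apply, ← Finset.sum_coe_sort σ]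
  simp only [tensorAct, LinearMap.coe_mk, AddHom.coe_mk, LinearMap.sum_apply, map_sum,
    PiTensorProduct.map_tprod]
  refine Finset.sum_congr rfl fun j _ => ?_
  have h2 : (fun i : σ => Function.update (fun _ => LinearMap.id) j (s j).1 i (v i)) =
      fun i : σ => Function.update v j ((s j).1 (v j)) i := by
    funext i
    rcases eq_or_ne i j with rfl | hij
    · simp
    · rw [Function.update_of_ne hij, Function.update_of_ne (fun h => hij (Subtype.ext h))]
      rfl
  rw [h2, castTensor_tprod]
  rfl

/-- `φ_{σ,∅}` is minus the natural action. -/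
theorem phi_pure_ofSp {σ : Finset (Fin n)} (hσ : σ ≠ ∅) (s : Fin n → P.sp) (v : Fin n → V) :
    P.phi σ ∅ (VMod.pure P σ v) (VMod.ofSp P s) =
      -∑ j ∈ σ, VMod.pure P (symmDiff σ ∅) (Function.update v j ((s j).1 (v j))) := by
  refine Prod.ext (funext fun h => absurd (symmDiff_eq_empty.1 h.down) hσ)
    (funext fun h => ?_)
  have h1 : (P.phi σ ∅ (VMod.pure P σ v) (VMod.ofSp P s)).2 h =
      -castTensor (symmDiff_bot σ).symm
        (P.tensorAct σ s (PiTensorProduct.tprod F fun i : σ => v i)) := by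
    simp only [phi, phiTensor, LinearMap.mk₂_apply, dif_neg hσ, dite_true]
    rfl
  rw [h1, Prod.snd_neg, Prod.snd_sum, Pi.neg_apply, Finset.sum_apply, ← Finset.sum_coe_sort σ]
  simp only [tensorAct, LinearMap.coe_mk, AddHom.coe_mk, LinearMap.sum_apply, map_sum,
    PiTensorProduct.map_tprod]
  congr 1
  refine Finset.sum_congr rfl fun j _ => ?_
  have h2 : (fun i : σ => Function.update (fun _ => LinearMap.id) j (s j).1 i (v i)) =
      fun i : σ => Function.update v j ((s j).1 (v j)) i := by
    funext i
    rcases eq_or_ne i j with rfl | hij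
    · simp
    · rw [Function.update_of_ne hij, Function.update_of_ne (fun h => hij (Subtype.ext h))]
      rfl
  rw [h2, castTensor_tprod]
  rfl

/-- `φ_{σ,σ}` is given by `-½ ∑_{j ∈ σ} (∏_{k ∈ σ, k ≠ j} ⟨v_k | w_k⟩) ν_j(γ_{v_j,w_j})`. -/
theorem phi_pure_self {σ : Finset (Fin n)} (hσ : σ ≠ ∅) (v w : Fin n → V) :
    (P.phi σ σ (VMod.pure P σ v) (VMod.pure P σ w)).1 ⟨symmDiff_self _⟩ =
      -(2⁻¹ : F) • ∑ j ∈ σ, (∏ k ∈ σ.erase j, P.form (v k) (w k)) •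
        (Pi.single j (P.gamma (v j) (w j)) : Fin n → P.sp) := by
  have h1 : (P.phi σ σ (VMod.pure P σ v) (VMod.pure P σ w)).1 ⟨symmDiff_self _⟩ =
      P.selfContract σ (PiTensorProduct.tprod F fun i : σ => v i)
        (castTensor rfl (PiTensorProduct.tprod F fun i : σ => w i)) := by
    simp only [phi, phiEmpty, LinearMap.mk₂_apply, dif_neg hσ]
    rfl
  rw [h1, castTensor_tprod, ← Finset.sum_coe_sort σ]
  simp only [selfContract, LinearMap.smul_apply, LinearMap.sum_apply, LinearMap.compr₂_apply,
    biLift_tprod, pairMap_apply, map_smul]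
  congr 1
  refine Finset.sum_congr rfl fun j _ => ?_
  congr 1
  refine Finset.prod_bij (fun (k : {k : σ // k ≠ j}) _ => (k.1.1 : Fin n)) ?_ ?_ ?_ ?_
  · rintro ⟨⟨k, hk⟩, hkj⟩ -
    exact Finset.mem_erase.2 ⟨fun h => hkj (Subtype.ext h), hk⟩
  · rintro ⟨⟨k, hk⟩, hkj⟩ - ⟨⟨l, hl⟩, hlj⟩ - hkl
    simpa using hkl
  · intro k hk
    obtain ⟨hkj, hk⟩ := Finset.mem_erase.1 hk
    exact ⟨⟨⟨k, hk⟩, fun h => hkj (congrArg Subtype.val h)⟩, Finset.mem_univ _, rfl⟩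
  · intros
    rfl

/-- `φ_{σ,τ}` is given by `(∏_{k ∈ σ ∩ τ} ⟨v_k | w_k⟩) (⨂_{i ∈ σ ∖ τ} v_i) ⊗ (⨂_{i ∈ τ ∖ σ} w_i)` if
`∅ ≠ σ ≠ τ ≠ ∅`. -/
theorem phi_pure_pure {σ τ : Finset (Fin n)} (hσ : σ ≠ ∅) (hτ : τ ≠ ∅) (h : σ ≠ τ)
    (v w : Fin n → V) :
    P.phi σ τ (VMod.pure P σ v) (VMod.pure P τ w) =
      (∏ k ∈ σ ∩ τ, P.form (v k) (w k)) •
        VMod.pure P (symmDiff σ τ) (fun i => if i ∈ σ then v i else w i) := by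
  refine Prod.ext (funext fun h' => absurd (symmDiff_eq_empty.1 h'.down) h)
    (funext fun h' => ?_)
  have h1 : (P.phi σ τ (VMod.pure P σ v) (VMod.pure P τ w)).2 h' =
      P.contract σ τ (PiTensorProduct.tprod F fun i : σ => v i)
        (PiTensorProduct.tprod F fun i : τ => w i) := by
    simp only [phi, phiTensor, LinearMap.mk₂_apply, dif_neg hσ, dif_neg hτ]
    rfl
  rw [h1, contract, biLift_tprod, pairMap_apply, ← Finset.prod_coe_sort (σ ∩ τ)]
  simp only [Sum.elim_inl, Sum.elim_inr, Prod.smul_snd, Pi.smul_apply, VMod.pure, idxLeft, idxRight]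
  congr 2
  funext i
  simp only [idxRest]
  split_ifs <;> rfl

end SymplecticPlane

end E8Model

namespace E8Model

/-! ### The set `𝒮_{𝔢₈}` and the signs `ε_{𝔢₈}`

The indices `1, …, 8` are represented by the elements `0, …, 7` of `Fin 8`. -/

/-- The elements of `𝒮_{𝔢₈}`, in the order used in the table `epsTable`. -/
def calSList : List (Finset (Fin 8)) :=
  [∅, {0, 1, 4, 5}, {1, 2, 5, 6}, {0, 2, 4, 6}, {0, 1, 2, 3}, {2, 3, 4, 5}, {0, 3, 5, 6},
    {1, 3, 4, 6}, {2, 3, 6, 7}, {0, 3, 4, 7}, {1, 3, 5, 7}, {4, 5, 6, 7}, {0, 1, 6, 7},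
    {1, 2, 4, 7}, {0, 2, 5, 7}]

/-- The set `𝒮_{𝔢₈}` of subsets of `{1, …, 8}`. -/
def calS : Finset (Finset (Fin 8)) := calSList.toFinset

/-- The table of the signs `ε_{𝔢₈}`, with rows and columns indexed by `calSList`. The entry `0`
stands for a blank entry of the table (these are the `(σ, τ)` with `σ + τ = {1, …, 8}`). -/
def epsTable : List (List ℤ) :=
  [[1, 1, 1, 1, 1, 1, 1, 1, 1, 1, 1, 1, 1, 1, 1],
    [1, -1, 1, -1, 1, -1, -1, 1, 0, 1, -1, 1, -1, -1, 1],
    [1, -1, -1, 1, 1, 1, -1, -1, -1, 0, 1, 1, 1, -1, -1],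
    [1, 1, -1, -1, 1, -1, 1, -1, 1, -1, 0, 1, -1, 1, -1],
    [1, -1, -1, -1, -1, 1, 1, 1, 1, 1, 1, 0, -1, -1, -1],
    [1, 1, -1, 1, -1, -1, -1, 1, -1, 1, -1, 1, 0, 1, -1],
    [1, 1, 1, -1, -1, 1, -1, -1, -1, -1, 1, 1, -1, 0, 1],
    [1, -1, 1, 1, -1, -1, 1, -1, 1, -1, -1, 1, 1, -1, 0],
    [1, 0, 1, -1, -1, 1, 1, -1, -1, 1, -1, -1, 1, 1, -1],
    [1, -1, 0, 1, -1, -1, 1, 1, -1, -1, 1, -1, -1, 1, 1],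
    [1, 1, -1, 0, -1, 1, -1, 1, 1, -1, -1, -1, 1, -1, 1],
    [1, -1, -1, -1, 0, -1, -1, -1, 1, 1, 1, -1, 1, 1, 1],
    [1, 1, -1, 1, 1, 0, 1, -1, -1, 1, -1, -1, -1, -1, 1],
    [1, 1, 1, -1, 1, -1, 0, 1, -1, -1, 1, -1, 1, -1, -1],
    [1, -1, 1, 1, 1, 1, -1, 0, 1, -1, -1, -1, -1, 1, -1]]

/-- The sign `ε_{𝔢₈}(σ, τ)`, read off the table (`0` if there is no entry). -/
def epsE8 (σ τ : Finset (Fin 8)) : ℤ :=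
  (epsTable.getD (calSList.idxOf σ) []).getD (calSList.idxOf τ) 0

/-- The `ℤ₂`-linear map `χ₄ : ℤ₂⁴ → ℤ₂⁸`. -/
def chi4 : (Fin 4 → ZMod 2) →ₗ[ZMod 2] (Fin 8 → ZMod 2) where
  toFun x := ![x 0 + x 2 + x 3, x 0 + x 1 + x 2 + x 3, x 1 + x 2 + x 3, x 2 + x 3, x 0 + x 3,
    x 0 + x 1 + x 3, x 1 + x 3, x 3]
  map_add' x y := by
    ext i
    fin_cases i <;> simp <;> ring
  map_smul' c x := by
    ext i
    fin_cases i <;> simp <;> ring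

/-- The subset of `{1, …, 8}` with characteristic function `v ∈ ℤ₂⁸`. -/
def toSubset (v : Fin 8 → ZMod 2) : Finset (Fin 8) := Finset.univ.filter fun i => v i = 1

/-- The subset of `{1, …, 8}` given by `χ₄(x)`. -/
def chiSet (x : Fin 4 → ZMod 2) : Finset (Fin 8) := toSubset (chi4 x)

/-- `g(x, y) = ∑_{1 ≤ j ≤ i ≤ 3} x_i y_j + x₃ y₄ + x₄ y₃ + x₁ y₂ y₃ + x₂ y₁ y₃ + x₃ y₁ y₂`. -/
def gE8 (x y : Fin 4 → ZMod 2) : ZMod 2 :=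
  (x 0 * y 0 + x 1 * y 0 + x 1 * y 1 + x 2 * y 0 + x 2 * y 1 + x 2 * y 2) +
    x 2 * y 3 + x 3 * y 2 + x 0 * y 1 * y 2 + x 1 * y 0 * y 2 + x 2 * y 0 * y 1

/-- The sign `(-1)^{g(x, y)}`. -/
def signE8 (x y : Fin 4 → ZMod 2) : ℤ := (-1) ^ (gE8 x y).val

/-- The identification of `{1, …, 8}` with the affine space `𝔽₂³`. -/
def pt : Fin 8 → Fin 3 → ZMod 2 :=
  ![![1, 0, 1], ![1, 1, 1], ![0, 1, 1], ![0, 0, 1], ![1, 0, 0], ![1, 1, 0], ![0, 1, 0], ![0, 0, 0]]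

/-- `σ ⊆ {1, …, 8}` is an affine plane of `𝔽₂³`. -/
def IsAffinePlane (σ : Finset (Fin 8)) : Prop :=
  ∃ A : AffineSubspace (ZMod 2) (Fin 3 → ZMod 2),
    (A : Set (Fin 3 → ZMod 2)) = pt '' (σ : Set (Fin 8)) ∧
      Module.finrank (ZMod 2) A.direction = 2

/-! ### The algebra `𝕆 ⊗ ℝ[ε]` -/

/-- The real division algebra `𝕆` of octonions, the Cayley-Dickson double of the real quaternions:
`(a, b)` stands for `a + b l`. -/
def Octonion : Type := Quaternion ℝ × Quaternion ℝ

namespace Octonion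

noncomputable instance : AddCommGroup Octonion :=
  Prod.instAddCommGroup (G := Quaternion ℝ) (H := Quaternion ℝ)

noncomputable instance : Module ℝ Octonion :=
  Prod.instModule (M := Quaternion ℝ) (N := Quaternion ℝ)

/-- The octonion `a + b l`. -/
def mk (a b : Quaternion ℝ) : Octonion := (a, b)

noncomputable instance : Mul Octonion :=
  ⟨fun x y => mk (x.1 * y.1 - star y.2 * x.2) (y.2 * x.1 + x.2 * star y.1)⟩

theorem mul_def (x y : Octonion) :
    x * y = mk (x.1 * y.1 - star y.2 * x.2) (y.2 * x.1 + x.2 * star y.1) := rfl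

theorem ext' {x y : Octonion} (h : x.1 = y.1) (h' : x.2 = y.2) : x = y := Prod.ext h h'

noncomputable instance : NonUnitalNonAssocRing Octonion :=
  { (inferInstance : AddCommGroup Octonion), (inferInstance : Mul Octonion) with
    left_distrib := fun x y z => by
      refine ext' ?_ ?_
      · change x.1 * (y.1 + z.1) - star (y.2 + z.2) * x.2 =
          (x.1 * y.1 - star y.2 * x.2) + (x.1 * z.1 - star z.2 * x.2)
        rw [star_add]; noncomm_ring
      · change (y.2 + z.2) * x.1 + x.2 * star (y.1 + z.1) =
          (y.2 * x.1 + x.2 * star y.1) + (z.2 * x.1 + x.2 * star z.1)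
        rw [star_add]; noncomm_ring
    right_distrib := fun x y z => by
      refine ext' ?_ ?_
      · change (x.1 + y.1) * z.1 - star z.2 * (x.2 + y.2) =
          (x.1 * z.1 - star z.2 * x.2) + (y.1 * z.1 - star z.2 * y.2)
        noncomm_ring
      · change z.2 * (x.1 + y.1) + (x.2 + y.2) * star z.1 =
          (z.2 * x.1 + x.2 * star z.1) + (z.2 * y.1 + y.2 * star z.1)
        noncomm_ring
    zero_mul := fun x => by
      refine ext' ?_ ?_
      · change 0 * x.1 - star x.2 * 0 = 0
        simp
      · change x.2 * 0 + 0 * star x.1 = 0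
        simp
    mul_zero := fun x => by
      refine ext' ?_ ?_
      · change x.1 * 0 - star 0 * x.2 = 0
        simp
      · change 0 * x.1 + x.2 * star 0 = 0
        simp }

instance : SMulCommClass ℝ Octonion Octonion where
  smul_comm c x y := by
    refine ext' ?_ ?_
    · change c • (x.1 * y.1 - star y.2 * x.2) = x.1 * (c • y.1) - star (c • y.2) * x.2
      simp [smul_sub]
    · change c • (y.2 * x.1 + x.2 * star y.1) = (c • y.2) * x.1 + x.2 * star (c • y.1)
      simp [smul_add]

instance : IsScalarTower ℝ Octonion Octonion where
  smul_assoc c x y := by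
    refine ext' ?_ ?_
    · change (c • x.1) * y.1 - star y.2 * (c • x.2) = c • (x.1 * y.1 - star y.2 * x.2)
      simp [smul_sub]
    · change y.2 * (c • x.1) + (c • x.2) * star y.1 = c • (y.2 * x.1 + x.2 * star y.1)
      simp [smul_add]

end Octonion

/-- The algebra `ℝ[ε] = ℝ 1 ⊕ ℝ ε`, with `ε² = 1`. -/
abbrev REps : Type := QuadraticAlgebra ℝ 1 0

/-- The algebra `𝕆 ⊗ ℝ[ε]`. -/
abbrev OctEps : Type := Octonion ⊗[ℝ] REps

/-- The octonion `i^{x₁} j^{x₂} l^{x₃}`, that is, one of `1, i, j, k, l, il, jl, kl`. -/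
noncomputable def octUnit (x : Fin 3 → ZMod 2) : Octonion :=
  let a : Quaternion ℝ := ⟨0, 1, 0, 0⟩ ^ (x 0).val * ⟨0, 0, 1, 0⟩ ^ (x 1).val
  if x 2 = 0 then Octonion.mk a 0 else Octonion.mk 0 a

/-- The elements `u ⊗ 1` for `u = 1, i, j, k, l, il, jl, kl`, `u ⊗ ε` for `u = 1, i, j, k`, and
`-u ⊗ ε` for `u = l, il, jl, kl`, indexed by `ℤ₂⁴`. -/
noncomputable def octBasis (x : Fin 4 → ZMod 2) : OctEps :=
  (if x 2 = 1 ∧ x 3 = 1 then -1 else 1 : ℝ) •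
    (octUnit ![x 0, x 1, x 2] ⊗ₜ[ℝ] ((QuadraticAlgebra.omega : REps) ^ (x 3).val))

/-! ### The decomposition of `𝔢₈ = 𝔤(S₈, S₈)`

The four copies of `V` in `S₈ = V ⊗ V ⊕ V ⊗ V` are numbered `1, 2, 3, 4` in the first `S₈`, and
`5, 6, 7, 8` in the second one. -/

namespace SymplecticPlane

variable {F V : Type*} [Field F] [AddCommGroup V] [Module F V] (P : SymplecticPlane F V)

/-- The vector space `𝔢₈ = 𝔤(S₈, S₈)`, with its bracket. -/
abbrev E8 [NeZero (2 : F)] : Type _ := SymmetricComposition.Magic P.S8 P.S8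

/-- The natural action `ρ` of `sp(V)⁴` on `S₈ = V ⊗ V ⊕ V ⊗ V`, where the `i`-th component acts on
the `i`-th copy of `V`. -/
def rhoSp (s : Fin 4 → P.sp) : Module.End F (Cayley F V) :=
  LinearMap.prodMap ((s 0).1.rTensor V + (s 1).1.lTensor V)
    ((s 2).1.rTensor V + (s 3).1.lTensor V)

/-- The endomorphism `ρ(v₁ ⊗ v₂ ⊗ v₃ ⊗ v₄)` of `S₈`, that maps `(w₁ ⊗ w₂, w₃ ⊗ w₄)` to
`(⟨v₃ | w₃⟩⟨v₄ | w₄⟩ v₁ ⊗ v₂, -⟨v₁ | w₁⟩⟨v₂ | w₂⟩ v₃ ⊗ v₄)`. -/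
def rhoTensor (v : Fin 4 → V) : Module.End F (Cayley F V) :=
  LinearMap.prod
    ((P.quatForm (v 2 ⊗ₜ v 3) ∘ₗ LinearMap.snd F _ _).smulRight (v 0 ⊗ₜ[F] v 1))
    (-(P.quatForm (v 0 ⊗ₜ v 1) ∘ₗ LinearMap.fst F _ _).smulRight (v 2 ⊗ₜ[F] v 3))

theorem rhoTensor_apply (v w : Fin 4 → V) :
    P.rhoTensor v (w 0 ⊗ₜ w 1, w 2 ⊗ₜ w 3) =
      ((P.form (v 2) (w 2) * P.form (v 3) (w 3)) • (v 0 ⊗ₜ[F] v 1),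
        -((P.form (v 0) (w 0) * P.form (v 1) (w 1)) • (v 2 ⊗ₜ[F] v 3))) := by
  simp [rhoTensor]

end SymplecticPlane

/-- The cyclic permutations of `1, 2, 3`, with `4` fixed: the sequences `1234`, `2314`, `3124`. -/
def cyc : Fin 3 → Fin 4 → Fin 4 := ![![0, 1, 2, 3], ![1, 2, 0, 3], ![2, 0, 1, 3]]

/-- The two pairs of indices, of the tensor factors of the first and second copy of `V ⊗ V`
in the `k`-th `S₈`. -/
def pairIdx (k : Fin 3) : Fin 2 → Fin 2 → Fin 4 :=
  ![![cyc k 0, cyc k 1], ![cyc k 2, cyc k 3]]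

/-- The index in `{1, …, 8}` of the `i`-th copy of `V` in the first `S₈`. -/
def left8 (i : Fin 4) : Fin 8 := Fin.castAdd 4 i

/-- The index in `{1, …, 8}` of the `i`-th copy of `V` in the second `S₈`. -/
def right8 (i : Fin 4) : Fin 8 := Fin.natAdd 4 i

/-- The sets `σ ∈ 𝒮_{𝔢₈}` such that `V(σ)` is one of the four summands of `ι_k(S₈ ⊗ S₈)`: those
which consist of one of the two pairs of indices in each `S₈`. -/
def mixedSet (k : Fin 3) (h h' : Fin 2) : Finset (Fin 8) :=
  {left8 (pairIdx k h 0), left8 (pairIdx k h 1), right8 (pairIdx k h' 0), right8 (pairIdx k h' 1)}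

namespace SymplecticPlane

variable {F V : Type*} [Field F] [AddCommGroup V] [Module F V]

/-- The element `a ⊗ b` of the first (`h = 0`) or second (`h = 1`) copy of `V ⊗ V` in `S₈`. -/
def half (h : Fin 2) (a b : V) : Cayley F V :=
  if h = 0 then (a ⊗ₜ b, 0) else (0, a ⊗ₜ b)

/-- The space `⨁_{σ ∈ 𝒮_{𝔢₈}} V(σ)`. -/
abbrev E8Sum (P : SymplecticPlane F V) : Type _ := ⨁ σ : {σ // σ ∈ calS}, P.VMod σ.1

/-- The inclusion of `V(σ)` in `⨁_{σ ∈ 𝒮_{𝔢₈}} V(σ)`. -/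
def inc (P : SymplecticPlane F V) (σ : {σ // σ ∈ calS}) : P.VMod σ.1 →ₗ[F] P.E8Sum :=
  DirectSum.lof F {σ // σ ∈ calS} (fun σ => P.VMod σ.1) σ

end SymplecticPlane

theorem empty_mem_calS : (∅ : Finset (Fin 8)) ∈ calS := by decide

theorem left_mem_calS : ({0, 1, 2, 3} : Finset (Fin 8)) ∈ calS := by decide

theorem right_mem_calS : ({4, 5, 6, 7} : Finset (Fin 8)) ∈ calS := by decide

theorem mixedSet_mem_calS (k : Fin 3) (h h' : Fin 2) : mixedSet k h h' ∈ calS := by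
  revert k h h'; decide

end E8Model

open E8Model E8Model.SymmetricComposition E8Model.SymplecticPlane

/-!
The set `𝒮`, completed by `{1, …, 8}`, is the image of `χ₄`, a binary code of length `8` and
dimension `4`, so everything about `𝒮`, `χ₄`, `ε` and `g` alone is a finite verification. This
includes the description of `𝒮` by affine planes, once the latter are characterized as the
four-element sets that contain `a + b + c` together with `a`, `b`, `c` (`isAffinePlane_iff`).

For the algebra `𝕆 ⊗ ℝ[ε]`, the units of `ℍ` multiply with a sign that is quadratic in the exponents,
and the Cayley-Dickson doubling turns it into the cubic sign of `octUnit_mul`. The factor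
`s_x = (-1)^{x₃x₄}` in `b_x` changes this sign by the coboundary `x₃y₄ + x₄y₃`, which gives `g`
(`octBasis_mul`). The sixteen elements `b_x` span a space of dimension sixteen.

The Jacobi identity holds in `𝔤(S, S')` for all symmetric composition algebras (`Magic.jacobi`).
On homogeneous generators it says that `𝔱𝔯𝔦(S)` acts on `θ^i(t_{x,y})` through `d_i`
(`triLie_theta_pow_t`), that `t_{x,y}` acts by `σ_{x,y}` and by `½ q(x,y) - r_x l_y`,
`½ q(x,y) - l_x r_y` (whose tensor combinations are handled by `Magic.tmul_half_sub`), and that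
`θ²(t_{x*y,z}) + t_{y*z,x} + θ(t_{z*x,y}) = 0` (`t_cyclic`).

For the decomposition of `𝔢₈`, the maps `ρ` yield elements `spTriple s` and `tensorTriple v` of
`𝔱𝔯𝔦(S₈)`, because `ρ` is compatible with the product of `S₈` up to a cyclic permutation of the first
three copies of `V` (`rhoSp_paraMul`, `rhoTensor_paraMul`). Together they give an isomorphism
`sp(V)⁴ ⊕ V^{⊗4} ≅ 𝔱𝔯𝔦(S₈)` (`triMap_surjective`, `triMap_injective`): the elements `t_{x,y}` lie in
the image by the explicit formulas `t_half_zero_zero`, …, `t_half_one_zero`, and they span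
`𝔱𝔯𝔦(S₈)` since their first components span `𝔬(S₈, q)` and an element of `𝔱𝔯𝔦(S₈)` is determined by
its first component (`tri_le_of_t_mem`). The map `Ψ` is defined summand by summand. Its image contains
generators of `𝔢₈`, and both sides have dimension `8 dim sp(V) + 224`, so that it is bijective
(`psiSum_bijective`).

Both sides of the bracket formula are bilinear, so it suffices to check it on `sp(V)⁸` and on pure
tensors. The nonempty elements of `𝒮` are labelled by `Label`: two sets for the two copies of
`V^{⊗4}` in `𝔱𝔯𝔦(S₈) ⊕ 𝔱𝔯𝔦(S₈)`, and four sets for each `ι_k(S₈ ⊗ S₈)`. For distinct sets the bracket is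
one action, one value of `t`, or one product of `S₈ ⊗ S₈`, uniformly in the label
(`bracketFormula`). Only one order of each pair has to be considered, since `σ ∩ τ` has two elements
if `∅ ≠ σ ≠ τ ≠ ∅` and `σ + τ ∈ 𝒮`, whereas `ε` is antisymmetric on these pairs
(`BracketFormula.swap`).
-/

set_option linter.unusedSimpArgs false

namespace E8Model

/-! ### The set `𝒮`, the map `χ₄` and the signs -/

theorem bijective_pt : Function.Bijective pt := by decide +kernel

theorem chi4_injective : Function.Injective chi4 := by decide +kernel

theorem mem_calS_iff_exists_chiSet :
    ∀ σ, σ ∈ calS ↔ ∃ x, x ≠ ![0, 0, 0, 1] ∧ chiSet x = σ := by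
  decide +kernel

theorem epsE8_chiSet : ∀ x y, chiSet x ∈ calS → chiSet y ∈ calS →
    symmDiff (chiSet x) (chiSet y) ∈ calS → epsE8 (chiSet x) (chiSet y) = signE8 x y := by
  decide +kernel

theorem chiSet_add : ∀ x y, chiSet (x + y) = symmDiff (chiSet x) (chiSet y) := by
  decide +kernel

theorem card_calS : calS.card = 15 := by decide +kernel

/-- Over `𝔽₂`, the affine planes are the four-element sets closed under sums of three points. -/
theorem isAffinePlane_iff (σ : Finset (Fin 8)) : IsAffinePlane σ ↔
    σ.card = 4 ∧ ∀ a ∈ σ, ∀ b ∈ σ, ∀ c ∈ σ, ∃ d ∈ σ, pt d = pt a + pt b + pt c := by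
  have hneg : ∀ x : Fin 3 → ZMod 2, -x = x := by decide
  have hcard (B : AffineSubspace (ZMod 2) (Fin 3 → ZMod 2))
      (hB : (B : Set (Fin 3 → ZMod 2)) = pt '' (σ : Set (Fin 8))) (a : Fin 8) (ha : a ∈ σ) :
      σ.card = 2 ^ Module.finrank (ZMod 2) B.direction := by
    have haB : pt a ∈ B := by
      rw [← SetLike.mem_coe, hB]; exact ⟨a, ha, rfl⟩
    have h1 : Nat.card B.direction = 2 ^ Module.finrank (ZMod 2) B.direction := by
      rw [Module.natCard_eq_pow_finrank (K := ZMod 2), Nat.card_zmod]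
    have h2 : (B.direction : Set (Fin 3 → ZMod 2)) = (· -ᵥ pt a) '' (B : Set _) :=
      AffineSubspace.coe_direction_eq_vsub_set_right haB
    rw [← h1]
    change _ = Nat.card (B.direction : Set (Fin 3 → ZMod 2))
    rw [h2, Nat.card_image_of_injective (vsub_left_injective _), hB,
      Nat.card_image_of_injective bijective_pt.1]
    simp
  constructor
  · rintro ⟨B, hB, hdim⟩
    have hmem : ∀ x, x ∈ B ↔ ∃ a ∈ σ, pt a = x := fun x => by
      rw [← SetLike.mem_coe, hB]; simp
    refine ⟨?_, fun a ha b hb c hc => ?_⟩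
    · obtain ⟨a, ha⟩ : σ.Nonempty := by
        rw [Finset.nonempty_iff_ne_empty]
        rintro rfl
        have : B = ⊥ := by
          rw [← AffineSubspace.coe_eq_bot_iff, hB]; simp
        rw [this, AffineSubspace.direction_bot, finrank_bot] at hdim
        exact absurd hdim (by norm_num)
      rw [hcard B hB a ha, hdim]; norm_num
    · have h := B.smul_vsub_vadd_mem 1 ((hmem _).2 ⟨a, ha, rfl⟩) ((hmem _).2 ⟨b, hb, rfl⟩)
        ((hmem _).2 ⟨c, hc, rfl⟩)
      rw [one_smul, vsub_eq_sub, vadd_eq_add, sub_eq_add_neg, hneg] at h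
      exact (hmem _).1 h
  · rintro ⟨h4, hadd⟩
    let B : AffineSubspace (ZMod 2) (Fin 3 → ZMod 2) :=
      { carrier := pt '' (σ : Set (Fin 8))
        smul_vsub_vadd_mem' := by
          rintro c _ _ _ ⟨x, hx, rfl⟩ ⟨y, hy, rfl⟩ ⟨z, hz, rfl⟩
          obtain rfl | rfl : c = 0 ∨ c = 1 := by revert c; decide
          · exact ⟨z, hz, by simp⟩
          · obtain ⟨d, hd, h⟩ := hadd x hx y hy z hz
            exact ⟨d, hd, by rw [h, one_smul, vsub_eq_sub, vadd_eq_add, sub_eq_add_neg, hneg]⟩ }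
    obtain ⟨a, ha⟩ : σ.Nonempty := by
      rw [← Finset.card_pos]; omega
    refine ⟨B, rfl, ?_⟩
    have h := hcard B rfl a ha
    rw [h4] at h
    exact (Nat.pow_right_injective le_rfl (h.symm.trans (by norm_num : 4 = 2 ^ 2)))

theorem mem_calS_iff_isAffinePlane (σ : Finset (Fin 8)) :
    σ ∈ calS ↔ σ = ∅ ∨ IsAffinePlane σ := by
  rw [isAffinePlane_iff]
  revert σ
  decide +kernel

theorem ncard_isAffinePlane : {σ | IsAffinePlane σ}.ncard = 14 := by
  have h : {σ | IsAffinePlane σ} = ((calS.erase ∅ : Finset (Finset (Fin 8))) : Set _) := by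
    ext σ
    have h0 : IsAffinePlane σ → σ ≠ ∅ := fun h hσ => by
      have := ((isAffinePlane_iff σ).1 h).1
      simp [hσ] at this
    have := mem_calS_iff_isAffinePlane σ
    simp only [Set.mem_ofPred_eq, Finset.coe_erase, Set.mem_sdiff, Finset.mem_coe,
      Set.mem_singleton_iff]
    tauto
  rw [h, Set.ncard_coe_finset, Finset.card_erase_of_mem empty_mem_calS, card_calS]

/-! ### The algebra `𝕆 ⊗ ℝ[ε]` -/

namespace Octonion

theorem mk_mul_mk (a b c d : Quaternion ℝ) : Octonion.mk a b * Octonion.mk c d =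
    Octonion.mk (a * c - star d * b) (d * a + b * star c) := rfl

theorem smul_mk (r : ℝ) (a b : Quaternion ℝ) :
    r • Octonion.mk a b = Octonion.mk (r • a) (r • b) := rfl

theorem mk_add_mk (a b c d : Quaternion ℝ) :
    Octonion.mk a b + Octonion.mk c d = Octonion.mk (a + c) (b + d) := rfl

end Octonion

/-- The quaternion `i`. -/
def quatI : Quaternion ℝ := ⟨0, 1, 0, 0⟩

/-- The quaternion `j`. -/
def quatJ : Quaternion ℝ := ⟨0, 0, 1, 0⟩

@[simp] theorem re_quatI : quatI.re = 0 := rfl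
@[simp] theorem imI_quatI : quatI.imI = 1 := rfl
@[simp] theorem imJ_quatI : quatI.imJ = 0 := rfl
@[simp] theorem imK_quatI : quatI.imK = 0 := rfl
@[simp] theorem re_quatJ : quatJ.re = 0 := rfl
@[simp] theorem imI_quatJ : quatJ.imI = 0 := rfl
@[simp] theorem imJ_quatJ : quatJ.imJ = 1 := rfl
@[simp] theorem imK_quatJ : quatJ.imK = 0 := rfl

/-- The quaternion `i^x j^y`. -/
noncomputable def quatUnit (x y : ZMod 2) : Quaternion ℝ := quatI ^ x.val * quatJ ^ y.val

theorem quatUnit_zero_zero : quatUnit 0 0 = 1 := mul_one _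

theorem quatUnit_one_zero : quatUnit 1 0 = quatI := (mul_one _).trans (pow_one _)

theorem quatUnit_zero_one : quatUnit 0 1 = quatJ := (one_mul _).trans (pow_one _)

theorem quatUnit_one_one : quatUnit 1 1 = quatI * quatJ :=
  congrArg₂ (· * ·) (pow_one quatI) (pow_one quatJ)

theorem zmod_two_cases (x : ZMod 2) : x = 0 ∨ x = 1 := by
  revert x; decide

/-- The real sign `(-1)^x`. -/
def zsign (x : ZMod 2) : ℝ := if x = 0 then 1 else -1

@[simp] theorem zsign_zero : zsign 0 = 1 := rfl

@[simp] theorem zsign_one : zsign 1 = -1 := rfl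

theorem zsign_add (x y : ZMod 2) : zsign (x + y) = zsign x * zsign y := by
  have h11 : (1 : ZMod 2) + 1 = 0 := rfl
  obtain rfl | rfl := zmod_two_cases x <;> obtain rfl | rfl := zmod_two_cases y <;> simp [h11]

theorem quatUnit_mul (x y z w : ZMod 2) : quatUnit x y * quatUnit z w =
    zsign (x * z + y * z + y * w) • quatUnit (x + z) (y + w) := by
  have h11 : (1 : ZMod 2) + 1 = 0 := rfl
  obtain rfl | rfl := zmod_two_cases x <;> obtain rfl | rfl := zmod_two_cases y <;>
  obtain rfl | rfl := zmod_two_cases z <;> obtain rfl | rfl := zmod_two_cases w <;>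
  simp only [h11, add_zero, zero_add, mul_zero, mul_one, zsign_zero, zsign_one,
    quatUnit_zero_zero, quatUnit_one_zero, quatUnit_zero_one, quatUnit_one_one] <;>
  ext <;> simp <;> rfl

theorem star_quatUnit (x y : ZMod 2) :
    star (quatUnit x y) = zsign (x + y + x * y) • quatUnit x y := by
  have h11 : (1 : ZMod 2) + 1 = 0 := rfl
  obtain rfl | rfl := zmod_two_cases x <;> obtain rfl | rfl := zmod_two_cases y <;>
  simp only [h11, add_zero, zero_add, mul_zero, mul_one, zsign_zero, zsign_one,
    quatUnit_zero_zero, quatUnit_one_zero, quatUnit_zero_one, quatUnit_one_one] <;>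
  ext <;> simp

theorem octUnit_eq (x y z : ZMod 2) : octUnit ![x, y, z] =
    if z = 0 then Octonion.mk (quatUnit x y) 0 else Octonion.mk 0 (quatUnit x y) := rfl

/-- The multiplication table of the octonion units. -/
theorem octUnit_mul (x y z x' y' z' : ZMod 2) :
    octUnit ![x, y, z] * octUnit ![x', y', z'] =
      zsign (x * x' + y * x' + y * y' + z * x' + z * y' + z * z' + x * y' * z' + y * x' * z' +
        z * x' * y') • octUnit ![x + x', y + y', z + z'] := by
  have h11 : (1 : ZMod 2) + 1 = 0 := rfl
  have h10 : (1 : ZMod 2) ≠ 0 := by decide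
  have hneg : ∀ x, -zsign x = zsign (x + 1) := fun x => by simp [zsign_add]
  obtain rfl | rfl := zmod_two_cases z <;> obtain rfl | rfl := zmod_two_cases z' <;>
  simp only [octUnit_eq, h11, h10, add_zero, zero_add, mul_zero, mul_one, zero_mul, one_mul,
    if_true, if_false, Octonion.mk_mul_mk, Octonion.smul_mk, star_zero, sub_zero, zero_sub,
    smul_zero, star_quatUnit, quatUnit_mul, smul_mul_assoc, mul_smul_comm, smul_smul, neg_zero,
    ← neg_smul, ← zsign_add, hneg] <;>
  congr 2 <;> congr 1 <;> revert x y x' y' <;> decide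

theorem omega_pow_mul (x y : ZMod 2) :
    (QuadraticAlgebra.omega : REps) ^ x.val * QuadraticAlgebra.omega ^ y.val =
      QuadraticAlgebra.omega ^ (x + y).val := by
  have h11 : (1 : ZMod 2) + 1 = 0 := rfl
  have hv : (1 : ZMod 2).val = 1 := rfl
  have hv0 : (0 : ZMod 2).val = 0 := rfl
  have h : (QuadraticAlgebra.omega : REps) * QuadraticAlgebra.omega = 1 := by
    ext <;> simp <;> rfl
  obtain rfl | rfl := zmod_two_cases x <;> obtain rfl | rfl := zmod_two_cases y <;>
  simp [hv, hv0, h11, h]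

theorem octBasis_eq (x : Fin 4 → ZMod 2) : octBasis x = zsign (x 2 * x 3) •
    (octUnit ![x 0, x 1, x 2] ⊗ₜ[ℝ] ((QuadraticAlgebra.omega : REps) ^ (x 3).val)) := by
  rw [octBasis]
  congr 1
  obtain h | h := zmod_two_cases (x 2) <;> obtain h' | h' := zmod_two_cases (x 3) <;>
  simp [h, h']

theorem octBasis_mul (x y : Fin 4 → ZMod 2) :
    octBasis x * octBasis y = signE8 x y • octBasis (x + y) := by
  have hs : (signE8 x y : ℝ) = zsign (gE8 x y) := by
    rw [signE8, zsign]
    obtain h | h := zmod_two_cases (gE8 x y)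
    · simp [h]
    · simp [h, ZMod.val_one]
  rw [← Int.cast_smul_eq_zsmul ℝ, hs, octBasis_eq, octBasis_eq, octBasis_eq, smul_mul_smul_comm,
    Algebra.TensorProduct.tmul_mul_tmul, octUnit_mul, omega_pow_mul, ← TensorProduct.smul_tmul',
    smul_smul, smul_smul]
  simp only [Pi.add_apply, ← zsign_add]
  congr 2
  simp only [gE8]
  generalize x 0 = a, x 1 = b, x 2 = c, x 3 = d, y 0 = a', y 1 = b', y 2 = c', y 3 = d'
  have h2 : (2 : ZMod 2) = 0 := rfl
  linear_combination (-(c * d' + d * c')) * h2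

theorem span_octBasis : Submodule.span ℝ (Set.range octBasis) = ⊤ := by
  set N := Submodule.span ℝ (Set.range octBasis)
  have h1 (x y z : ZMod 2) (w : ZMod 2) :
      octUnit ![x, y, z] ⊗ₜ[ℝ] ((QuadraticAlgebra.omega : REps) ^ w.val) ∈ N := by
    have hz : ∀ x, zsign x * zsign x = 1 := fun x => by
      obtain rfl | rfl := zmod_two_cases x <;> simp
    have h := N.smul_mem (zsign (z * w)) (Submodule.subset_span ⟨![x, y, z, w], rfl⟩)
    rw [octBasis_eq, smul_smul] at h
    simpa [hz] using h
  have h2 (x y z : ZMod 2) (r : REps) : octUnit ![x, y, z] ⊗ₜ[ℝ] r ∈ N := by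
    have hr : r = r.re • (QuadraticAlgebra.omega : REps) ^ (0 : ZMod 2).val +
        r.im • (QuadraticAlgebra.omega : REps) ^ (1 : ZMod 2).val := by
      rw [ZMod.val_zero, ZMod.val_one, pow_zero, pow_one]
      ext
      · simp; exact (mul_one _).symm
      · simp; exact Or.inr rfl
    rw [hr, TensorProduct.tmul_add, TensorProduct.tmul_smul, TensorProduct.tmul_smul]
    exact N.add_mem (N.smul_mem _ (h1 _ _ _ _)) (N.smul_mem _ (h1 _ _ _ _))
  have hq (q : Quaternion ℝ) : q = q.re • quatUnit 0 0 + q.imI • quatUnit 1 0 +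
      q.imJ • quatUnit 0 1 + q.imK • quatUnit 1 1 := by
    rw [quatUnit_zero_zero, quatUnit_one_zero, quatUnit_zero_one, quatUnit_one_one]
    ext
    · simp; exact (mul_one _).symm
    all_goals simp; exact Or.inr rfl
  have ho (o : Octonion) : o = (o.1.re • octUnit ![0, 0, 0] + o.1.imI • octUnit ![1, 0, 0] +
      o.1.imJ • octUnit ![0, 1, 0] + o.1.imK • octUnit ![1, 1, 0]) +
      (o.2.re • octUnit ![0, 0, 1] + o.2.imI • octUnit ![1, 0, 1] +
      o.2.imJ • octUnit ![0, 1, 1] + o.2.imK • octUnit ![1, 1, 1]) := by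
    have h10 : (1 : ZMod 2) ≠ 0 := by decide
    simp only [octUnit_eq, if_true, if_neg h10, Octonion.smul_mk, Octonion.mk_add_mk, smul_zero,
      add_zero, zero_add]
    exact Octonion.ext' (hq _) (hq _)
  rw [eq_top_iff]
  rintro u -
  induction u using TensorProduct.induction_on with
  | zero => exact N.zero_mem
  | add u v hu hv => exact N.add_mem hu hv
  | tmul o r =>
    rw [ho o]
    simp only [TensorProduct.add_tmul, ← TensorProduct.smul_tmul']
    refine N.add_mem (N.add_mem (N.add_mem (N.add_mem ?_ ?_) ?_) ?_)
      (N.add_mem (N.add_mem (N.add_mem ?_ ?_) ?_) ?_) <;>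
    exact N.smul_mem _ (h2 _ _ _ _)

instance : Module.Finite ℝ Octonion :=
  inferInstanceAs (Module.Finite ℝ (Quaternion ℝ × Quaternion ℝ))

theorem finrank_octEps : Module.finrank ℝ OctEps = 16 := by
  have h : Module.finrank ℝ Octonion = 8 := by
    change Module.finrank ℝ (Quaternion ℝ × Quaternion ℝ) = 8
    rw [Module.finrank_prod, Quaternion.finrank_eq_four]
  rw [Module.finrank_tensorProduct, h, QuadraticAlgebra.finrank_eq_two]

/-- The basis `(b_x)` of `𝕆 ⊗ ℝ[ε]`. -/
noncomputable def octEpsBasis : Module.Basis (Fin 4 → ZMod 2) ℝ OctEps :=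
  basisOfTopLeSpanOfCardEqFinrank octBasis span_octBasis.ge (by rw [finrank_octEps]; simp)

theorem octEpsBasis_apply (x : Fin 4 → ZMod 2) : octEpsBasis x = octBasis x := by
  simp [octEpsBasis]

/-! ### The triality Lie algebra -/

namespace SymmetricComposition

variable {F S S' : Type*} [Field F] [AddCommGroup S] [Module F S] [AddCommGroup S'] [Module F S']
variable (A : SymmetricComposition F S) (A' : SymmetricComposition F S')

theorem q_mul_left_cyc (x y z : S) : A.q (A.mul x y) z = A.q (A.mul y z) x := by
  rw [A.q_comm (A.mul y z)]
  exact A.polar_mul x y z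

theorem tri_q {d : Fin 3 → Module.End F S} (hd : d ∈ A.tri) (i : Fin 3) (x y : S) :
    A.q (d i x) y + A.q x (d i y) = 0 := hd.1 i x y

/-- The triality principle: the three components of an element of the triality Lie algebra
play cyclically symmetric roles. -/
theorem tri_mul {d : Fin 3 → Module.End F S} (hd : d ∈ A.tri) (i : Fin 3) (x y : S) :
    d i (A.mul x y) = A.mul (d (i + 1) x) y + A.mul x (d (i + 2) y) := by
  fin_cases i
  · exact hd.2 x y
  · exact (A.theta (A.theta ⟨d, hd⟩)).2.2 x y
  · exact (A.theta ⟨d, hd⟩).2.2 x y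

/-- The cyclic rotations of an element of the triality Lie algebra belong to it, which is the invariance
under `θ` with components indexed modulo `3`. -/
theorem rotate_mem_tri {d : Fin 3 → Module.End F S} (hd : d ∈ A.tri) (i : Fin 3) :
    (fun j => d (j + i)) ∈ A.tri :=
  ⟨fun j => hd.1 (j + i), fun x y => by
    have h := A.tri_mul hd (0 + i) x y
    rw [add_right_comm 0 i 1, add_right_comm 0 i 2] at h
    exact h⟩

theorem theta_pow_apply (i j : Fin 3) (d : A.tri) :
    ((A.theta ^ (i : ℕ)) d).1 j = d.1 (j - i) := by
  fin_cases i <;> fin_cases j <;> rfl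

theorem triLie_apply (d e : A.tri) (i : Fin 3) :
    (A.triLie d e).1 i = d.1 i * e.1 i - e.1 i * d.1 i := rfl

variable [NeZero (2 : F)]

theorem t_zero_apply (x y z : S) : (A.t x y).1 0 z = A.q x z • y - A.q y z • x := rfl

theorem t_one_apply (x y z : S) :
    (A.t x y).1 1 z = ((2⁻¹ : F) * A.q x y) • z - A.mul (A.mul y z) x := rfl

theorem t_two_apply (x y z : S) :
    (A.t x y).1 2 z = ((2⁻¹ : F) * A.q x y) • z - A.mul x (A.mul z y) := rfl

/-- `d ∈ 𝔱𝔯𝔦(S)` acts on the elements `t_{x,y}` through its first component. -/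
theorem commutator_tTriple {d : Fin 3 → Module.End F S} (hd : d ∈ A.tri) (x y : S) (j : Fin 3) :
    d j * (A.t x y).1 j - (A.t x y).1 j * d j =
      (A.t (d 0 x) y).1 j + (A.t x (d 0 y)).1 j := by
  have hq := A.tri_q hd 0
  ext z
  simp only [LinearMap.sub_apply, Module.End.mul_apply, LinearMap.add_apply]
  fin_cases j
  · simp only [Fin.zero_eta, t_zero_apply, map_sub, map_smul]
    have e1 := congrArg (fun c : F => c • y) (hq x z)
    have e2 := congrArg (fun c : F => c • x) (hq y z)
    linear_combination (norm := module) e2 - e1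
  · simp only [Fin.mk_one, t_one_apply, map_sub, map_smul]
    have e1 := A.tri_mul hd 1 (A.mul y z) x
    have e2 := congrArg (fun u => A.mul u x) (A.tri_mul hd 2 y z)
    have e3 := congrArg (fun c : F => (2⁻¹ * c) • z) (hq x y)
    simp only [Fin.reduceAdd, map_add, LinearMap.add_apply] at e1 e2 e3
    linear_combination (norm := module) -e1 - e2 - e3
  · simp only [Fin.reduceFinMk, t_two_apply, map_sub, map_smul]
    have e1 := A.tri_mul hd 2 x (A.mul z y)
    have e2 := congrArg (fun u => A.mul x u) (A.tri_mul hd 1 z y)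
    have e3 := congrArg (fun c : F => (2⁻¹ * c) • z) (hq x y)
    simp only [Fin.reduceAdd, map_add, LinearMap.add_apply] at e1 e2 e3
    linear_combination (norm := module) -e1 - e2 - e3

/-- `θ^i(t_{x,y})` is acted on by `d ∈ 𝔱𝔯𝔦(S)` through the component `d_i`. -/
theorem triLie_theta_pow_t (d : A.tri) (i : Fin 3) (x y : S) :
    A.triLie d ((A.theta ^ (i : ℕ)) (A.t x y)) =
      (A.theta ^ (i : ℕ)) (A.t (d.1 i x) y + A.t x (d.1 i y)) := by
  ext j : 2
  rw [triLie_apply, map_add]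
  change _ = ((A.theta ^ (i : ℕ)) _).1 j + ((A.theta ^ (i : ℕ)) _).1 j
  rw [theta_pow_apply, theta_pow_apply, theta_pow_apply]
  have h := A.commutator_tTriple (A.rotate_mem_tri d.2 i) x y (j - i)
  simp only [sub_add_cancel, zero_add] at h
  exact h

theorem t_swap (x y : S) : A.t x y = -A.t y x := by
  ext j : 2
  change _ = -(A.t y x).1 j
  ext z
  rw [LinearMap.neg_apply]
  fin_cases j
  · simp only [Fin.zero_eta, t_zero_apply]
    abel
  · simp only [Fin.mk_one, t_one_apply]
    have h := A.mul_mul_left y z x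
    rw [A.q_comm y x] at h ⊢
    have h2 : (2⁻¹ : F) * 2 = 1 := inv_mul_cancel₀ (NeZero.ne 2)
    have e := congrArg (fun c : F => (A.q x y * c) • z) h2
    linear_combination (norm := module) e - h
  · simp only [Fin.reduceFinMk, t_two_apply]
    have h := A.mul_mul_right y z x
    rw [A.q_comm y x] at h ⊢
    have h2 : (2⁻¹ : F) * 2 = 1 := inv_mul_cancel₀ (NeZero.ne 2)
    have e := congrArg (fun c : F => (A.q x y * c) • z) h2
    linear_combination (norm := module) e - h

/-- The first component of the identity `t_cyclic` for `i = 1`. It follows from the linearized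
composition identities `mul_mul_left` and the associativity of `q`. -/
theorem t_cyclic_zero (x y z : S) :
    (A.t (A.mul x y) z).1 0 + (A.t (A.mul y z) x).1 2 + (A.t (A.mul z x) y).1 1 = 0 := by
  ext w
  simp only [LinearMap.add_apply, t_zero_apply, t_one_apply, t_two_apply, LinearMap.zero_apply]
  have h2 : (2⁻¹ : F) * 2 = 1 := inv_mul_cancel₀ (NeZero.ne 2)
  have e1 := A.mul_mul_left y z (A.mul w x)
  have e2 := A.mul_mul_left y w (A.mul z x)
  have e3 := congrArg (fun u => A.mul u y) (A.mul_mul_left w x z)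
  simp only [map_add, LinearMap.add_apply, map_smul, LinearMap.smul_apply] at e3
  have q1 : A.q (A.mul y z) x = A.q (A.mul x y) z := (A.q_mul_left_cyc x y z).symm
  have q2 : A.q (A.mul z x) y = A.q (A.mul x y) z := A.q_mul_left_cyc z x y
  have q3 : A.q y (A.mul w x) = A.q (A.mul x y) w := by
    rw [A.q_comm, A.q_mul_left_cyc]
  have q4 : A.q y (A.mul z x) = A.q (A.mul x y) z := by
    rw [A.q_comm, A.q_mul_left_cyc]
  rw [q3] at e1
  rw [q4] at e2
  rw [q1, q2, A.q_comm z w]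
  have e := congrArg (fun c : F => (A.q (A.mul x y) z * c) • w) h2
  linear_combination (norm := module) e - e1 - e2 + e3

/-- `θ^{i+2}(t_{x*y,z}) + θ^i(t_{y*z,x}) + θ^{i+1}(t_{z*x,y}) = 0`. -/
theorem t_cyclic (i : Fin 3) (x y z : S) :
    (A.theta ^ ((i + 2 : Fin 3) : ℕ)) (A.t (A.mul x y) z) +
      (A.theta ^ (i : ℕ)) (A.t (A.mul y z) x) +
      (A.theta ^ ((i + 1 : Fin 3) : ℕ)) (A.t (A.mul z x) y) = 0 := by
  have h1 := A.t_cyclic_zero x y z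
  have h2 := A.t_cyclic_zero y z x
  have h3 := A.t_cyclic_zero z x y
  ext j : 2
  change ((A.theta ^ ((i + 2 : Fin 3) : ℕ)) _).1 j + ((A.theta ^ (i : ℕ)) _).1 j +
    ((A.theta ^ ((i + 1 : Fin 3) : ℕ)) _).1 j = 0
  rw [theta_pow_apply, theta_pow_apply, theta_pow_apply]
  obtain ⟨m, rfl⟩ : ∃ m, j = m + (i + 2) := ⟨j - (i + 2), by simp⟩
  have e1 : m + (i + 2) - (i + 2) = m := by simp
  have e2 : m + (i + 2) - i = m + 2 := by rw [add_comm i 2, ← add_assoc, add_sub_cancel_right]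
  have e3 : m + (i + 2) - (i + 1) = m + 1 := by
    revert m i; decide
  rw [e1, e2, e3]
  fin_cases m
  · exact h1
  · refine Eq.trans ?_ h2
    change (A.t _ _).1 1 + (A.t _ _).1 0 + (A.t _ _).1 2 = _
    abel
  · refine Eq.trans ?_ h3
    change (A.t _ _).1 2 + (A.t _ _).1 1 + (A.t _ _).1 0 = _
    abel

/-! ### The Jacobi identity for `𝔤(S, S')` -/

namespace Magic

variable {A A'}

protected theorem lie_add (X Y Z : Magic A A') : ⁅X, Y + Z⁆ = ⁅X, Y⁆ + ⁅X, Z⁆ :=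
  (bracket X).map_add Y Z

protected theorem add_lie (X Y Z : Magic A A') : ⁅X + Y, Z⁆ = ⁅X, Z⁆ + ⁅Y, Z⁆ :=
  LinearMap.map_add₂ bracket X Y Z

protected theorem lie_neg (X Y : Magic A A') : ⁅X, -Y⁆ = -⁅X, Y⁆ := (bracket X).map_neg Y

protected theorem lie_zero (X : Magic A A') : ⁅X, (0 : Magic A A')⁆ = 0 := (bracket X).map_zero

protected theorem zero_lie (X : Magic A A') : ⁅(0 : Magic A A'), X⁆ = 0 :=
  LinearMap.map_zero₂ bracket X

theorem iotaSame_tmul (i : Fin 3) (a b : S) (x y : S') :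
    iotaSame i (a ⊗ₜ[F] x) (b ⊗ₜ[F] y) =
      (A'.q x y • (A.theta ^ (i : ℕ)) (A.t a b), A.q a b • (A'.theta ^ (i : ℕ)) (A'.t x y)) := by
  simp [iotaSame, tLeft, tRight]

theorem act_tmul (i : Fin 3) (d : A.tri × A'.tri) (a : S) (x : S') :
    act i d (a ⊗ₜ[F] x) = d.1.1 i a ⊗ₜ[F] x + a ⊗ₜ[F] d.2.1 i x := rfl

theorem tensorMul_tmul (a b : S) (x y : S') :
    tensorMul A A' (a ⊗ₜ[F] x) (b ⊗ₜ[F] y) = A.mul a b ⊗ₜ[F] A'.mul x y := rfl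

theorem iotaSame_swap (i : Fin 3) (u w : S ⊗[F] S') :
    iotaSame (A := A) (A' := A') i u w = -iotaSame i w u := by
  induction u with
  | zero => simp
  | add u u' h h' => simp only [map_add, LinearMap.add_apply, h, h', neg_add]
  | tmul a x =>
    induction w with
    | zero => simp
    | add u u' h h' => simp only [map_add, LinearMap.add_apply, h, h', neg_add]
    | tmul b y =>
      rw [iotaSame_tmul, iotaSame_tmul, A.t_swap a b, A'.t_swap x y, A.q_comm a b, A'.q_comm x y]
      simp

theorem iotaSame_self (i : Fin 3) (u : S ⊗[F] S') :
    iotaSame (A := A) (A' := A') i u u = 0 := by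
  have h := iotaSame_swap (A := A) (A' := A') i u u
  rw [eq_neg_iff_add_eq_zero, ← two_smul F] at h
  exact (smul_eq_zero.1 h).resolve_left (NeZero.ne 2)

theorem triLie₂_self (d : A.tri × A'.tri) : triLie₂ d d = 0 := by
  have h1 : A.triLie d.1 d.1 = 0 := by
    ext i : 2
    exact sub_self _
  have h2 : A'.triLie d.2 d.2 = 0 := by
    ext i : 2
    exact sub_self _
  simp [triLie₂, h1, h2]

/-- The product of `𝔤(S, S')` is alternating. -/
theorem lie_self_eq_zero (X : Magic A A') : ⁅X, X⁆ = 0 := by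
  rw [lie_eq, triLie₂_self, map_zero, zero_add]
  refine Finset.sum_eq_zero fun i _ => ?_
  rw [iotaSame_self, map_zero]
  abel

theorem lie_swap (X Y : Magic A A') : ⁅X, Y⁆ = -⁅Y, X⁆ := by
  have h := lie_self_eq_zero (X + Y)
  rw [Magic.lie_add, Magic.add_lie, Magic.add_lie, lie_self_eq_zero, lie_self_eq_zero,
    zero_add, add_zero] at h
  rw [eq_neg_iff_add_eq_zero, add_comm]
  exact h

theorem lie_ofTri_ofTri' (d e : A.tri × A'.tri) :
    ⁅(ofTri d : Magic A A'), (ofTri e : Magic A A')⁆ = ofTri (triLie₂ d e) := by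
  simp [lie_eq]

theorem lie_ofTri_iota' (d : A.tri × A'.tri) (i : Fin 3) (u : S ⊗[F] S') :
    ⁅(ofTri d : Magic A A'), (iota i u : Magic A A')⁆ = iota i (act i d u) := by
  induction u with
  | zero => simp [Magic.lie_zero]
  | add u u' h h' => simp only [map_add, Magic.lie_add, h, h']
  | tmul a x => rw [lie_ofTri_iota, act_tmul]

theorem lie_iota_ofTri (d : A.tri × A'.tri) (i : Fin 3) (u : S ⊗[F] S') :
    ⁅(iota i u : Magic A A'), (ofTri d : Magic A A')⁆ = -iota i (act i d u) := by
  rw [lie_swap, lie_ofTri_iota']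

theorem lie_iota_iota_self (i : Fin 3) (u w : S ⊗[F] S') :
    ⁅(iota i u : Magic A A'), (iota i w : Magic A A')⁆ = ofTri (iotaSame i u w) := by
  induction u with
  | zero => simp [Magic.zero_lie]
  | add u u' h h' => simp only [map_add, Magic.add_lie, h, h', LinearMap.add_apply]
  | tmul a x =>
    induction w with
    | zero => simp [Magic.lie_zero]
    | add u u' h h' => simp only [map_add, Magic.lie_add, h, h']
    | tmul b y => rw [lie_iota_iota, iotaSame_tmul]

theorem lie_iota_iota_add_one (i : Fin 3) (u w : S ⊗[F] S') :
    ⁅(iota i u : Magic A A'), (iota (i + 1) w : Magic A A')⁆ =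
      iota (i + 2) (tensorMul A A' u w) := by
  induction u with
  | zero => simp [Magic.zero_lie]
  | add u u' h h' => simp only [map_add, Magic.add_lie, h, h', LinearMap.add_apply]
  | tmul a x =>
    induction w with
    | zero => simp [Magic.lie_zero]
    | add u u' h h' => simp only [map_add, Magic.lie_add, h, h']
    | tmul b y => rw [lie_iota_iota_succ, tensorMul_tmul]

theorem lie_iota_iota_add_two (i : Fin 3) (u w : S ⊗[F] S') :
    ⁅(iota i u : Magic A A'), (iota (i + 2) w : Magic A A')⁆ =
      -iota (i + 1) (tensorMul A A' w u) := by
  have e : i = i + 2 + 1 := by revert i; decide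
  have e' : i + 1 = i + 2 + 2 := by revert i; decide
  rw [lie_swap]
  nth_rw 2 [e]
  rw [lie_iota_iota_add_one, ← e']

theorem act_triLie₂ (i : Fin 3) (d e : A.tri × A'.tri) (u : S ⊗[F] S') :
    act i (triLie₂ d e) u = act i d (act i e u) - act i e (act i d u) := by
  induction u with
  | zero => simp
  | add u u' h h' => simp only [map_add, h, h']; abel
  | tmul a x =>
    have h1 : (triLie₂ d e).1 = A.triLie d.1 e.1 := by simp [triLie₂]
    have h2 : (triLie₂ d e).2 = A'.triLie d.2 e.2 := by simp [triLie₂]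
    simp only [act_tmul, map_add, h1, h2, triLie_apply, LinearMap.sub_apply, Module.End.mul_apply,
      TensorProduct.sub_tmul, TensorProduct.tmul_sub]
    abel

/-- Invariance of `(u, w) ↦ [ι_i u, ι_i w]` under `𝔱𝔯𝔦(S) ⊕ 𝔱𝔯𝔦(S')`, which is the Jacobi identity for
`d`, `ι_i u`, `ι_i w`. -/
theorem triLie₂_iotaSame (i : Fin 3) (d : A.tri × A'.tri) (u w : S ⊗[F] S') :
    triLie₂ d (iotaSame i u w) = iotaSame i (act i d u) w + iotaSame i u (act i d w) := by
  induction u with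
  | zero => simp
  | add u u' h h' => simp only [map_add, LinearMap.add_apply, h, h']; abel
  | tmul a x =>
    induction w with
    | zero => simp
    | add u u' h h' => simp only [map_add, h, h']; abel
    | tmul b y =>
      have h : ∀ e : A.tri × A'.tri, triLie₂ d e = (A.triLie d.1 e.1, A'.triLie d.2 e.2) :=
        fun e => by simp [triLie₂]
      have q1 := A.tri_q d.1.2 i a b
      have q2 := A'.tri_q d.2.2 i x y
      simp only [h, act_tmul, map_add, LinearMap.add_apply, iotaSame_tmul, map_smul,
        triLie_theta_pow_t]
      refine Prod.ext ?_ ?_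
      · have e := congrArg (fun c : F => c • (A.theta ^ (i : ℕ)) (A.t a b)) q2
        simp only [Prod.fst_add]
        linear_combination (norm := module) -e
      · have e := congrArg (fun c : F => c • (A'.theta ^ (i : ℕ)) (A'.t x y)) q1
        simp only [Prod.snd_add]
        linear_combination (norm := module) -e

/-- Invariance of the product of `S ⊗ S'` under `𝔱𝔯𝔦(S) ⊕ 𝔱𝔯𝔦(S')`, which is the Jacobi identity for `d`,
`ι_{i+1} u`, `ι_{i+2} w`. -/
theorem act_tensorMul (i : Fin 3) (d : A.tri × A'.tri) (u w : S ⊗[F] S') :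
    act i d (tensorMul A A' u w) =
      tensorMul A A' (act (i + 1) d u) w + tensorMul A A' u (act (i + 2) d w) := by
  induction u with
  | zero => simp
  | add u u' h h' => simp only [map_add, LinearMap.add_apply, h, h']; abel
  | tmul a x =>
    induction w with
    | zero => simp
    | add u u' h h' => simp only [map_add, h, h']; abel
    | tmul b y =>
      simp only [act_tmul, map_add, LinearMap.add_apply, tensorMul_tmul, A.tri_mul d.1.2 i,
        A'.tri_mul d.2.2 i, TensorProduct.add_tmul, TensorProduct.tmul_add]
      abel

/-- The Jacobi identity for three elements of `ι_i(S ⊗ S')`, where `[ι_i u, ι_i v]` acts through the maps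
`σ_{a,b}`. -/
theorem act_iotaSame (i : Fin 3) (u v w : S ⊗[F] S') :
    act i (iotaSame (A := A) (A' := A') i u v) w + act i (iotaSame (A := A) (A' := A') i v w) u +
      act i (iotaSame (A := A) (A' := A') i w u) v = 0 := by
  induction u with
  | zero => simp
  | add u u' h h' =>
    simp only [map_add, LinearMap.add_apply]; linear_combination (norm := abel) h + h'
  | tmul a x =>
    induction v with
    | zero => simp
    | add u u' h h' =>
      simp only [map_add, LinearMap.add_apply]; linear_combination (norm := abel) h + h'
    | tmul b y =>
      induction w with
      | zero => simp
      | add u u' h h' =>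
        simp only [map_add, LinearMap.add_apply]; linear_combination (norm := abel) h + h'
      | tmul c z =>
        have h (a b c : S) (r : F) : (r • (A.theta ^ (i : ℕ)) (A.t a b)).1 i c =
            r • (A.q a c • b - A.q b c • a) := by
          change r • ((A.theta ^ (i : ℕ)) (A.t a b)).1 i c = _
          rw [theta_pow_apply, sub_self]
          rfl
        have h' (a b c : S') (r : F) : (r • (A'.theta ^ (i : ℕ)) (A'.t a b)).1 i c =
            r • (A'.q a c • b - A'.q b c • a) := by
          change r • ((A'.theta ^ (i : ℕ)) (A'.t a b)).1 i c = _
          rw [theta_pow_apply, sub_self]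
          rfl
        simp only [iotaSame_tmul, act_tmul, h, h', TensorProduct.sub_tmul, TensorProduct.tmul_sub,
          ← TensorProduct.smul_tmul', TensorProduct.tmul_smul, smul_sub, smul_smul]
        rw [A.q_comm b a, A.q_comm c a, A.q_comm c b, A'.q_comm y x, A'.q_comm z x, A'.q_comm z y]
        module

/-- Two linearized composition identities `p + r = α c` and `p' + r' = β z` combine to the action of
`β t_{a,b} + α t'_{x,y}` on `c ⊗ z`; the mixed terms `p ⊗ r'` and `r ⊗ p'` cancel because of the
factor `½` in `t`. -/
theorem tmul_half_sub {c p r : S} {z p' r' : S'} {α β : F} (h : p + r = α • c)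
    (h' : p' + r' = β • z) :
    (β • ((2⁻¹ * α) • c - r)) ⊗ₜ[F] z + c ⊗ₜ[F] (α • ((2⁻¹ * β) • z - r')) =
      p ⊗ₜ[F] p' - r ⊗ₜ[F] r' := by
  have h2 : (2⁻¹ : F) * 2 = 1 := inv_mul_cancel₀ (NeZero.ne 2)
  have hh : ∀ u : S ⊗[F] S', (2⁻¹ : F) • u + (2⁻¹ : F) • u = u := fun u => by
    rw [← add_smul, ← two_mul, mul_comm, h2, one_smul]
  rw [TensorProduct.smul_tmul β (_ : S) z, ← TensorProduct.smul_tmul α c, mul_smul, mul_smul,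
    ← h, ← h']
  simp only [TensorProduct.sub_tmul, TensorProduct.tmul_sub, TensorProduct.add_tmul,
    TensorProduct.tmul_add, smul_add, ← TensorProduct.smul_tmul', TensorProduct.tmul_smul]
  linear_combination (norm := module)
    hh (p ⊗ₜ[F] p') + hh (p ⊗ₜ[F] r') + hh (r ⊗ₜ[F] p') + hh (r ⊗ₜ[F] r')

/-- The Jacobi identity for `ι_i u`, `ι_i v`, `ι_{i+1} w`. -/
theorem act_add_one_iotaSame (i : Fin 3) (u v w : S ⊗[F] S') :
    act (i + 1) (iotaSame (A := A) (A' := A') i u v) w =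
      tensorMul A A' (tensorMul A A' u w) v - tensorMul A A' (tensorMul A A' v w) u := by
  induction u with
  | zero => simp
  | add u u' h h' =>
    simp only [map_add, LinearMap.add_apply]; linear_combination (norm := abel) h + h'
  | tmul a x =>
    induction v with
    | zero => simp
    | add u u' h h' =>
      simp only [map_add, LinearMap.add_apply]; linear_combination (norm := abel) h + h'
    | tmul b y =>
      induction w with
      | zero => simp
      | add u u' h h' =>
        simp only [map_add, LinearMap.add_apply]; linear_combination (norm := abel) h + h'
      | tmul c z =>
        have h (r : F) : (r • (A.theta ^ (i : ℕ)) (A.t a b)).1 (i + 1) c =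
            r • ((2⁻¹ * A.q a b) • c - A.mul (A.mul b c) a) := by
          change r • ((A.theta ^ (i : ℕ)) (A.t a b)).1 (i + 1) c = _
          rw [theta_pow_apply, add_sub_cancel_left]
          rfl
        have h' (r : F) : (r • (A'.theta ^ (i : ℕ)) (A'.t x y)).1 (i + 1) z =
            r • ((2⁻¹ * A'.q x y) • z - A'.mul (A'.mul y z) x) := by
          change r • ((A'.theta ^ (i : ℕ)) (A'.t x y)).1 (i + 1) z = _
          rw [theta_pow_apply, add_sub_cancel_left]
          rfl
        simp only [iotaSame_tmul, act_tmul, h, h', tensorMul_tmul]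
        exact tmul_half_sub (A.mul_mul_left a c b) (A'.mul_mul_left x z y)

/-- The Jacobi identity for `ι_i u`, `ι_i v`, `ι_{i+2} w`. -/
theorem act_add_two_iotaSame (i : Fin 3) (u v w : S ⊗[F] S') :
    act (i + 2) (iotaSame (A := A) (A' := A') i u v) w =
      tensorMul A A' v (tensorMul A A' w u) - tensorMul A A' u (tensorMul A A' w v) := by
  induction u with
  | zero => simp
  | add u u' h h' =>
    simp only [map_add, LinearMap.add_apply]; linear_combination (norm := abel) h + h'
  | tmul a x =>
    induction v with
    | zero => simp
    | add u u' h h' =>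
      simp only [map_add, LinearMap.add_apply]; linear_combination (norm := abel) h + h'
    | tmul b y =>
      induction w with
      | zero => simp
      | add u u' h h' =>
        simp only [map_add, LinearMap.add_apply]; linear_combination (norm := abel) h + h'
      | tmul c z =>
        have h (r : F) : (r • (A.theta ^ (i : ℕ)) (A.t a b)).1 (i + 2) c =
            r • ((2⁻¹ * A.q a b) • c - A.mul a (A.mul c b)) := by
          change r • ((A.theta ^ (i : ℕ)) (A.t a b)).1 (i + 2) c = _
          rw [theta_pow_apply, add_sub_cancel_left]
          rfl
        have h' (r : F) : (r • (A'.theta ^ (i : ℕ)) (A'.t x y)).1 (i + 2) z =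
            r • ((2⁻¹ * A'.q x y) • z - A'.mul x (A'.mul z y)) := by
          change r • ((A'.theta ^ (i : ℕ)) (A'.t x y)).1 (i + 2) z = _
          rw [theta_pow_apply, add_sub_cancel_left]
          rfl
        simp only [iotaSame_tmul, act_tmul, h, h', tensorMul_tmul]
        refine tmul_half_sub ?_ ?_
        · rw [add_comm]; exact A.mul_mul_right a c b
        · rw [add_comm]; exact A'.mul_mul_right x z y

/-- The Jacobi identity for `ι_i u`, `ι_{i+1} v`, `ι_{i+2} w`, which reduces to `t_cyclic`. -/
theorem iotaSame_cyclic (i : Fin 3) (u v w : S ⊗[F] S') :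
    iotaSame (A := A) (A' := A') (i + 2) (tensorMul A A' u v) w +
      iotaSame i (tensorMul A A' v w) u + iotaSame (i + 1) (tensorMul A A' w u) v = 0 := by
  induction u with
  | zero => simp
  | add u u' h h' =>
    simp only [map_add, LinearMap.add_apply]; linear_combination (norm := abel) h + h'
  | tmul a x =>
    induction v with
    | zero => simp
    | add u u' h h' =>
      simp only [map_add, LinearMap.add_apply]; linear_combination (norm := abel) h + h'
    | tmul b y =>
      induction w with
      | zero => simp
      | add u u' h h' =>
        simp only [map_add, LinearMap.add_apply]; linear_combination (norm := abel) h + h'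
      | tmul c z =>
        simp only [tensorMul_tmul, iotaSame_tmul]
        rw [A.q_mul_left_cyc c a b, ← A.q_mul_left_cyc a b c, A'.q_mul_left_cyc z x y,
          ← A'.q_mul_left_cyc x y z]
        refine Prod.ext ?_ ?_
        · simp only [Prod.fst_add, ← smul_add, A.t_cyclic, smul_zero, Prod.fst_zero]
        · simp only [Prod.snd_add, ← smul_add, A'.t_cyclic, smul_zero, Prod.snd_zero]

/-- The elements of `𝔱𝔯𝔦(S) ⊕ 𝔱𝔯𝔦(S')` and of the `ι_i(S ⊗ S')` generate `𝔤(S, S')` additively. -/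
theorem generators_induction {p : Magic A A' → Prop} (X : Magic A A')
    (add : ∀ X Y, p X → p Y → p (X + Y)) (tri : ∀ d, p (ofTri d)) (io : ∀ i u, p (iota i u)) :
    p X := by
  have h : X = ofTri (triPart A A' X) + (iota 0 (iotaPart A A' 0 X) +
      (iota 1 (iotaPart A A' 1 X) + iota 2 (iotaPart A A' 2 X))) := by
    obtain ⟨d, u⟩ := X
    refine Prod.ext ?_ ?_
    · change d = d + (0 + (0 + 0))
      simp
    · change u = 0 + ((Pi.single 0 (u 0) : Fin 3 → S ⊗[F] S') + ((Pi.single 1 (u 1) :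
        Fin 3 → S ⊗[F] S') + (Pi.single 2 (u 2) : Fin 3 → S ⊗[F] S')))
      funext j
      fin_cases j <;> simp
  rw [h]
  exact add _ _ (tri _) (add _ _ (io _ _) (add _ _ (io _ _) (io _ _)))

/-- The Jacobi identity for a triple of elements of `𝔤(S, S')`. -/
def Jacobi (X Y Z : Magic A A') : Prop := ⁅X, ⁅Y, Z⁆⁆ + ⁅Y, ⁅Z, X⁆⁆ + ⁅Z, ⁅X, Y⁆⁆ = 0

theorem Jacobi.rotate {X Y Z : Magic A A'} (h : Jacobi X Y Z) : Jacobi Y Z X := by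
  unfold Jacobi at *
  rw [← h]; abel

theorem Jacobi.swap {X Y Z : Magic A A'} (h : Jacobi X Y Z) : Jacobi Y X Z := by
  unfold Jacobi at *
  rw [lie_swap X Z, lie_swap Z Y, lie_swap Y X, Magic.lie_neg, Magic.lie_neg, Magic.lie_neg]
  linear_combination (norm := abel) -h

theorem Jacobi.add {X Y Z X' : Magic A A'} (h : Jacobi X Y Z) (h' : Jacobi X' Y Z) :
    Jacobi (X + X') Y Z := by
  unfold Jacobi at *
  simp only [Magic.lie_add, Magic.add_lie]
  linear_combination (norm := abel) h + h'

theorem jacobi_tri_tri_tri (d e f : A.tri × A'.tri) :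
    Jacobi (ofTri d : Magic A A') (ofTri e) (ofTri f) := by
  have hA (d e f : A.tri) : A.triLie d (A.triLie e f) + A.triLie e (A.triLie f d) +
      A.triLie f (A.triLie d e) = 0 := by
    ext i : 2
    change (A.triLie d (A.triLie e f)).1 i + (A.triLie e (A.triLie f d)).1 i +
      (A.triLie f (A.triLie d e)).1 i = 0
    simp only [triLie_apply]
    noncomm_ring
  have hA' (d e f : A'.tri) : A'.triLie d (A'.triLie e f) + A'.triLie e (A'.triLie f d) +
      A'.triLie f (A'.triLie d e) = 0 := by
    ext i : 2
    change (A'.triLie d (A'.triLie e f)).1 i + (A'.triLie e (A'.triLie f d)).1 i +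
      (A'.triLie f (A'.triLie d e)).1 i = 0
    simp only [triLie_apply]
    noncomm_ring
  unfold Jacobi
  simp only [lie_ofTri_ofTri]
  rw [← map_add, ← map_add, Prod.mk_add_mk, Prod.mk_add_mk, hA, hA']
  exact map_zero _

theorem jacobi_tri_tri_iota (d e : A.tri × A'.tri) (i : Fin 3) (u : S ⊗[F] S') :
    Jacobi (ofTri d : Magic A A') (ofTri e) (iota i u) := by
  unfold Jacobi
  rw [lie_ofTri_iota', lie_ofTri_iota', lie_iota_ofTri, Magic.lie_neg, lie_ofTri_iota',
    lie_ofTri_ofTri', lie_iota_ofTri, act_triLie₂, map_sub]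
  abel

theorem jacobi_tri_iota_iota (d : A.tri × A'.tri) (i j : Fin 3) (u w : S ⊗[F] S') :
    Jacobi (ofTri d : Magic A A') (iota i u) (iota j w) := by
  have key (i : Fin 3) (u w : S ⊗[F] S') :
      Jacobi (ofTri d : Magic A A') (iota i u) (iota (i + 1) w) := by
    have e1 : i + 2 + 1 = i := by revert i; decide
    have e2 : i + 2 + 2 = i + 1 := by revert i; decide
    unfold Jacobi
    rw [lie_iota_iota_add_one, lie_ofTri_iota', lie_iota_ofTri, Magic.lie_neg,
      lie_iota_iota_add_one, lie_ofTri_iota', lie_swap (iota (i + 1) w),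
      lie_iota_iota_add_one, act_tensorMul, e1, e2, map_add]
    abel
  obtain rfl | rfl | rfl : j = i ∨ j = i + 1 ∨ i = j + 1 := by revert i j; decide
  · unfold Jacobi
    rw [lie_iota_iota_self, lie_ofTri_ofTri', lie_iota_ofTri, Magic.lie_neg, lie_iota_iota_self,
      lie_ofTri_iota', lie_iota_iota_self, triLie₂_iotaSame, iotaSame_swap _ w, map_add, map_neg]
    abel
  · exact key i u w
  · exact (key j w u).rotate.swap.rotate.rotate

theorem jacobi_iota_iota_iota_self (i : Fin 3) (u v w : S ⊗[F] S') :
    Jacobi (iota i u : Magic A A') (iota i v) (iota i w) := by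
  unfold Jacobi
  simp only [lie_iota_iota_self, lie_iota_ofTri]
  have h := congrArg (iota (A := A) (A' := A') i) (act_iotaSame (A := A) (A' := A') i u v w)
  simp only [map_add, map_zero] at h
  linear_combination (norm := abel) -h

theorem jacobi_iota_iota_iota_add_one (i : Fin 3) (u v w : S ⊗[F] S') :
    Jacobi (iota i u : Magic A A') (iota i v) (iota (i + 1) w) := by
  unfold Jacobi
  rw [lie_swap (iota (i + 1) w), lie_iota_iota_add_one, lie_iota_iota_add_one, Magic.lie_neg,
    lie_iota_iota_add_two, lie_iota_iota_add_two, lie_iota_iota_self, lie_iota_ofTri,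
    act_add_one_iotaSame, map_sub]
  abel

theorem jacobi_iota_iota_iota_add_two (i : Fin 3) (u v w : S ⊗[F] S') :
    Jacobi (iota i u : Magic A A') (iota i v) (iota (i + 2) w) := by
  unfold Jacobi
  rw [lie_swap (iota (i + 2) w), lie_iota_iota_add_two, lie_iota_iota_add_two, neg_neg,
    Magic.lie_neg, lie_iota_iota_add_one, lie_iota_iota_add_one, lie_iota_iota_self,
    lie_iota_ofTri, act_add_two_iotaSame, map_sub]
  abel

theorem jacobi_iota_iota_iota_distinct (i : Fin 3) (u v w : S ⊗[F] S') :
    Jacobi (iota i u : Magic A A') (iota (i + 1) v) (iota (i + 2) w) := by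
  have e1 : i + 2 = i + 1 + 1 := by revert i; decide
  have e2 : i = i + 1 + 2 := by revert i; decide
  have e3 : i = i + 2 + 1 := by revert i; decide
  have e4 : i + 1 = i + 2 + 2 := by revert i; decide
  have l1 : ⁅(iota (i + 1) v : Magic A A'), (iota (i + 2) w : Magic A A')⁆ =
      iota i (tensorMul A A' v w) := by
    conv_lhs => rw [e1]
    rw [lie_iota_iota_add_one, ← e2]
  have l2 : ⁅(iota (i + 2) w : Magic A A'), (iota i u : Magic A A')⁆ =
      iota (i + 1) (tensorMul A A' w u) := by
    conv_lhs => rw [e3]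
    rw [← e3]
    nth_rw 2 [e3]
    rw [lie_iota_iota_add_one, ← e4]
  have h := congrArg (ofTri (A := A) (A' := A'))
    (iotaSame_cyclic (A := A) (A' := A') i u v w)
  unfold Jacobi
  rw [l1, l2, lie_iota_iota_add_one, lie_iota_iota_self, lie_iota_iota_self, lie_iota_iota_self,
    iotaSame_swap _ u, iotaSame_swap _ v, iotaSame_swap _ w]
  simp only [map_add, map_neg, map_zero] at h ⊢
  linear_combination (norm := abel) -h

theorem jacobi_iota_iota_iota (i j k : Fin 3) (u v w : S ⊗[F] S') :
    Jacobi (iota i u : Magic A A') (iota j v) (iota k w) := by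
  have key (i k : Fin 3) (u v w : S ⊗[F] S') :
      Jacobi (iota i u : Magic A A') (iota i v) (iota k w) := by
    obtain rfl | rfl | rfl : k = i ∨ k = i + 1 ∨ k = i + 2 := by revert i k; decide
    · exact jacobi_iota_iota_iota_self _ u v w
    · exact jacobi_iota_iota_iota_add_one i u v w
    · exact jacobi_iota_iota_iota_add_two i u v w
  obtain rfl | rfl | rfl | ⟨rfl, rfl⟩ | ⟨rfl, rfl⟩ : i = j ∨ j = k ∨ k = i ∨
      (j = i + 1 ∧ k = i + 2) ∨ (i = j + 1 ∧ k = j + 2) := by revert i j k; decide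
  · exact key _ _ u v w
  · exact (key _ _ v w u).rotate.rotate
  · exact (key _ _ w u v).rotate
  · exact jacobi_iota_iota_iota_distinct i u v w
  · exact (jacobi_iota_iota_iota_distinct j v u w).swap

/-- `𝔤(S, S')` satisfies the Jacobi identity, for all symmetric composition algebras. -/
theorem jacobi (X Y Z : Magic A A') : ⁅X, ⁅Y, Z⁆⁆ + ⁅Y, ⁅Z, X⁆⁆ + ⁅Z, ⁅X, Y⁆⁆ = 0 := by
  change Jacobi X Y Z
  induction X using generators_induction with
  | add X X' h h' => exact h.add h'
  | tri d =>
    induction Y using generators_induction with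
    | add Y Y' h h' => exact (h.rotate.add h'.rotate).rotate.rotate
    | tri e =>
      induction Z using generators_induction with
      | add Z Z' h h' => exact (h.rotate.rotate.add h'.rotate.rotate).rotate
      | tri f => exact jacobi_tri_tri_tri d e f
      | io i u => exact jacobi_tri_tri_iota d e i u
    | io i u =>
      induction Z using generators_induction with
      | add Z Z' h h' => exact (h.rotate.rotate.add h'.rotate.rotate).rotate
      | tri f => exact (jacobi_tri_tri_iota f d i u).rotate
      | io j w => exact jacobi_tri_iota_iota d i j u w
  | io i u =>
    induction Y using generators_induction with
    | add Y Y' h h' => exact (h.rotate.add h'.rotate).rotate.rotate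
    | tri e =>
      induction Z using generators_induction with
      | add Z Z' h h' => exact (h.rotate.rotate.add h'.rotate.rotate).rotate
      | tri f => exact (jacobi_tri_tri_iota e f i u).rotate.rotate
      | io j w => exact (jacobi_tri_iota_iota e j i w u).rotate.rotate
    | io j v =>
      induction Z using generators_induction with
      | add Z Z' h h' => exact (h.rotate.rotate.add h'.rotate.rotate).rotate
      | tri f => exact (jacobi_tri_iota_iota f i j u v).rotate
      | io k w => exact jacobi_iota_iota_iota i j k u v w

end Magic

end SymmetricComposition

namespace SymplecticPlane

variable {F V : Type*} [Field F] [AddCommGroup V] [Module F V] (P : SymplecticPlane F V)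

/-! ### Generators of the split para-octonions and of their endomorphisms -/

section

theorem cayley_hom_ext {N : Type*} [AddCommGroup N] [Module F N] {f g : Cayley F V →ₗ[F] N}
    (h : ∀ i a b, f (half i a b) = g (half i a b)) : f = g := by
  ext1
  · ext a b; exact h 0 a b
  · ext a b; exact h 1 a b

/-- Since the polar form is regular, its values on generators separate elements. In combination with
`cayley_hom_ext` this reduces identities between endomorphisms to polynomial identities in the
coordinates. -/
theorem cayleyForm_ext {X Y : Cayley F V}
    (h : ∀ i a b, P.cayleyForm X (half i a b) = P.cayleyForm Y (half i a b)) : X = Y := by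
  rw [← sub_eq_zero]
  refine P.cayleyForm_regular _ fun Z => ?_
  have : P.cayleyForm X = P.cayleyForm Y := cayley_hom_ext h
  rw [map_sub, this, sub_self, LinearMap.zero_apply]

theorem paraMul_zero_zero (a b c d : V) :
    P.paraMul (half 0 a b) (half 0 c d) = P.form b c • half 0 d a := by
  simp [half, paraMul_apply]

theorem paraMul_one_one (a b c d : V) :
    P.paraMul (half 1 a b) (half 1 c d) = -(P.form b d • half 0 a c) := by
  simp [half, paraMul_apply, ← P.neg_form d b]

theorem paraMul_zero_one (a b c d : V) :
    P.paraMul (half 0 a b) (half 1 c d) = -(P.form a c • half 1 b d) := by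
  simp [half, paraMul_apply, ← P.neg_form c a]

theorem paraMul_one_zero (a b c d : V) :
    P.paraMul (half 1 a b) (half 0 c d) = -(P.form a d • half 1 c b) := by
  simp [half, paraMul_apply]

theorem cayleyForm_half_self (h : Fin 2) (a b c d : V) :
    P.cayleyForm (half h a b) (half h c d) = P.form a c * P.form b d := by
  fin_cases h <;> simp [half, cayleyForm_apply]

theorem cayleyForm_half_of_ne {h g : Fin 2} (hg : h ≠ g) (a b c d : V) :
    P.cayleyForm (half h a b) (half g c d) = 0 := by
  fin_cases h <;> fin_cases g <;> simp [half, cayleyForm_apply] at hg ⊢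

theorem rhoSp_half_zero (s : Fin 4 → P.sp) (a b : V) :
    P.rhoSp s (half 0 a b) = half 0 ((s 0).1 a) b + half 0 a ((s 1).1 b) := by
  simp [rhoSp, half]

theorem rhoSp_half_one (s : Fin 4 → P.sp) (a b : V) :
    P.rhoSp s (half 1 a b) = half 1 ((s 2).1 a) b + half 1 a ((s 3).1 b) := by
  simp [rhoSp, half]

theorem rhoTensor_half_zero (v : Fin 4 → V) (a b : V) :
    P.rhoTensor v (half 0 a b) =
      -((P.form (v 0) a * P.form (v 1) b) • half 1 (v 2) (v 3)) := by
  simp [rhoTensor, half]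

theorem rhoTensor_half_one (v : Fin 4 → V) (a b : V) :
    P.rhoTensor v (half 1 a b) = (P.form (v 2) a * P.form (v 3) b) • half 0 (v 0) (v 1) := by
  simp [rhoTensor, half]

theorem form_sp (s : P.sp) (v w : V) : P.form (s.1 v) w = -P.form v (s.1 w) :=
  P.mem_sp.1 s.2 v w

theorem rhoSp_add (s s' : Fin 4 → P.sp) : P.rhoSp (s + s') = P.rhoSp s + P.rhoSp s' := by
  refine cayley_hom_ext fun i a b => ?_
  fin_cases i <;> simp [rhoSp_half_zero, rhoSp_half_one] <;>
  simp [half, TensorProduct.add_tmul, TensorProduct.tmul_add] <;> abel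

theorem rhoSp_smul (c : F) (s : Fin 4 → P.sp) : P.rhoSp (c • s) = c • P.rhoSp s := by
  refine cayley_hom_ext fun i a b => ?_
  fin_cases i <;> simp [rhoSp_half_zero, rhoSp_half_one] <;>
  simp [half, TensorProduct.smul_tmul', TensorProduct.tmul_smul]

theorem rhoTensor_update_add (v : Fin 4 → V) (i : Fin 4) (x y : V) :
    P.rhoTensor (Function.update v i (x + y)) =
      P.rhoTensor (Function.update v i x) + P.rhoTensor (Function.update v i y) := by
  refine cayley_hom_ext fun h a b => ?_
  fin_cases h <;> simp [rhoTensor_half_zero, rhoTensor_half_one] <;>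
  fin_cases i <;> simp [Function.update] <;>
  simp [half, TensorProduct.add_tmul, TensorProduct.tmul_add] <;> module

theorem rhoTensor_update_smul (v : Fin 4 → V) (i : Fin 4) (c : F) (x : V) :
    P.rhoTensor (Function.update v i (c • x)) = c • P.rhoTensor (Function.update v i x) := by
  refine cayley_hom_ext fun h a b => ?_
  fin_cases h <;> simp [rhoTensor_half_zero, rhoTensor_half_one] <;>
  fin_cases i <;> simp [Function.update] <;>
  simp [half, ← TensorProduct.smul_tmul', TensorProduct.tmul_smul] <;> module

theorem cayleyForm_rhoSp (s : Fin 4 → P.sp) (X Y : Cayley F V) :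
    P.cayleyForm (P.rhoSp s X) Y + P.cayleyForm X (P.rhoSp s Y) = 0 := by
  have : P.cayleyForm ∘ₗ P.rhoSp s + P.cayleyForm.compl₂ (P.rhoSp s) = 0 := by
    refine cayley_hom_ext fun i a b => cayley_hom_ext fun j c d => ?_
    have h01 : (0 : Fin 2) ≠ 1 := by decide
    fin_cases i <;> fin_cases j <;>
    simp [rhoSp_half_zero, rhoSp_half_one, cayleyForm_half_self, form_sp,
      P.cayleyForm_half_of_ne h01, P.cayleyForm_half_of_ne h01.symm]
    all_goals ring
  exact congr($this X Y)

theorem cayleyForm_rhoTensor (v : Fin 4 → V) (X Y : Cayley F V) :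
    P.cayleyForm (P.rhoTensor v X) Y + P.cayleyForm X (P.rhoTensor v Y) = 0 := by
  have : P.cayleyForm ∘ₗ P.rhoTensor v + P.cayleyForm.compl₂ (P.rhoTensor v) = 0 := by
    refine cayley_hom_ext fun i a b => cayley_hom_ext fun j c d => ?_
    have h01 : (0 : Fin 2) ≠ 1 := by decide
    fin_cases i <;> fin_cases j <;>
    simp [rhoTensor_half_zero, rhoTensor_half_one, cayleyForm_half_self,
      P.cayleyForm_half_of_ne h01, P.cayleyForm_half_of_ne h01.symm]
    · rw [← P.neg_form a, ← P.neg_form b]; ring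
    · rw [← P.neg_form a, ← P.neg_form b]; ring
  exact congr($this X Y)

/-- The product of `S₈` is `sp(V)⁴`-equivariant up to cyclic permutations of the first three factors. -/
theorem rhoSp_paraMul (s : Fin 4 → P.sp) (X Y : Cayley F V) :
    P.rhoSp s (P.paraMul X Y) = P.paraMul (P.rhoSp ![s 1, s 2, s 0, s 3] X) Y +
      P.paraMul X (P.rhoSp ![s 2, s 0, s 1, s 3] Y) := by
  have : P.paraMul.compr₂ (P.rhoSp s) = P.paraMul ∘ₗ P.rhoSp ![s 1, s 2, s 0, s 3] +
      P.paraMul.compl₂ (P.rhoSp ![s 2, s 0, s 1, s 3]) := by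
    refine cayley_hom_ext fun i a b => cayley_hom_ext fun j c d => ?_
    fin_cases i <;> fin_cases j <;>
    simp [rhoSp_half_zero, rhoSp_half_one, paraMul_zero_zero, paraMul_zero_one,
      paraMul_one_zero, paraMul_one_one, form_sp] <;> module
  exact congr($this X Y)

/-- The analogue of `rhoSp_paraMul` for `ρ(v₁ ⊗ v₂ ⊗ v₃ ⊗ v₄)`. -/
theorem rhoTensor_paraMul (v : Fin 4 → V) (X Y : Cayley F V) :
    P.rhoTensor v (P.paraMul X Y) = P.paraMul (P.rhoTensor ![v 1, v 2, v 0, v 3] X) Y +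
      P.paraMul X (P.rhoTensor ![v 2, v 0, v 1, v 3] Y) := by
  obtain ⟨e, f, α, β, -, hform, -⟩ := P.exists_coords
  have : P.paraMul.compr₂ (P.rhoTensor v) = P.paraMul ∘ₗ P.rhoTensor ![v 1, v 2, v 0, v 3] +
      P.paraMul.compl₂ (P.rhoTensor ![v 2, v 0, v 1, v 3]) := by
    refine cayley_hom_ext fun i a b => cayley_hom_ext fun j c d => P.cayleyForm_ext fun k x y => ?_
    have h01 : (0 : Fin 2) ≠ 1 := by decide
    fin_cases i <;> fin_cases j <;> fin_cases k <;>
    simp [rhoTensor_half_zero, rhoTensor_half_one, paraMul_zero_zero, paraMul_zero_one,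
      paraMul_one_zero, paraMul_one_one, cayleyForm_half_self,
      P.cayleyForm_half_of_ne h01, P.cayleyForm_half_of_ne h01.symm]
    all_goals
      simp only [hform]
      ring
  exact congr($this X Y)

theorem rhoSp_commutator (s s' : Fin 4 → P.sp) :
    P.rhoSp s * P.rhoSp s' - P.rhoSp s' * P.rhoSp s = P.rhoSp (P.spPowLie s s') := by
  have h (i : Fin 4) : (P.spPowLie s s' i).1 = (s i).1 * (s' i).1 - (s' i).1 * (s i).1 := rfl
  refine cayley_hom_ext fun i a b => ?_
  fin_cases i <;>
  simp [rhoSp_half_zero, rhoSp_half_one, h] <;>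
  simp [half, TensorProduct.sub_tmul, TensorProduct.tmul_sub] <;> abel

theorem rhoSp_rhoTensor_commutator (s : Fin 4 → P.sp) (v : Fin 4 → V) :
    P.rhoSp s * P.rhoTensor v - P.rhoTensor v * P.rhoSp s =
      ∑ j, P.rhoTensor (Function.update v j ((s j).1 (v j))) := by
  refine cayley_hom_ext fun i a b => ?_
  rw [Fin.sum_univ_four]
  fin_cases i <;>
  simp [rhoSp_half_zero, rhoSp_half_one, rhoTensor_half_zero, rhoTensor_half_one, form_sp] <;>
  module

/-- The element `((∏_{i ≠ j} ⟨v_i | w_i⟩) γ_{v_j, w_j})_j` of `sp(V)^n`. -/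
def gammaProd {n : ℕ} (v w : Fin n → V) (j : Fin n) : P.sp :=
  (∏ i, if i = j then 1 else P.form (v i) (w i)) • P.gamma (v j) (w j)

variable [NeZero (2 : F)]

theorem rhoTensor_commutator (v w : Fin 4 → V) :
    P.rhoTensor v * P.rhoTensor w - P.rhoTensor w * P.rhoTensor v =
      (2⁻¹ : F) • P.rhoSp (P.gammaProd v w) := by
  obtain ⟨e, f, α, β, -, hform, -⟩ := P.exists_coords
  have h2 : (2 : F) ≠ 0 := NeZero.ne 2
  have hg (a b c : V) : (P.gamma a b).1 c = P.form a c • b + P.form b c • a := rfl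
  refine cayley_hom_ext fun i a b => P.cayleyForm_ext fun k x y => ?_
  have h01 : (0 : Fin 2) ≠ 1 := by decide
  fin_cases i <;> fin_cases k <;>
  simp [rhoSp_half_zero, rhoSp_half_one, rhoTensor_half_zero, rhoTensor_half_one,
      cayleyForm_half_self, gammaProd, hg, Fin.prod_univ_four,
      P.cayleyForm_half_of_ne h01, P.cayleyForm_half_of_ne h01.symm]
  all_goals
    simp only [hform]
    field_simp
    ring

end

/-! ### Elements of the triality Lie algebra of `S₈` -/

section

variable [NeZero (2 : F)]

theorem S8_q (X Y : Cayley F V) : P.S8.q X Y = P.cayleyForm X Y := P.polar_S8 X Y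

theorem cyc_injective : ∀ k, Function.Injective (cyc k) := by decide

theorem cyc_cyc : ∀ k j i, cyc k (cyc (j - k) i) = cyc j i := by decide

theorem mem_tri_S8 {d : Fin 3 → Module.End F (Cayley F V)}
    (h : ∀ k X Y, P.cayleyForm (d k X) Y + P.cayleyForm X (d k Y) = 0)
    (h' : ∀ X Y, d 0 (P.paraMul X Y) = P.paraMul (d 1 X) Y + P.paraMul X (d 2 Y)) :
    d ∈ P.S8.tri :=
  ⟨fun k X Y => by rw [S8_q, S8_q]; exact h k X Y, h'⟩

theorem comp_cyc {T : Type*} (s : Fin 4 → T) : (fun j => s (cyc 0 j)) = s ∧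
    (fun j => s (cyc 1 j)) = ![s 1, s 2, s 0, s 3] ∧
    (fun j => s (cyc 2 j)) = ![s 2, s 0, s 1, s 3] := by
  refine ⟨?_, ?_, ?_⟩ <;> funext j <;> fin_cases j <;> rfl

theorem rhoSp_mem_tri (s : Fin 4 → P.sp) : (fun k => P.rhoSp fun j => s (cyc k j)) ∈ P.S8.tri := by
  refine P.mem_tri_S8 (fun k X Y => P.cayleyForm_rhoSp _ X Y) fun X Y => ?_
  simp only [(comp_cyc s).1, (comp_cyc s).2.1, (comp_cyc s).2.2]
  exact P.rhoSp_paraMul s X Y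

theorem rhoTensor_mem_tri (v : Fin 4 → V) :
    (fun k => P.rhoTensor fun j => v (cyc k j)) ∈ P.S8.tri := by
  refine P.mem_tri_S8 (fun k X Y => P.cayleyForm_rhoTensor _ X Y) fun X Y => ?_
  simp only [(comp_cyc v).1, (comp_cyc v).2.1, (comp_cyc v).2.2]
  exact P.rhoTensor_paraMul v X Y

/-- The action of `sp(V)⁴` on `S₈` by triples in the triality Lie algebra. -/
def spTriple : (Fin 4 → P.sp) →ₗ[F] P.S8.tri where
  toFun s := ⟨fun k => P.rhoSp fun j => s (cyc k j), P.rhoSp_mem_tri s⟩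
  map_add' s s' := Subtype.ext <| funext fun k =>
    P.rhoSp_add (fun j => s (cyc k j)) fun j => s' (cyc k j)
  map_smul' c s := Subtype.ext <| funext fun k => P.rhoSp_smul c fun j => s (cyc k j)

theorem spTriple_apply (s : Fin 4 → P.sp) (k : Fin 3) :
    (P.spTriple s).1 k = P.rhoSp fun j => s (cyc k j) := rfl

theorem comp_update_cyc (v : Fin 4 → V) (k : Fin 3) (i : Fin 4) :
    ∃ i', ∀ x, (fun j => Function.update v i x (cyc k j)) =
      Function.update (fun j => v (cyc k j)) i' x := by
  obtain ⟨i', rfl⟩ := (Finite.injective_iff_surjective.1 (cyc_injective k)) i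
  exact ⟨i', fun x => Function.update_comp_eq_of_injective v (cyc_injective k) i' x⟩

/-- The action of `V₁ ⊗ V₂ ⊗ V₃ ⊗ V₄` on `S₈` by triples in the triality Lie algebra. -/
def tensorTriple : MultilinearMap F (fun _ : Fin 4 => V) P.S8.tri where
  toFun v := ⟨fun k => P.rhoTensor fun j => v (cyc k j), P.rhoTensor_mem_tri v⟩
  map_update_add' {inst} v i x y := by
    obtain rfl : inst = instDecidableEqFin 4 := Subsingleton.elim _ _
    refine Subtype.ext <| funext fun k => ?_
    obtain ⟨i', h⟩ := comp_update_cyc v k i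
    change (P.rhoTensor fun j => Function.update v i (x + y) (cyc k j)) =
      (P.rhoTensor fun j => Function.update v i x (cyc k j)) +
        (P.rhoTensor fun j => Function.update v i y (cyc k j))
    rw [h, h, h, rhoTensor_update_add]
  map_update_smul' {inst} v i c x := by
    obtain rfl : inst = instDecidableEqFin 4 := Subsingleton.elim _ _
    refine Subtype.ext <| funext fun k => ?_
    obtain ⟨i', h⟩ := comp_update_cyc v k i
    change (P.rhoTensor fun j => Function.update v i (c • x) (cyc k j)) =
      c • (P.rhoTensor fun j => Function.update v i x (cyc k j))
    rw [h, h, rhoTensor_update_smul]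

theorem tensorTriple_apply (v : Fin 4 → V) (k : Fin 3) :
    (P.tensorTriple v).1 k = P.rhoTensor fun j => v (cyc k j) := rfl

/-- `θ^k` permutes the factors of `sp(V)⁴` cyclically. -/
theorem theta_pow_spTriple (k : Fin 3) (s : Fin 4 → P.sp) :
    (P.S8.theta ^ (k : ℕ)) (P.spTriple fun j => s (cyc k j)) = P.spTriple s := by
  ext j : 2
  simp only [theta_pow_apply, spTriple_apply, cyc_cyc]

/-- `θ^k` permutes the factors of `V₁ ⊗ V₂ ⊗ V₃ ⊗ V₄` cyclically. -/
theorem theta_pow_tensorTriple (k : Fin 3) (v : Fin 4 → V) :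
    (P.S8.theta ^ (k : ℕ)) (P.tensorTriple fun j => v (cyc k j)) = P.tensorTriple v := by
  ext j : 2
  simp only [theta_pow_apply, tensorTriple_apply, cyc_cyc]

theorem triLie_spTriple_spTriple (s s' : Fin 4 → P.sp) :
    P.S8.triLie (P.spTriple s) (P.spTriple s') = P.spTriple (P.spPowLie s s') := by
  ext k : 2
  rw [triLie_apply, spTriple_apply, spTriple_apply, rhoSp_commutator]
  rfl

theorem triLie_spTriple_tensorTriple (s : Fin 4 → P.sp) (v : Fin 4 → V) :
    P.S8.triLie (P.spTriple s) (P.tensorTriple v) =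
      ∑ j, P.tensorTriple (Function.update v j ((s j).1 (v j))) := by
  ext k : 2
  rw [triLie_apply, spTriple_apply, tensorTriple_apply, rhoSp_rhoTensor_commutator]
  have hk : Function.Bijective (cyc k) := Finite.injective_iff_bijective.1 (cyc_injective k)
  rw [Submodule.coe_sum, Finset.sum_apply]
  refine Eq.trans ?_ (hk.sum_comp fun j =>
    (P.tensorTriple (Function.update v j ((s j).1 (v j)))).1 k)
  refine Finset.sum_congr rfl fun j _ => ?_
  rw [tensorTriple_apply]
  congr 1
  exact (Function.update_comp_eq_of_injective v hk.1 j _).symm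

/-- `gammaProd` is compatible with permutations of the indices. -/
theorem gammaProd_comp {m n : ℕ} {f : Fin m → Fin n} (hf : Function.Bijective f)
    (v w : Fin n → V) (j : Fin m) :
    P.gammaProd (fun i => v (f i)) (fun i => w (f i)) j = P.gammaProd v w (f j) := by
  rw [gammaProd, gammaProd, ← hf.prod_comp]
  simp only [hf.1.eq_iff]

theorem triLie_tensorTriple_tensorTriple (v w : Fin 4 → V) :
    P.S8.triLie (P.tensorTriple v) (P.tensorTriple w) =
      (2⁻¹ : F) • P.spTriple (P.gammaProd v w) := by
  ext k : 2
  rw [triLie_apply, tensorTriple_apply, tensorTriple_apply, rhoTensor_commutator]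
  have hk : Function.Bijective (cyc k) := Finite.injective_iff_bijective.1 (cyc_injective k)
  change _ = (2⁻¹ : F) • P.rhoSp fun j => P.gammaProd v w (cyc k j)
  congr 2
  funext j
  exact P.gammaProd_comp hk v w j

theorem S8_mul (X Y : Cayley F V) : P.S8.mul X Y = P.paraMul X Y := rfl

theorem gamma_apply (a b c : V) : (P.gamma a b).1 c = P.form a c • b + P.form b c • a := rfl

theorem S8_t_zero_apply (X Y Z : Cayley F V) :
    (P.S8.t X Y).1 0 Z = P.cayleyForm X Z • Y - P.cayleyForm Y Z • X := by
  rw [t_zero_apply, S8_q, S8_q]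

theorem S8_t_one_apply (X Y Z : Cayley F V) : (P.S8.t X Y).1 1 Z =
    ((2⁻¹ : F) * P.cayleyForm X Y) • Z - P.paraMul (P.paraMul Y Z) X := by
  rw [t_one_apply, S8_q]; rfl

theorem S8_t_two_apply (X Y Z : Cayley F V) : (P.S8.t X Y).1 2 Z =
    ((2⁻¹ : F) * P.cayleyForm X Y) • Z - P.paraMul X (P.paraMul Z Y) := by
  rw [t_two_apply, S8_q]; rfl

/-- A criterion for `d = ½ spTriple s` in terms of the three components of `d`. -/
theorem spTriple_eq_of {d : P.S8.tri} {s : Fin 4 → P.sp}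
    (h0 : d.1 0 = (2⁻¹ : F) • P.rhoSp s)
    (h1 : d.1 1 = (2⁻¹ : F) • P.rhoSp ![s 1, s 2, s 0, s 3])
    (h2 : d.1 2 = (2⁻¹ : F) • P.rhoSp ![s 2, s 0, s 1, s 3]) :
    d = (2⁻¹ : F) • P.spTriple s := by
  refine Subtype.ext <| funext fun k => ?_
  change d.1 k = (2⁻¹ : F) • P.rhoSp fun j => s (cyc k j)
  fin_cases k
  · exact h0.trans (by rw [← (comp_cyc s).1]; rfl)
  · exact h1.trans (by rw [← (comp_cyc s).2.1]; rfl)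
  · exact h2.trans (by rw [← (comp_cyc s).2.2]; rfl)

theorem t_half_zero_zero (a b c d : V) :
    P.S8.t (half 0 a b) (half 0 c d) = (2⁻¹ : F) •
      P.spTriple ![P.form b d • P.gamma a c, P.form a c • P.gamma b d, 0, 0] := by
  obtain ⟨e, f, α, β, -, hform, -⟩ := P.exists_coords
  have h2 : (2 : F) ≠ 0 := NeZero.ne 2
  have h01 : (0 : Fin 2) ≠ 1 := by decide
  refine P.spTriple_eq_of ?_ ?_ ?_ <;>
  refine cayley_hom_ext fun i u v => P.cayleyForm_ext fun l x y => ?_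
  · rw [S8_t_zero_apply]
    fin_cases i <;> fin_cases l <;>
    simp [rhoSp_half_zero, rhoSp_half_one, cayleyForm_half_self, gamma_apply,
      P.cayleyForm_half_of_ne h01, P.cayleyForm_half_of_ne h01.symm]
    simp only [hform]
    field_simp
    ring
  · rw [S8_t_one_apply]
    fin_cases i <;> fin_cases l <;>
    simp [rhoSp_half_zero, rhoSp_half_one, cayleyForm_half_self, gamma_apply,
      paraMul_zero_zero, paraMul_zero_one, paraMul_one_zero, paraMul_one_one,
      P.cayleyForm_half_of_ne h01, P.cayleyForm_half_of_ne h01.symm]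
    all_goals
      simp only [hform]
      field_simp
      ring
  · rw [S8_t_two_apply]
    fin_cases i <;> fin_cases l <;>
    simp [rhoSp_half_zero, rhoSp_half_one, cayleyForm_half_self, gamma_apply,
      paraMul_zero_zero, paraMul_zero_one, paraMul_one_zero, paraMul_one_one,
      P.cayleyForm_half_of_ne h01, P.cayleyForm_half_of_ne h01.symm]
    all_goals
      simp only [hform]
      field_simp
      ring

theorem t_half_one_one (a b c d : V) :
    P.S8.t (half 1 a b) (half 1 c d) = (2⁻¹ : F) •
      P.spTriple ![0, 0, P.form b d • P.gamma a c, P.form a c • P.gamma b d] := by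
  obtain ⟨e, f, α, β, -, hform, -⟩ := P.exists_coords
  have h2 : (2 : F) ≠ 0 := NeZero.ne 2
  have h01 : (0 : Fin 2) ≠ 1 := by decide
  refine P.spTriple_eq_of ?_ ?_ ?_ <;>
  refine cayley_hom_ext fun i u v => P.cayleyForm_ext fun l x y => ?_
  · rw [S8_t_zero_apply]
    fin_cases i <;> fin_cases l <;>
    simp [rhoSp_half_zero, rhoSp_half_one, cayleyForm_half_self, gamma_apply,
      P.cayleyForm_half_of_ne h01, P.cayleyForm_half_of_ne h01.symm]
    simp only [hform]
    field_simp
    ring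
  · rw [S8_t_one_apply]
    fin_cases i <;> fin_cases l <;>
    simp [rhoSp_half_zero, rhoSp_half_one, cayleyForm_half_self, gamma_apply,
      paraMul_zero_zero, paraMul_zero_one, paraMul_one_zero, paraMul_one_one,
      P.cayleyForm_half_of_ne h01, P.cayleyForm_half_of_ne h01.symm]
    all_goals
      simp only [hform]
      field_simp
      ring
  · rw [S8_t_two_apply]
    fin_cases i <;> fin_cases l <;>
    simp [rhoSp_half_zero, rhoSp_half_one, cayleyForm_half_self, gamma_apply,
      paraMul_zero_zero, paraMul_zero_one, paraMul_one_zero, paraMul_one_one,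
      P.cayleyForm_half_of_ne h01, P.cayleyForm_half_of_ne h01.symm]
    all_goals
      simp only [hform]
      field_simp
      ring

theorem t_half_zero_one (a b c d : V) :
    P.S8.t (half 0 a b) (half 1 c d) = -P.tensorTriple ![a, b, c, d] := by
  obtain ⟨e, f, α, β, -, hform, -⟩ := P.exists_coords
  have h01 : (0 : Fin 2) ≠ 1 := by decide
  have key : ∀ {x y : P.S8.tri}, x.1 0 = y.1 0 → x.1 1 = y.1 1 → x.1 2 = y.1 2 → x = y :=
    fun h0 h1 h2 => Subtype.ext <| funext fun k => by
      fin_cases k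
      exacts [h0, h1, h2]
  refine key ?_ ?_ ?_ <;>
  refine cayley_hom_ext fun i u v => P.cayleyForm_ext fun l x y => ?_
  · change _ = P.cayleyForm (-P.rhoTensor ![a, b, c, d] _) _
    rw [S8_t_zero_apply]
    fin_cases i <;> fin_cases l <;>
    simp [rhoTensor_half_zero, rhoTensor_half_one, cayleyForm_half_self,
      P.cayleyForm_half_of_ne h01, P.cayleyForm_half_of_ne h01.symm]
  · change _ = P.cayleyForm (-P.rhoTensor ![b, c, a, d] _) _
    rw [S8_t_one_apply]
    fin_cases i <;> fin_cases l <;>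
    simp [rhoTensor_half_zero, rhoTensor_half_one, cayleyForm_half_self,
      paraMul_zero_zero, paraMul_zero_one, paraMul_one_zero, paraMul_one_one,
      P.cayleyForm_half_of_ne h01, P.cayleyForm_half_of_ne h01.symm]
    all_goals
      simp only [hform]
      ring
  · change _ = P.cayleyForm (-P.rhoTensor ![c, a, b, d] _) _
    rw [S8_t_two_apply]
    fin_cases i <;> fin_cases l <;>
    simp [rhoTensor_half_zero, rhoTensor_half_one, cayleyForm_half_self,
      paraMul_zero_zero, paraMul_zero_one, paraMul_one_zero, paraMul_one_one,
      P.cayleyForm_half_of_ne h01, P.cayleyForm_half_of_ne h01.symm]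
    all_goals
      simp only [hform]
      ring

theorem t_half_zero_one' (a b c d : V) :
    P.S8.t (half 0 a b) (half 1 c d) = (-1 : F) • P.tensorTriple ![a, b, c, d] :=
  (P.t_half_zero_one a b c d).trans (neg_one_smul F (M := P.S8.tri) _).symm

theorem t_half_one_zero (a b c d : V) :
    P.S8.t (half 1 a b) (half 0 c d) = P.tensorTriple ![c, d, a, b] := by
  rw [t_swap, t_half_zero_one]
  exact neg_neg (G := P.S8.tri) _

end

/-! ### The decomposition `𝔱𝔯𝔦(S₈) = sp(V)⁴ ⊕ V^{⊗4}` -/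

section

theorem finite_dimensional (P : SymplecticPlane F V) : Module.Finite F V :=
  Module.finite_of_finrank_eq_succ P.finrank_eq_two

/-- A resolution of the identity of `S₈` in terms of its polar form. -/
theorem exists_dual_families : ∃ u w : Fin 8 → Cayley F V,
    ∀ X, X = ∑ i, P.cayleyForm X (u i) • w i := by
  obtain ⟨e, f, α, β, hv, hform, h1, h2, h3, h4⟩ := P.exists_coords
  refine ⟨![half 0 f f, half 0 f e, half 0 e f, half 0 e e,
    half 1 f f, half 1 f e, half 1 e f, half 1 e e],
    ![half 0 e e, -half 0 e f, -half 0 f e, half 0 f f,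
    half 1 e e, -half 1 e f, -half 1 f e, half 1 f f], fun X => ?_⟩
  have h01 : (0 : Fin 2) ≠ 1 := by decide
  have key : (LinearMap.id : Cayley F V →ₗ[F] Cayley F V) =
      ∑ i, (P.cayleyForm.flip (![half 0 f f, half 0 f e, half 0 e f, half 0 e e,
        half 1 f f, half 1 f e, half 1 e f, half 1 e e] i)).smulRight
        ((![half 0 e e, -half 0 e f, -half 0 f e, half 0 f f,
          half 1 e e, -half 1 e f, -half 1 f e, half 1 f f] : Fin 8 → Cayley F V) i) := by
    refine cayley_hom_ext fun i a b => P.cayleyForm_ext fun l x y => ?_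
    rw [Fin.sum_univ_eight]
    fin_cases i <;> fin_cases l <;>
    simp [cayleyForm_half_self,
      P.cayleyForm_half_of_ne h01, P.cayleyForm_half_of_ne h01.symm]
    all_goals
      simp only [hform, h1, h2, h3, h4]
      ring
  have h := congr($key X)
  rw [LinearMap.sum_apply] at h
  exact h

variable [NeZero (2 : F)]

/-- An element of `𝔬(S₈, q)` commuting with all `ρ(v₁ ⊗ v₂ ⊗ v₃ ⊗ v₄)` is zero: it is a scalar on the
first summand `V ⊗ V` because `ρ(v₁ ⊗ v₂ ⊗ v₃ ⊗ v₄)` has rank one there, and this scalar vanishes by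
skewness. -/
theorem eq_zero_of_commute_rhoTensor {E : Module.End F (Cayley F V)}
    (hE : ∀ X Y, P.cayleyForm (E X) Y + P.cayleyForm X (E Y) = 0)
    (hc : ∀ v X, E (P.rhoTensor v X) = P.rhoTensor v (E X)) : E = 0 := by
  obtain ⟨e, f, α, β, hv, hform, h1, h2, h3, h4⟩ := P.exists_coords
  have hef : P.form e f = 1 := by simp [hform, h1, h2, h3, h4]
  have hfe : P.form f e = -1 := by simp [hform, h1, h2, h3, h4]
  have hr (v : Fin 4 → V) (X : Cayley F V) : P.rhoTensor v X =
      P.quatForm (v 2 ⊗ₜ v 3) X.2 • half 0 (v 0) (v 1) -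
        P.quatForm (v 0 ⊗ₜ v 1) X.1 • half 1 (v 2) (v 3) := by
    simp [rhoTensor, half]
  obtain ⟨c, hc0⟩ : ∃ c : F, ∀ a b, E (half 0 a b) = c • half 0 a b := by
    refine ⟨P.quatForm (e ⊗ₜ e) (E (half 1 f f)).2, fun a b => ?_⟩
    have k1 := hc ![a, b, e, e] (half 1 f f)
    have k2 := hc ![a, b, f, f] (half 1 e e)
    rw [rhoTensor_half_one, hr] at k1 k2
    simp only [Matrix.cons_val, Matrix.cons_val_zero, Matrix.cons_val_one, hef, hfe, mul_one,
      one_smul, mul_neg, neg_neg] at k1 k2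
    have k3 : P.quatForm (a ⊗ₜ b) (E (half 1 f f)).1 = 0 := by
      have e1 := congrArg (fun X : Cayley F V => P.quatForm (f ⊗ₜ f) X.2) k1
      have e2 := congrArg (fun X : Cayley F V => P.quatForm (f ⊗ₜ f) X.2) k2
      rw [e2] at e1
      simpa [half, P.alt, hfe] using e1
    rw [k1, k3, zero_smul, sub_zero]
  have hc1 : c = 0 := by
    have k := hE (half 0 e e) (half 0 f f)
    rw [hc0, hc0, map_smul, map_smul, LinearMap.smul_apply, cayleyForm_half_self, hef] at k
    have h2 : (2 : F) ≠ 0 := NeZero.ne 2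
    have k' : (2 : F) * c = 0 := by
      simp only [smul_eq_mul] at k
      linear_combination k
    exact (mul_eq_zero.1 k').resolve_left h2
  refine cayley_hom_ext fun i a b => ?_
  rw [LinearMap.zero_apply]
  fin_cases i
  · exact (hc0 a b).trans (by rw [hc1, zero_smul])
  · have k := hc ![e, e, a, b] (half 0 f f)
    rw [hc0, hc1, zero_smul, map_zero, rhoTensor_half_zero] at k
    simpa [hef] using k

/-- The span of the elements `t_{x,y}` is the whole of the triality Lie algebra of `S₈`: the first
components of these elements span `𝔬(S₈, q)`, and an element of the triality Lie algebra whose first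
component vanishes commutes with all `t_{x,y}`, so that it is zero. -/
theorem tri_le_of_t_mem {N : Submodule F P.S8.tri} (hN : ∀ X Y, P.S8.t X Y ∈ N) : N = ⊤ := by
  rw [eq_top_iff]
  rintro d -
  have hskew (d : P.S8.tri) (k : Fin 3) (X Y : Cayley F V) :
      P.cayleyForm (d.1 k X) Y + P.cayleyForm X (d.1 k Y) = 0 := by
    rw [← S8_q, ← S8_q]
    exact P.S8.tri_q d.2 k X Y
  have hker (x : P.S8.tri) (hx : x.1 0 = 0) : x = 0 := by
    refine Subtype.ext <| funext fun k => ?_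
    refine P.eq_zero_of_commute_rhoTensor (hskew x k) fun v X => ?_
    obtain ⟨v, rfl⟩ : ∃ v', v = fun j => v' (cyc k j) :=
      ⟨fun j => v (cyc (0 - k) j), by
        funext j
        have : ∀ k j, cyc (0 - k) (cyc k j) = j := by decide
        exact congrArg v (this k j).symm⟩
    have h := P.S8.commutator_tTriple x.2 (half 0 (v 0) (v 1)) (half 1 (v 2) (v 3)) k
    rw [hx, LinearMap.zero_apply, LinearMap.zero_apply, map_zero, map_zero, LinearMap.zero_apply,
      t_half_zero_one] at h
    have hv : ![v 0, v 1, v 2, v 3] = v := by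
      funext j; fin_cases j <;> rfl
    rw [hv] at h
    have h' : x.1 k * -(P.rhoTensor fun j => v (cyc k j)) -
      -(P.rhoTensor fun j => v (cyc k j)) * x.1 k = 0 + 0 := h
    have h2 := congrArg (fun T : Module.End F (Cayley F V) => T X) h'
    simp only [LinearMap.sub_apply, Module.End.mul_apply, LinearMap.neg_apply, map_neg, add_zero,
      LinearMap.zero_apply] at h2
    linear_combination (norm := module) -h2
  obtain ⟨u, w, huw⟩ := P.exists_dual_families
  have huw' (X : Cayley F V) : X = ∑ i, P.cayleyForm X (w i) • u i := by
    refine P.cayleyForm_ext fun i a b => ?_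
    conv_lhs => rw [huw (half i a b)]
    simp only [map_sum, map_smul, LinearMap.sum_apply, LinearMap.smul_apply, smul_eq_mul]
    refine Finset.sum_congr rfl fun j _ => ?_
    rw [P.cayleyForm_comm (half i a b), mul_comm]
  have h2 : (2 : F) ≠ 0 := NeZero.ne 2
  -- a skew endomorphism `d₀` is `-½ ∑ σ_{d₀ u_i, w_i}` for dual families `u`, `w`
  have hd : d + (2⁻¹ : F) • ∑ i, P.S8.t (d.1 0 (u i)) (w i) = 0 := by
    refine hker _ ?_
    refine LinearMap.ext fun X => ?_
    change d.1 0 X + (2⁻¹ : F) • ((∑ i, P.S8.t (d.1 0 (u i)) (w i)).1 0) X = 0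
    rw [Submodule.coe_sum, Finset.sum_apply, LinearMap.sum_apply]
    simp only [S8_t_zero_apply, Finset.sum_sub_distrib]
    have e1 : ∑ i, P.cayleyForm (d.1 0 (u i)) X • w i = -d.1 0 X := by
      conv_rhs => rw [huw (d.1 0 X)]
      rw [← Finset.sum_neg_distrib]
      refine Finset.sum_congr rfl fun i _ => ?_
      rw [← neg_smul, P.cayleyForm_comm (d.1 0 X)]
      congr 1
      linear_combination hskew d 0 (u i) X
    have e2 : ∑ i, P.cayleyForm (w i) X • d.1 0 (u i) = d.1 0 X := by
      conv_rhs => rw [huw' X]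
      rw [map_sum]
      refine Finset.sum_congr rfl fun i _ => ?_
      rw [map_smul, P.cayleyForm_comm X]
    rw [e1, e2, ← neg_add', smul_neg, ← two_smul F (d.1 0 X), smul_smul, inv_mul_cancel₀ h2,
      one_smul, add_neg_cancel]
  have hs : (2⁻¹ : F) • ∑ i, P.S8.t (d.1 0 (u i)) (w i) ∈ N :=
    N.smul_mem _ (N.sum_mem fun i _ => hN _ _)
  have hm : d + (2⁻¹ : F) • ∑ i, P.S8.t (d.1 0 (u i)) (w i) ∈ N := by
    rw [hd]; exact N.zero_mem
  exact (Submodule.add_mem_iff_left (R := F) (M := P.S8.tri) N hs).1 hm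

/-- The map `sp(V)⁴ ⊕ V^{⊗4} → 𝔱𝔯𝔦(S₈)`. -/
noncomputable def triMap : (Fin 4 → P.sp) × (⨂[F] _ : Fin 4, V) →ₗ[F] P.S8.tri :=
  P.spTriple.coprod (PiTensorProduct.lift P.tensorTriple)

theorem tensorTriple_mem_range (v : Fin 4 → V) : P.tensorTriple v ∈ LinearMap.range P.triMap :=
  ⟨(0, PiTensorProduct.tprod F v), by simp [triMap]⟩

theorem spTriple_mem_range (s : Fin 4 → P.sp) : P.spTriple s ∈ LinearMap.range P.triMap :=
  ⟨(s, 0), by simp [triMap]⟩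

/-- The image of `triMap` contains all `t_{x,y}`, by the formulas for them on generators. -/
theorem triMap_surjective : Function.Surjective P.triMap := by
  rw [← LinearMap.range_eq_top]
  refine P.tri_le_of_t_mem fun X Y => ?_
  set N := LinearMap.range P.triMap
  have key (i j : Fin 2) (a b c d : V) : P.S8.t (half i a b) (half j c d) ∈ N := by
    fin_cases i <;> fin_cases j
    · exact (P.t_half_zero_zero a b c d) ▸ N.smul_mem _ (P.spTriple_mem_range _)
    · exact (P.t_half_zero_one' a b c d) ▸ N.smul_mem _ (P.tensorTriple_mem_range _)
    · exact (P.t_half_one_zero a b c d) ▸ P.tensorTriple_mem_range _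
    · exact (P.t_half_one_one a b c d) ▸ N.smul_mem _ (P.spTriple_mem_range _)
  have hY (i : Fin 2) (a b : V) : P.S8.t (half i a b) Y ∈ N := by
    induction Y using cayley_induction with
    | h0 => rw [map_zero]; exact N.zero_mem
    | hadd Y Y' h h' => rw [map_add]; exact N.add_mem h h'
    | h1 c d => exact key i 0 a b c d
    | h2 c d => exact key i 1 a b c d
  induction X using cayley_induction with
  | h0 => rw [map_zero]; exact N.zero_mem
  | hadd X X' h h' => rw [map_add]; exact N.add_mem h h'
  | h1 a b => exact hY 0 a b
  | h2 a b => exact hY 1 a b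

/-- The linear form `v₁ ⊗ ⋯ ⊗ v_n ↦ ∏ ⟨v_i | w_i⟩`. -/
noncomputable def formProd {ι : Type*} [Fintype ι] (w : ι → V) : (⨂[F] _ : ι, V) →ₗ[F] F :=
  PiTensorProduct.lift ((MultilinearMap.mkPiAlgebra F ι F).compLinearMap fun i =>
    P.form.flip (w i))

theorem formProd_tprod {ι : Type*} [Fintype ι] (w v : ι → V) :
    P.formProd w (PiTensorProduct.tprod F v) = ∏ i, P.form (v i) (w i) := by
  simp [formProd]

/-- The coordinates in a basis of `V^{⊗n}` are among the linear forms `formProd`. -/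
theorem eq_zero_of_formProd {ι : Type*} [Fintype ι] {x : ⨂[F] _ : ι, V}
    (h : ∀ w, P.formProd w x = 0) : x = 0 := by
  obtain ⟨e, f, α, β, hv, hform, h1, h2, h3, h4⟩ := P.exists_coords
  have hα (v : V) : P.form v f = α v := by simp [hform, h3, h4]
  have hβ (v : V) : P.form v (-e) = β v := by simp [hform, h1, h2]
  have hli : LinearIndependent F ![e, f] := by
    rw [LinearIndependent.pair_iff]
    intro s t hst
    have k1 := congrArg α hst
    have k2 := congrArg β hst
    simp only [map_add, map_smul, smul_eq_mul, h1, h2, h3, h4, map_zero] at k1 k2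
    exact ⟨by linear_combination k1, by linear_combination k2⟩
  let b : Module.Basis (Fin 2) F V := basisOfLinearIndependentOfCardEqFinrank hli
    (by rw [P.finrank_eq_two]; simp)
  have hb0 : b 0 = e := by simp [b]
  have hb1 : b 1 = f := by simp [b]
  have hrepr (v : V) (i : Fin 2) : b.repr v i = P.form v (![f, -e] i) := by
    have hv' : v = α v • b 0 + β v • b 1 := by rw [hb0, hb1]; exact hv v
    have : b.repr v = α v • b.repr (b 0) + β v • b.repr (b 1) := by
      conv_lhs => rw [hv']
      simp
    rw [this, b.repr_self, b.repr_self]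
    fin_cases i
    · simpa using (hα v).symm
    · simpa using (hβ v).symm
  refine (Module.Basis.ext_elem_iff (Basis.piTensorProduct fun _ : ι => b)).2 fun p => ?_
  rw [map_zero, Finsupp.zero_apply, ← h fun i => ![f, -e] (p i)]
  have key : (Finsupp.lapply p) ∘ₗ (Basis.piTensorProduct fun _ : ι => b).repr.toLinearMap =
      P.formProd fun i => (![f, -e] : Fin 2 → V) (p i) := by
    refine PiTensorProduct.ext (MultilinearMap.ext fun v => ?_)
    change (Basis.piTensorProduct fun _ : ι => b).repr (PiTensorProduct.tprod F v) p =
      P.formProd _ (PiTensorProduct.tprod F v)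
    rw [Basis.piTensorProduct_repr_tprod_apply, formProd_tprod]
    exact Finset.prod_congr rfl fun i _ => hrepr _ _
  exact congr($key x)

/-- The first diagonal blocks of `ρ(s)` determine `s`. -/
theorem sp_pair_eq_zero {s s' : P.sp}
    (h : ∀ a b c d, P.form (s.1 a) c * P.form b d + P.form a c * P.form (s'.1 b) d = 0) :
    s = 0 ∧ s' = 0 := by
  obtain ⟨e, f, α, β, hv, hform, h1, h2, h3, h4⟩ := P.exists_coords
  have hef : P.form e f = 1 := by simp [hform, h1, h2, h3, h4]
  have hfe : P.form f e = -1 := by simp [hform, h1, h2, h3, h4]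
  have hz : ∀ {s : P.sp}, (∀ a c, P.form (s.1 a) c = 0) → s = 0 := fun {s} hs => by
    refine Subtype.ext (LinearMap.ext fun a => ?_)
    rw [hv (s.1 a)]
    have k1 := hs a f
    have k2 := hs a e
    simp only [hform, h1, h2, h3, h4] at k1 k2
    have k1' : α (s.1 a) = 0 := by linear_combination k1
    have k2' : β (s.1 a) = 0 := by linear_combination -k2
    rw [k1', k2']
    simp
  have hs : s = 0 := hz fun a c => by
    have k1 := h a e c f
    have k2 := h a f c e
    have k3 : P.form (s'.1 f) e = P.form (s'.1 e) f := by
      rw [form_sp, P.neg_form]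
    rw [hef] at k1
    rw [hfe, k3] at k2
    have k : (2 : F) * P.form (s.1 a) c = 0 := by linear_combination k1 - k2
    exact (mul_eq_zero.1 k).resolve_left (NeZero.ne 2)
  refine ⟨hs, hz fun b d => ?_⟩
  have k := h e b f d
  rw [hs, hef] at k
  simpa using k

/-- The image of `sp(V)⁴` is block diagonal and that of `V^{⊗4}` is block off-diagonal with respect to
`S₈ = V ⊗ V ⊕ V ⊗ V`, and both are determined by the matrix entries of the first component. -/
theorem triMap_injective : Function.Injective P.triMap := by
  refine (injective_iff_map_eq_zero (G := (Fin 4 → P.sp) × (⨂[F] _ : Fin 4, V))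
    (H := P.S8.tri) P.triMap).2 ?_
  rintro ⟨s, x⟩ hx
  have h01 : (0 : Fin 2) ≠ 1 := by decide
  -- the matrix entries of the first component of an element of the triality algebra
  let ent (i j : Fin 2) (a b c d : V) : P.S8.tri →ₗ[F] F :=
    P.cayleyForm.flip (half j c d) ∘ₗ LinearMap.applyₗ (half i a b) ∘ₗ
      LinearMap.proj (φ := fun _ : Fin 3 => Module.End F (Cayley F V)) 0 ∘ₗ P.S8.tri.subtype
  have hent (i j a b c d) (y : P.S8.tri) :
      ent i j a b c d y = P.cayleyForm (y.1 0 (half i a b)) (half j c d) := rfl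
  have hT (i j a b c d) (v : Fin 4 → V) : ent i j a b c d (P.tensorTriple v) =
      P.cayleyForm (P.rhoTensor v (half i a b)) (half j c d) := by
    rw [hent, tensorTriple_apply, (comp_cyc v).1]
  have hS (i j a b c d) : ent i j a b c d (P.spTriple s) =
      P.cayleyForm (P.rhoSp s (half i a b)) (half j c d) := by
    rw [hent, spTriple_apply, (comp_cyc s).1]
  have hdiag (i a b c d) : ent i i a b c d (PiTensorProduct.lift P.tensorTriple x) = 0 := by
    have key : ent i i a b c d ∘ₗ PiTensorProduct.lift P.tensorTriple = 0 := by
      refine PiTensorProduct.ext (MultilinearMap.ext fun v => ?_)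
      change ent i i a b c d (PiTensorProduct.lift P.tensorTriple (PiTensorProduct.tprod F v)) = 0
      rw [PiTensorProduct.lift.tprod, hT]
      fin_cases i <;> simp [rhoTensor_half_zero, rhoTensor_half_one,
        P.cayleyForm_half_of_ne h01, P.cayleyForm_half_of_ne h01.symm]
    exact congr($key x)
  have hsum : P.spTriple s + PiTensorProduct.lift P.tensorTriple x = 0 := hx
  have hs (i a b c d) : P.cayleyForm (P.rhoSp s (half i a b)) (half i c d) = 0 := by
    have k := congrArg (ent i i a b c d) hsum
    rwa [map_add, hdiag, hS, map_zero, add_zero] at k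
  have h0 := P.sp_pair_eq_zero (s := s 0) (s' := s 1) fun a b c d => by
    have k := hs 0 a b c d
    rwa [rhoSp_half_zero, map_add, LinearMap.add_apply, cayleyForm_half_self,
      cayleyForm_half_self] at k
  have h1 := P.sp_pair_eq_zero (s := s 2) (s' := s 3) fun a b c d => by
    have k := hs 1 a b c d
    rwa [rhoSp_half_one, map_add, LinearMap.add_apply, cayleyForm_half_self,
      cayleyForm_half_self] at k
  have hs0 : s = 0 := by
    funext j
    fin_cases j
    exacts [h0.1, h0.2, h1.1, h1.2]
  rw [hs0, map_zero, zero_add] at hsum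
  refine Prod.ext hs0 (P.eq_zero_of_formProd fun w => ?_)
  have key : ent 1 0 (w 2) (w 3) (w 0) (w 1) ∘ₗ PiTensorProduct.lift P.tensorTriple =
      P.formProd w := by
    refine PiTensorProduct.ext (MultilinearMap.ext fun v => ?_)
    change ent _ _ _ _ _ _ (PiTensorProduct.lift P.tensorTriple (PiTensorProduct.tprod F v)) =
      P.formProd w (PiTensorProduct.tprod F v)
    rw [PiTensorProduct.lift.tprod, hT, formProd_tprod, rhoTensor_half_one, map_smul,
      LinearMap.smul_apply, cayleyForm_half_self, Fin.prod_univ_four, smul_eq_mul]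
    ring
  have k := congrArg (ent 1 0 (w 2) (w 3) (w 0) (w 1)) hsum
  rw [map_zero] at k
  rw [← key]
  exact k

end

/-! ### Labels and the map `Ψ` -/

section

/-- The labels of the nonempty elements of `𝒮_{𝔢₈}`: `inl 0` and `inl 1` stand for `{1, 2, 3, 4}` and
`{5, 6, 7, 8}`, and `inr (k, h, h')` stands for `mixedSet k h h'`. -/
abbrev Label : Type := Fin 2 ⊕ (Fin 3 × Fin 2 × Fin 2)

/-- The elements of the set with a given label, in the order in which they occur in `Ψ`. -/
def labelIdx : Label → Fin 4 → Fin 8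
  | Sum.inl a => if a = 0 then left8 else right8
  | Sum.inr (k, h, h') => ![left8 (pairIdx k h 0), left8 (pairIdx k h 1),
      right8 (pairIdx k h' 0), right8 (pairIdx k h' 1)]

/-- The element of `𝒮_{𝔢₈}` with a given label. -/
def labelSet (c : Label) : Finset (Fin 8) := Finset.univ.image (labelIdx c)

theorem labelIdx_injective : ∀ c, Function.Injective (labelIdx c) := by decide +kernel

theorem labelSet_injective : Function.Injective labelSet := by decide +kernel

theorem labelSet_ne_empty : ∀ c, labelSet c ≠ ∅ := by decide +kernel

theorem labelSet_mem_calS : ∀ c, labelSet c ∈ calS := by decide +kernel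

theorem eq_empty_or_exists_label : ∀ σ ∈ calS, σ = ∅ ∨ ∃ c, labelSet c = σ := by decide +kernel

theorem labelSet_left : labelSet (Sum.inl 0) = {0, 1, 2, 3} := by decide +kernel

theorem labelSet_right : labelSet (Sum.inl 1) = {4, 5, 6, 7} := by decide +kernel

theorem labelSet_mixed : ∀ k h h', labelSet (Sum.inr (k, h, h')) = mixedSet k h h' := by
  decide +kernel

theorem left8_injective : Function.Injective left8 := by decide

theorem right8_injective : Function.Injective right8 := by decide

section

variable {F V : Type*} [Field F] [AddCommGroup V] [Module F V]

theorem half_add_left (h : Fin 2) (a a' b : V) :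
    half (F := F) h (a + a') b = half h a b + half h a' b := by
  fin_cases h <;> simp [half, TensorProduct.add_tmul]

theorem half_add_right (h : Fin 2) (a b b' : V) :
    half (F := F) h a (b + b') = half h a b + half h a b' := by
  fin_cases h <;> simp [half, TensorProduct.tmul_add]

theorem half_smul_left (h : Fin 2) (c : F) (a b : V) :
    half (F := F) h (c • a) b = c • half h a b := by
  fin_cases h <;> simp [half, TensorProduct.smul_tmul']

theorem half_smul_right (h : Fin 2) (c : F) (a b : V) :
    half (F := F) h a (c • b) = c • half h a b := by
  fin_cases h <;> simp [half]

/-- The multilinear map `v ↦ half h v₁ v₂ ⊗ half h' v₃ v₄`. -/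
def halfTensor (h h' : Fin 2) :
    MultilinearMap F (fun _ : Fin 4 => V) (Cayley F V ⊗[F] Cayley F V) where
  toFun v := half h (v 0) (v 1) ⊗ₜ half h' (v 2) (v 3)
  map_update_add' {inst} v i x y := by
    obtain rfl : inst = instDecidableEqFin 4 := Subsingleton.elim _ _
    fin_cases i <;> simp [Function.update, half_add_left, half_add_right, TensorProduct.add_tmul,
      TensorProduct.tmul_add]
  map_update_smul' {inst} v i c x := by
    obtain rfl : inst = instDecidableEqFin 4 := Subsingleton.elim _ _
    fin_cases i <;> simp [Function.update, half_smul_left, half_smul_right,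
      TensorProduct.smul_tmul']

end

variable [NeZero (2 : F)]

/-- The multilinear map `V⁴ → 𝔢₈` whose linearization is the restriction of `Ψ` to `V(σ)`, for the
set `σ` with a given label. -/
def labelMap : Label → MultilinearMap F (fun _ : Fin 4 => V) P.E8
  | Sum.inl a => (Magic.ofTri ∘ₗ (if a = 0 then LinearMap.inl F P.S8.tri P.S8.tri
      else LinearMap.inr F P.S8.tri P.S8.tri)).compMultilinearMap P.tensorTriple
  | Sum.inr (k, h, h') => (Magic.iota k).compMultilinearMap (halfTensor h h')

theorem labelMap_left (v : Fin 4 → V) :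
    P.labelMap (Sum.inl 0) v = Magic.ofTri (P.tensorTriple v, 0) := rfl

theorem labelMap_right (v : Fin 4 → V) :
    P.labelMap (Sum.inl 1) v = Magic.ofTri (0, P.tensorTriple v) := rfl

theorem labelMap_mixed (k : Fin 3) (h h' : Fin 2) (v : Fin 4 → V) :
    P.labelMap (Sum.inr (k, h, h')) v =
      Magic.iota k (half h (v 0) (v 1) ⊗ₜ half h' (v 2) (v 3)) := rfl

/-- The restriction of `Ψ` to `V(∅) = sp(V)⁸`. -/
def spE8 : (Fin 8 → P.sp) →ₗ[F] P.E8 :=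
  Magic.ofTri ∘ₗ (P.spTriple ∘ₗ LinearMap.funLeft F P.sp left8).prod
    (P.spTriple ∘ₗ LinearMap.funLeft F P.sp right8)

theorem spE8_apply (s : Fin 8 → P.sp) : P.spE8 s =
    Magic.ofTri (P.spTriple fun j => s (left8 j), P.spTriple fun j => s (right8 j)) := rfl

/-- The image under `Ψ` of the pure tensor in `V(σ)` with factors `v_i`, for the set `σ` with a
given label. -/
def labelElt (c : Label) (v : Fin 8 → V) : P.E8 := P.labelMap c fun i => v (labelIdx c i)

/-- The bijection from `{1, 2, 3, 4}` to the set with a given label. -/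
noncomputable def labelEquiv (c : Label) {σ : Finset (Fin 8)} (h : labelSet c = σ) : Fin 4 ≃ σ :=
  Equiv.ofBijective (fun i => ⟨labelIdx c i, h ▸ Finset.mem_image_of_mem _ (Finset.mem_univ i)⟩)
    ⟨fun i j hij => labelIdx_injective c (congrArg Subtype.val hij), fun ⟨j, hj⟩ => by
      rw [← h] at hj
      obtain ⟨i, -, hi⟩ := Finset.mem_image.1 hj
      exact ⟨i, Subtype.ext hi⟩⟩

open Classical in
/-- The restriction of `Ψ` to `V(σ)`. -/
noncomputable def psi (σ : Finset (Fin 8)) : P.VMod σ →ₗ[F] P.E8 :=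
  if h : σ = ∅ then P.spE8 ∘ₗ VMod.atEmpty P h
  else if hc : ∃ c, labelSet c = σ then
    PiTensorProduct.lift ((P.labelMap hc.choose).domDomCongr (labelEquiv _ hc.choose_spec)) ∘ₗ
      VMod.atTensor P h
  else 0

theorem psi_of_eq_empty {σ : Finset (Fin 8)} (h : σ = ∅) (x : P.VMod σ) :
    P.psi σ x = P.spE8 (x.1 ⟨h⟩) := by
  rw [psi, dif_pos h]
  rfl

/-- `psi` does not depend on the label chosen in its definition, since labels are determined by sets. -/
theorem psi_pure {σ : Finset (Fin 8)} {c : Label} (h : labelSet c = σ) (v : Fin 8 → V) :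
    P.psi σ (VMod.pure P σ v) = P.labelElt c v := by
  have hσ : σ ≠ ∅ := h ▸ labelSet_ne_empty c
  have hc : ∃ c, labelSet c = σ := ⟨c, h⟩
  have key : ∀ c' (h' : labelSet c' = σ), PiTensorProduct.lift
      ((P.labelMap c').domDomCongr (labelEquiv c' h'))
        (PiTensorProduct.tprod F fun i : σ => v i) = P.labelElt c' v := fun c' h' => by
    rw [PiTensorProduct.lift.tprod]
    rfl
  rw [psi, dif_neg hσ, dif_pos hc]
  refine (key hc.choose hc.choose_spec).trans ?_
  rw [labelSet_injective (hc.choose_spec.trans h.symm)]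

/-- The map `Ψ : ⨁_{σ ∈ 𝒮} V(σ) → 𝔢₈`. -/
noncomputable def psiSum : P.E8Sum →ₗ[F] P.E8 :=
  DirectSum.toModule F {σ // σ ∈ calS} P.E8 fun σ => P.psi σ.1

theorem psiSum_inc (σ : {σ // σ ∈ calS}) (x : P.VMod σ.1) : P.psiSum (P.inc σ x) = P.psi σ.1 x := by
  rw [psiSum, inc, DirectSum.toModule_lof]

theorem labelMap_mem_range (c : Label) (u : Fin 4 → V) :
    P.labelMap c u ∈ LinearMap.range P.psiSum := by
  refine ⟨P.inc ⟨labelSet c, labelSet_mem_calS c⟩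
    (VMod.pure P _ (Function.extend (labelIdx c) u 0)), ?_⟩
  rw [psiSum_inc, P.psi_pure rfl, labelElt]
  congr 1
  funext i
  exact (labelIdx_injective c).extend_apply u 0 i

theorem spE8_mem_range (s : Fin 8 → P.sp) : P.spE8 s ∈ LinearMap.range P.psiSum := by
  refine ⟨P.inc ⟨∅, empty_mem_calS⟩ (VMod.ofSp P s), ?_⟩
  rw [psiSum_inc, P.psi_of_eq_empty rfl]
  rfl

theorem ofTri_left_mem_range (d : P.S8.tri) :
    (Magic.ofTri (d, 0) : P.E8) ∈ LinearMap.range P.psiSum := by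
  obtain ⟨⟨s, x⟩, rfl⟩ := P.triMap_surjective d
  have hd : (Magic.ofTri (P.triMap (s, x), 0) : P.E8) =
      Magic.ofTri (P.spTriple s, 0) +
        Magic.ofTri (PiTensorProduct.lift P.tensorTriple x, 0) := by
    rw [← map_add, Prod.mk_add_mk, add_zero]
    rfl
  rw [hd]
  clear hd
  refine Submodule.add_mem _ ?_ ?_
  · have h := P.spE8_mem_range (Function.extend left8 s 0)
    have e1 : (fun j => Function.extend left8 s 0 (left8 j)) = s :=
      funext fun j => left8_injective.extend_apply s 0 j
    have e2 : (fun j => Function.extend left8 s 0 (right8 j)) = 0 :=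
      funext fun j => Function.extend_apply' _ _ _ (by revert j; decide)
    rwa [spE8_apply, e1, e2, map_zero] at h
  · induction x using PiTensorProduct.induction_on with
    | smul_tprod r v =>
      rw [map_smul, PiTensorProduct.lift.tprod]
      have := (LinearMap.range P.psiSum).smul_mem r (P.labelMap_mem_range (Sum.inl 0) v)
      rw [labelMap_left, ← map_smul, Prod.smul_mk, smul_zero] at this
      exact this
    | add x y hx hy =>
      rw [map_add]
      have := (LinearMap.range P.psiSum).add_mem hx hy
      rw [← map_add, Prod.mk_add_mk, add_zero] at this
      exact this

theorem ofTri_right_mem_range (d : P.S8.tri) :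
    (Magic.ofTri (0, d) : P.E8) ∈ LinearMap.range P.psiSum := by
  obtain ⟨⟨s, x⟩, rfl⟩ := P.triMap_surjective d
  have hd : (Magic.ofTri (0, P.triMap (s, x)) : P.E8) =
      Magic.ofTri (0, P.spTriple s) +
        Magic.ofTri (0, PiTensorProduct.lift P.tensorTriple x) := by
    rw [← map_add, Prod.mk_add_mk, add_zero]
    rfl
  rw [hd]
  clear hd
  refine Submodule.add_mem _ ?_ ?_
  · have h := P.spE8_mem_range (Function.extend right8 s 0)
    have e1 : (fun j => Function.extend right8 s 0 (right8 j)) = s :=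
      funext fun j => right8_injective.extend_apply s 0 j
    have e2 : (fun j => Function.extend right8 s 0 (left8 j)) = 0 :=
      funext fun j => Function.extend_apply' _ _ _ (by revert j; decide)
    rwa [spE8_apply, e1, e2, map_zero] at h
  · induction x using PiTensorProduct.induction_on with
    | smul_tprod r v =>
      rw [map_smul, PiTensorProduct.lift.tprod]
      have := (LinearMap.range P.psiSum).smul_mem r (P.labelMap_mem_range (Sum.inl 1) v)
      rw [labelMap_right, ← map_smul, Prod.smul_mk, smul_zero] at this
      exact this
    | add x y hx hy =>
      rw [map_add]
      have := (LinearMap.range P.psiSum).add_mem hx hy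
      rw [← map_add, Prod.mk_add_mk, add_zero] at this
      exact this

theorem iota_mem_range (k : Fin 3) (u : Cayley F V ⊗[F] Cayley F V) :
    (Magic.iota k u : P.E8) ∈ LinearMap.range P.psiSum := by
  induction u using TensorProduct.induction_on with
  | zero => rw [map_zero]; exact Submodule.zero_mem _
  | add u u' h h' => rw [map_add]; exact Submodule.add_mem _ h h'
  | tmul X Y =>
    induction X using cayley_induction with
    | h0 => rw [TensorProduct.zero_tmul, map_zero]; exact Submodule.zero_mem _
    | hadd X X' h h' => rw [TensorProduct.add_tmul, map_add]; exact Submodule.add_mem _ h h'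
    | h1 a b =>
      induction Y using cayley_induction with
      | h0 => rw [TensorProduct.tmul_zero, map_zero]; exact Submodule.zero_mem _
      | hadd X X' h h' => rw [TensorProduct.tmul_add, map_add]; exact Submodule.add_mem _ h h'
      | h1 c d => exact P.labelMap_mem_range (Sum.inr (k, 0, 0)) ![a, b, c, d]
      | h2 c d => exact P.labelMap_mem_range (Sum.inr (k, 0, 1)) ![a, b, c, d]
    | h2 a b =>
      induction Y using cayley_induction with
      | h0 => rw [TensorProduct.tmul_zero, map_zero]; exact Submodule.zero_mem _
      | hadd X X' h h' => rw [TensorProduct.tmul_add, map_add]; exact Submodule.add_mem _ h h'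
      | h1 c d => exact P.labelMap_mem_range (Sum.inr (k, 1, 0)) ![a, b, c, d]
      | h2 c d => exact P.labelMap_mem_range (Sum.inr (k, 1, 1)) ![a, b, c, d]

theorem psiSum_surjective : Function.Surjective P.psiSum := by
  rw [← LinearMap.range_eq_top, Submodule.eq_top_iff']
  intro X
  induction X using Magic.generators_induction with
  | add X Y h h' => exact Submodule.add_mem _ h h'
  | tri d =>
    have hd : (Magic.ofTri d : P.E8) = Magic.ofTri (d.1, 0) + Magic.ofTri (0, d.2) := by
      rw [← map_add, Prod.mk_add_mk, add_zero, zero_add]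
    rw [hd]
    exact Submodule.add_mem _ (P.ofTri_left_mem_range _) (P.ofTri_right_mem_range _)
  | io k u => exact P.iota_mem_range k u

end

/-! ### Dimensions -/

section

theorem finrank_tensor (P : SymplecticPlane F V) (ι : Type*) [Fintype ι] :
    Module.finrank F (⨂[F] _ : ι, V) = 2 ^ Fintype.card ι := by
  classical
  have := P.finite_dimensional
  let b := Module.finBasis F V
  rw [Module.finrank_eq_card_basis (Basis.piTensorProduct fun _ : ι => b)]
  simp [P.finrank_eq_two]

variable [NeZero (2 : F)]

theorem finite_sp : Module.Finite F P.sp := by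
  have := P.finite_dimensional
  infer_instance

theorem finrank_tri :
    Module.finrank F P.S8.tri = 4 * Module.finrank F P.sp + 16 := by
  have := P.finite_dimensional
  have h := (LinearEquiv.ofBijective P.triMap ⟨P.triMap_injective, P.triMap_surjective⟩).finrank_eq
  have hf : Module.Finite F (⨂[F] _ : Fin 4, V) :=
    .of_basis (Basis.piTensorProduct fun _ : Fin 4 => Module.finBasis F V)
  rw [← h, Module.finrank_prod, Module.finrank_pi_fintype, P.finrank_tensor]
  simp

theorem finite_tri : Module.Finite F P.S8.tri := by
  have := P.finite_dimensional
  infer_instance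

theorem free_tri : Module.Free F P.S8.tri := Module.Free.of_divisionRing F P.S8.tri

theorem finite_E8 : Module.Finite F P.E8 := by
  have := P.finite_dimensional
  have := P.finite_tri
  have h : Module.Finite F (P.S8.tri × P.S8.tri) := Module.Finite.prod
  have h' : Module.Finite F (Fin 3 → Cayley F V ⊗[F] Cayley F V) := inferInstance
  exact Module.Finite.prod (M := P.S8.tri × P.S8.tri)
    (N := Fin 3 → Cayley F V ⊗[F] Cayley F V)

theorem finrank_E8 : Module.finrank F P.E8 = 8 * Module.finrank F P.sp + 224 := by
  have := P.finite_dimensional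
  have := P.finite_tri
  have := P.free_tri
  have h : Module.finrank F (Cayley F V) = 8 := by
    change Module.finrank F ((V ⊗[F] V) × (V ⊗[F] V)) = 8
    rw [Module.finrank_prod, Module.finrank_tensorProduct, P.finrank_eq_two]
  have h3 : Module.finrank F (Fin 3 → Cayley F V ⊗[F] Cayley F V) = 192 := by
    rw [Module.finrank_pi_fintype]
    simp only [Module.finrank_tensorProduct, h]
    rfl
  have h2 : Module.finrank F (P.S8.tri × P.S8.tri) = 8 * Module.finrank F P.sp + 32 := by
    rw [Module.finrank_prod, finrank_tri]
    ring
  have : Module.Finite F (P.S8.tri × P.S8.tri) := Module.Finite.prod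
  have : Module.Free F (P.S8.tri × P.S8.tri) := Module.Free.prod F _ _
  have key := Module.finrank_prod (R := F) (M := P.S8.tri × P.S8.tri)
    (M' := Fin 3 → Cayley F V ⊗[F] Cayley F V)
  rw [h2, h3] at key
  exact key

theorem finite_VMod {n : ℕ} (σ : Finset (Fin n)) : Module.Finite F (P.VMod σ) := by
  classical
  have := P.finite_dimensional
  have hf : Module.Finite F (⨂[F] _ : σ, V) :=
    .of_basis (Basis.piTensorProduct fun _ : σ => Module.finBasis F V)
  infer_instance

theorem card_eq_four_of_mem_calS : ∀ σ ∈ calS, σ ≠ ∅ → σ.card = 4 := by decide +kernel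

theorem finrank_E8Sum : Module.finrank F P.E8Sum = 8 * Module.finrank F P.sp + 224 := by
  have := P.finite_sp
  have := fun σ : {σ // σ ∈ calS} => P.finite_VMod σ.1
  have h0 : Module.finrank F (P.VMod (∅ : Finset (Fin 8))) = 8 * Module.finrank F P.sp := by
    rw [(VMod.emptyEquiv P).finrank_eq, Module.finrank_pi_fintype]
    simp
  have h1 : ∀ σ ∈ calS, σ ≠ ∅ → Module.finrank F (P.VMod σ) = 16 := fun σ hσ hσ' => by
    rw [(VMod.tensorEquiv P hσ').finrank_eq, P.finrank_tensor, Fintype.card_coe,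
      card_eq_four_of_mem_calS σ hσ hσ']
    rfl
  rw [Module.finrank_directSum, Finset.sum_coe_sort calS fun σ => Module.finrank F (P.VMod σ),
    ← Finset.add_sum_erase _ _ empty_mem_calS, h0,
    Finset.sum_congr rfl fun σ hσ => h1 σ (Finset.mem_of_mem_erase hσ) (Finset.ne_of_mem_erase hσ),
    Finset.sum_const, Finset.card_erase_of_mem empty_mem_calS,
    card_calS]
  rfl

theorem finite_E8Sum : Module.Finite F P.E8Sum := by
  have := fun σ : {σ // σ ∈ calS} => P.finite_VMod σ.1
  infer_instance

/-- `Ψ` is surjective between spaces of the same finite dimension. -/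
theorem psiSum_bijective : Function.Bijective P.psiSum := by
  have h := P.finite_E8
  have h' := P.finite_E8Sum
  refine ⟨?_, P.psiSum_surjective⟩
  exact (LinearMap.injective_iff_surjective_of_finrank_eq_finrank (K := F) (V := P.E8Sum)
    (V₂ := P.E8) (P.finrank_E8Sum.trans P.finrank_E8.symm)).2 P.psiSum_surjective

end

/-! ### Brackets with `sp(V)⁸` and within one summand -/

section

variable [NeZero (2 : F)]

theorem spTriple_half (s : Fin 4 → P.sp) (k : Fin 3) (h : Fin 2) (a b : V) :
    (P.spTriple s).1 k (half h a b) =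
      half h ((s (pairIdx k h 0)).1 a) b + half h a ((s (pairIdx k h 1)).1 b) := by
  rw [spTriple_apply]
  fin_cases h
  · exact P.rhoSp_half_zero _ a b
  · exact P.rhoSp_half_one _ a b

theorem tensorTriple_half (v : Fin 4 → V) (k : Fin 3) (h : Fin 2) (a b : V) :
    (P.tensorTriple v).1 k (half h a b) =
      (((if h = 0 then -1 else 1 : ℤ) : F) *
        (P.form (v (pairIdx k h 0)) a * P.form (v (pairIdx k h 1)) b)) •
        half (h + 1) (v (pairIdx k (h + 1) 0)) (v (pairIdx k (h + 1) 1)) := by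
  rw [tensorTriple_apply]
  fin_cases h
  · refine (P.rhoTensor_half_zero _ a b).trans ?_
    simp only [Fin.zero_eta, if_true, Int.cast_neg, Int.cast_one, neg_one_mul, neg_smul]
    rfl
  · refine (P.rhoTensor_half_one _ a b).trans ?_
    simp only [Fin.mk_one, one_ne_zero, if_false, Int.cast_one, one_mul]
    rfl

/-- The value of `θ^k(t)` on two elements of the same summand `V ⊗ V` of `S₈`. -/
theorem theta_pow_t_half_self (k : Fin 3) (h : Fin 2) (a b c d : V) :
    (P.S8.theta ^ (k : ℕ)) (P.S8.t (half h a b) (half h c d)) =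
      (2⁻¹ : F) • P.spTriple (Pi.single (pairIdx k h 0) (P.form b d • P.gamma a c) +
        Pi.single (pairIdx k h 1) (P.form a c • P.gamma b d)) := by
  rw [← P.theta_pow_spTriple k, ← map_smul]
  congr 1
  have key (x y : P.sp) (j : Fin 4) :
      (Pi.single (pairIdx k h 0) x + Pi.single (pairIdx k h 1) y : Fin 4 → P.sp) (cyc k j) =
        (if h = 0 then ![x, y, 0, 0] else ![0, 0, x, y]) j := by
    have e (i j : Fin 4) (x : P.sp) :
        (Pi.single (cyc k i) x : Fin 4 → P.sp) (cyc k j) =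
          (Pi.single i x : Fin 4 → P.sp) j := by
      simp only [Pi.single_apply, (cyc_injective k).eq_iff]
    fin_cases h
    · refine (congrArg₂ (· + ·) (e 0 j x) (e 1 j y)).trans ?_
      fin_cases j <;> simp
    · refine (congrArg₂ (· + ·) (e 2 j x) (e 3 j y)).trans ?_
      fin_cases j <;> simp
  simp only [key]
  fin_cases h
  · exact P.t_half_zero_zero a b c d
  · exact P.t_half_one_one a b c d

/-- The value of `θ^k(t)` on two elements of different summands `V ⊗ V` of `S₈`. -/
theorem theta_pow_t_half_add_one (k : Fin 3) (h : Fin 2) (u : Fin 4 → V) :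
    (P.S8.theta ^ (k : ℕ)) (P.S8.t (half h (u (pairIdx k h 0)) (u (pairIdx k h 1)))
      (half (h + 1) (u (pairIdx k (h + 1) 0)) (u (pairIdx k (h + 1) 1)))) =
      ((if h = 0 then -1 else 1 : ℤ) : F) • P.tensorTriple u := by
  rw [← P.theta_pow_tensorTriple k, ← map_smul]
  congr 1
  have e : (fun j => u (cyc k j)) =
      ![u (cyc k 0), u (cyc k 1), u (cyc k 2), u (cyc k 3)] := by
    funext j
    fin_cases j <;> rfl
  rw [e]
  fin_cases h
  · simp only [Fin.zero_eta, if_true, Int.cast_neg, Int.cast_one]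
    exact P.t_half_zero_one' _ _ _ _
  · simp only [Fin.mk_one, one_ne_zero, if_false, Int.cast_one]
    refine (P.t_half_one_zero _ _ _ _).trans (one_smul F _).symm

/-- The common element of the pairs `pairIdx k h` and `pairIdx (k + 1) g`. -/
def commonIdx (k : Fin 3) (h g : Fin 2) : Fin 4 := cyc k (![![1, 0], ![2, 3]] h g)

/-- The product of an element of a summand of the `k`-th `S₈` and one of the `(k + 1)`-st: the contraction
in the common index `commonIdx k h g`, up to a sign. The vector `z` collects the remaining factors. -/
theorem paraMul_half (k : Fin 3) (h g : Fin 2) (v w : Fin 4 → V) (z : Fin 4 → V)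
    (hz : ∀ i, z i = if i = pairIdx k h 0 ∨ i = pairIdx k h 1 then v i else w i) :
    P.paraMul (half h (v (pairIdx k h 0)) (v (pairIdx k h 1)))
      (half g (w (pairIdx (k + 1) g 0)) (w (pairIdx (k + 1) g 1))) =
      (((if h = 0 ∧ g = 0 then 1 else -1 : ℤ) : F) *
        P.form (v (commonIdx k h g)) (w (commonIdx k h g))) •
        half (h + g) (z (pairIdx (k + 2) (h + g) 0)) (z (pairIdx (k + 2) (h + g) 1)) := by
  obtain rfl : z = fun i => if i = pairIdx k h 0 ∨ i = pairIdx k h 1 then v i else w i :=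
    funext hz
  have e (k : Fin 3) (h g : Fin 2) : pairIdx k h g =
      ![![cyc k 0, cyc k 1], ![cyc k 2, cyc k 3]] h g := rfl
  fin_cases h <;> fin_cases g
  · refine (P.paraMul_zero_zero _ _ _ _).trans ?_
    fin_cases k <;> simp [commonIdx, e, cyc]
  · refine (P.paraMul_zero_one _ _ _ _).trans ?_
    fin_cases k <;> simp [commonIdx, e, cyc]
  · refine (P.paraMul_one_zero _ _ _ _).trans ?_
    fin_cases k <;> simp [commonIdx, e, cyc]
  · refine (P.paraMul_one_one _ _ _ _).trans ?_
    fin_cases k <;> simp [commonIdx, e, cyc]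

/-- The inclusion of the first triality Lie algebra in `𝔢₈`. -/
def ofLeft : P.S8.tri →ₗ[F] P.E8 := Magic.ofTri ∘ₗ LinearMap.inl F P.S8.tri P.S8.tri

/-- The inclusion of the second triality Lie algebra in `𝔢₈`. -/
def ofRight : P.S8.tri →ₗ[F] P.E8 := Magic.ofTri ∘ₗ LinearMap.inr F P.S8.tri P.S8.tri

theorem ofTri_left (d : P.S8.tri) : Magic.ofTri (d, 0) = P.ofLeft d := rfl

theorem ofTri_right (d : P.S8.tri) : Magic.ofTri (0, d) = P.ofRight d := rfl

theorem ofTri_eq (d e : P.S8.tri) : Magic.ofTri (d, e) = P.ofLeft d + P.ofRight e := by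
  rw [← ofTri_left, ← ofTri_right, ← map_add, Prod.mk_add_mk, add_zero, zero_add]

theorem lie_spE8_spE8 (s s' : Fin 8 → P.sp) :
    ⁅P.spE8 s, P.spE8 s'⁆ = P.spE8 (P.spPowLie s s') := by
  rw [spE8_apply, spE8_apply, Magic.lie_ofTri_ofTri, triLie_spTriple_spTriple,
    triLie_spTriple_spTriple]
  rfl

theorem lie_spE8_labelMap (s : Fin 8 → P.sp) (c : Label) (u : Fin 4 → V) :
    ⁅P.spE8 s, P.labelMap c u⁆ =
      ∑ i, P.labelMap c (Function.update u i ((s (labelIdx c i)).1 (u i))) := by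
  rw [spE8_apply]
  rcases c with a | ⟨k, h, h'⟩
  · fin_cases a
    · refine (Magic.lie_ofTri_ofTri _ _).trans ?_
      change Magic.ofTri (P.S8.triLie _ (P.tensorTriple u), P.S8.triLie _ 0) =
        ∑ i, P.ofLeft (P.tensorTriple (Function.update u i ((s (left8 i)).1 (u i))))
      rw [triLie_spTriple_tensorTriple, map_zero, ofTri_left, map_sum]
    · refine (Magic.lie_ofTri_ofTri _ _).trans ?_
      change Magic.ofTri (P.S8.triLie _ 0, P.S8.triLie _ (P.tensorTriple u)) =
        ∑ i, P.ofRight (P.tensorTriple (Function.update u i ((s (right8 i)).1 (u i))))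
      rw [triLie_spTriple_tensorTriple, map_zero, ofTri_right, map_sum]
  · refine (Magic.lie_ofTri_iota _ _ _ _).trans ?_
    rw [spTriple_half, spTriple_half, Fin.sum_univ_four, labelMap_mixed, labelMap_mixed,
      labelMap_mixed, labelMap_mixed, ← map_add, ← map_add, ← map_add, TensorProduct.add_tmul,
      TensorProduct.tmul_add]
    simp [Function.update, labelIdx, add_assoc]

theorem spE8_sum_left (g : Fin 4 → P.sp) :
    P.spE8 (∑ i, Pi.single (left8 i) (g i)) = P.ofLeft (P.spTriple g) := by
  have h (i j : Fin 4) : right8 j ≠ left8 i := by revert i j; decide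
  have e1 : (fun j => (∑ i, Pi.single (left8 i) (g i) : Fin 8 → P.sp) (left8 j)) = g := by
    funext j
    simp [Finset.sum_apply, Pi.single_apply, left8_injective.eq_iff]
  have e2 : (fun j => (∑ i, Pi.single (left8 i) (g i) : Fin 8 → P.sp) (right8 j)) = 0 := by
    funext j
    simp [Finset.sum_apply, Pi.single_apply, h]
  rw [spE8_apply, e1, e2, map_zero]
  rfl

theorem spE8_sum_right (g : Fin 4 → P.sp) :
    P.spE8 (∑ i, Pi.single (right8 i) (g i)) = P.ofRight (P.spTriple g) := by
  have h (i j : Fin 4) : left8 j ≠ right8 i := by revert i j; decide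
  have e1 : (fun j => (∑ i, Pi.single (right8 i) (g i) : Fin 8 → P.sp) (right8 j)) = g := by
    funext j
    simp [Finset.sum_apply, Pi.single_apply, right8_injective.eq_iff]
  have e2 : (fun j => (∑ i, Pi.single (right8 i) (g i) : Fin 8 → P.sp) (left8 j)) = 0 := by
    funext j
    simp [Finset.sum_apply, Pi.single_apply, h]
  rw [spE8_apply, e1, e2, map_zero]
  rfl

theorem spE8_single_left (i : Fin 4) (x : P.sp) :
    P.spE8 (Pi.single (left8 i) x) = P.ofLeft (P.spTriple (Pi.single i x)) := by
  rw [← spE8_sum_left]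
  congr 1
  rw [Finset.sum_eq_single i] <;> simp +contextual

theorem spE8_single_right (i : Fin 4) (x : P.sp) :
    P.spE8 (Pi.single (right8 i) x) = P.ofRight (P.spTriple (Pi.single i x)) := by
  rw [← spE8_sum_right]
  congr 1
  rw [Finset.sum_eq_single i] <;> simp +contextual

/-- The bracket of two elements of the same `V(σ)`, `σ ≠ ∅`. -/
theorem lie_labelMap_self (c : Label) (u z : Fin 4 → V) :
    ⁅P.labelMap c u, P.labelMap c z⁆ =
      (2⁻¹ : F) • P.spE8 (∑ i, Pi.single (labelIdx c i) (P.gammaProd u z i)) := by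
  rcases c with a | ⟨k, h, h'⟩
  · fin_cases a
    · refine (Magic.lie_ofTri_ofTri _ _).trans ?_
      change Magic.ofTri (P.S8.triLie (P.tensorTriple u) (P.tensorTriple z), P.S8.triLie 0 0) =
        (2⁻¹ : F) • P.spE8 (∑ i, Pi.single (left8 i) (P.gammaProd u z i))
      rw [triLie_tensorTriple_tensorTriple, map_zero, spE8_sum_left, ofTri_left,
        map_smul]
    · refine (Magic.lie_ofTri_ofTri _ _).trans ?_
      change Magic.ofTri (P.S8.triLie 0 0, P.S8.triLie (P.tensorTriple u) (P.tensorTriple z)) =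
        (2⁻¹ : F) • P.spE8 (∑ i, Pi.single (right8 i) (P.gammaProd u z i))
      rw [triLie_tensorTriple_tensorTriple, map_zero, spE8_sum_right, ofTri_right,
        map_smul]
  · refine (Magic.lie_iota_iota _ _ _ _ _).trans ?_
    rw [theta_pow_t_half_self, theta_pow_t_half_self, S8_q, S8_q, cayleyForm_half_self,
      cayleyForm_half_self, map_sum, Fin.sum_univ_four]
    have g0 : P.gammaProd u z 0 = (P.form (u 1) (z 1) * (P.form (u 2) (z 2) *
        P.form (u 3) (z 3))) • P.gamma (u 0) (z 0) := by
      simp [gammaProd, Fin.prod_univ_four, mul_assoc]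
    have g1 : P.gammaProd u z 1 = (P.form (u 0) (z 0) * (P.form (u 2) (z 2) *
        P.form (u 3) (z 3))) • P.gamma (u 1) (z 1) := by
      simp [gammaProd, Fin.prod_univ_four, mul_assoc]
    have g2 : P.gammaProd u z 2 = (P.form (u 3) (z 3) * (P.form (u 0) (z 0) *
        P.form (u 1) (z 1))) • P.gamma (u 2) (z 2) := by
      simp [gammaProd, Fin.prod_univ_four]
      ring_nf
    have g3 : P.gammaProd u z 3 = (P.form (u 2) (z 2) * (P.form (u 0) (z 0) *
        P.form (u 1) (z 1))) • P.gamma (u 3) (z 3) := by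
      simp [gammaProd, Fin.prod_univ_four]
      ring_nf
    rw [g0, g1, g2, g3]
    change _ = (2⁻¹ : F) • (P.spE8 (Pi.single (left8 (pairIdx k h 0)) _) +
      P.spE8 (Pi.single (left8 (pairIdx k h 1)) _) +
      P.spE8 (Pi.single (right8 (pairIdx k h' 0)) _) +
      P.spE8 (Pi.single (right8 (pairIdx k h' 1)) _))
    have hs (i : Fin 8) (r : F) (x : P.sp) :
        P.spE8 (Pi.single i (r • x)) = r • P.spE8 (Pi.single i x) := by
      rw [Pi.single_smul, map_smul]
    rw [ofTri_eq, map_smul, map_smul, map_smul, map_smul, map_add, map_add, map_add, map_add,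
      ← spE8_single_left, ← spE8_single_left, ← spE8_single_right, ← spE8_single_right]
    simp only [hs]
    module

end

/-! ### Brackets of distinct summands -/

section

theorem left8_ne_right8 : ∀ i j, left8 i ≠ right8 j := by decide

theorem mem_labelSet_inr_left : ∀ (k : Fin 3) (h h' : Fin 2) (i : Fin 4),
    left8 i ∈ labelSet (Sum.inr (k, h, h')) ↔ i = pairIdx k h 0 ∨ i = pairIdx k h 1 := by
  decide +kernel

theorem mem_labelSet_inr_right : ∀ (k : Fin 3) (h h' : Fin 2) (i : Fin 4),
    right8 i ∈ labelSet (Sum.inr (k, h, h')) ↔ i = pairIdx k h' 0 ∨ i = pairIdx k h' 1 := by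
  decide +kernel

theorem left8_mem_labelSet_inl_zero : ∀ i, left8 i ∈ labelSet (Sum.inl 0) := by decide +kernel

theorem right8_notMem_labelSet_inl_zero : ∀ i, right8 i ∉ labelSet (Sum.inl 0) := by
  decide +kernel

theorem left8_notMem_labelSet_inl_one : ∀ i, left8 i ∉ labelSet (Sum.inl 1) := by
  decide +kernel

theorem right8_mem_labelSet_inl_one : ∀ i, right8 i ∈ labelSet (Sum.inl 1) := by decide +kernel

theorem pairIdx_zero_ne_one : ∀ k h, pairIdx k h 0 ≠ pairIdx k h 1 := by decide

theorem pairIdx_add_one_ne : ∀ k h (e : Fin 2),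
    pairIdx k (h + 1) e ≠ pairIdx k h 0 ∧ pairIdx k (h + 1) e ≠ pairIdx k h 1 := by decide

theorem inter_inl_zero : ∀ k h h', labelSet (Sum.inl 0) ∩ labelSet (Sum.inr (k, h, h')) =
    {left8 (pairIdx k h 0), left8 (pairIdx k h 1)} := by decide +kernel

theorem inter_inl_one : ∀ k h h', labelSet (Sum.inl 1) ∩ labelSet (Sum.inr (k, h, h')) =
    {right8 (pairIdx k h' 0), right8 (pairIdx k h' 1)} := by decide +kernel

theorem inter_inr_same_left : ∀ k h h',
    labelSet (Sum.inr (k, h, h')) ∩ labelSet (Sum.inr (k, h, h' + 1)) =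
    {left8 (pairIdx k h 0), left8 (pairIdx k h 1)} := by decide +kernel

theorem inter_inr_same_right : ∀ k h h',
    labelSet (Sum.inr (k, h, h')) ∩ labelSet (Sum.inr (k, h + 1, h')) =
    {right8 (pairIdx k h' 0), right8 (pairIdx k h' 1)} := by decide +kernel

theorem inter_inr_add_one : ∀ k h h' g g',
    labelSet (Sum.inr (k, h, h')) ∩ labelSet (Sum.inr (k + 1, g, g')) =
    {left8 (commonIdx k h g), right8 (commonIdx k h' g')} := by decide +kernel

theorem epsE8_inl_zero : ∀ k h h', epsE8 (labelSet (Sum.inl 0)) (labelSet (Sum.inr (k, h, h'))) =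
    if h = 0 then -1 else 1 := by decide +kernel

theorem epsE8_inl_one : ∀ k h h', epsE8 (labelSet (Sum.inl 1)) (labelSet (Sum.inr (k, h, h'))) =
    if h' = 0 then -1 else 1 := by decide +kernel

theorem epsE8_inr_same_left : ∀ k h h', epsE8 (labelSet (Sum.inr (k, h, h')))
    (labelSet (Sum.inr (k, h, h' + 1))) = if h' = 0 then -1 else 1 := by decide +kernel

theorem epsE8_inr_same_right : ∀ k h h', epsE8 (labelSet (Sum.inr (k, h, h')))
    (labelSet (Sum.inr (k, h + 1, h'))) = if h = 0 then -1 else 1 := by decide +kernel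

theorem epsE8_inr_add_one : ∀ k h h' g g', epsE8 (labelSet (Sum.inr (k, h, h')))
    (labelSet (Sum.inr (k + 1, g, g'))) =
      (if h = 0 ∧ g = 0 then 1 else -1) * if h' = 0 ∧ g' = 0 then 1 else -1 := by decide +kernel

theorem epsE8_self : ∀ c, epsE8 (labelSet c) (labelSet c) = -1 := by decide +kernel

theorem epsE8_empty_left : ∀ σ ∈ calS, epsE8 ∅ σ = 1 := by decide +kernel

theorem epsE8_empty_right : ∀ σ ∈ calS, epsE8 σ ∅ = 1 := by decide +kernel

theorem epsE8_swap : ∀ c c', labelSet c ≠ labelSet c' →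
    epsE8 (labelSet c) (labelSet c') = -epsE8 (labelSet c') (labelSet c) := by decide +kernel

theorem card_inter_labelSet : ∀ c c', labelSet c ≠ labelSet c' →
    symmDiff (labelSet c) (labelSet c') ≠ Finset.univ →
    (labelSet c ∩ labelSet c').card = 2 := by decide +kernel

theorem labelSet_ne_univ : ∀ c, labelSet c ≠ Finset.univ := by decide +kernel

theorem symmDiff_inl_inl_ne : ∀ a b c, symmDiff (labelSet (Sum.inl a)) (labelSet (Sum.inl b)) ≠
    labelSet c := by decide +kernel

theorem symmDiff_inl_zero_inr : ∀ k h h', symmDiff (labelSet (Sum.inl 0))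
    (labelSet (Sum.inr (k, h, h'))) = labelSet (Sum.inr (k, h + 1, h')) := by decide +kernel

theorem symmDiff_inl_one_inr : ∀ k h h', symmDiff (labelSet (Sum.inl 1))
    (labelSet (Sum.inr (k, h, h'))) = labelSet (Sum.inr (k, h, h' + 1)) := by decide +kernel

theorem symmDiff_inr_same_left : ∀ k h h', symmDiff (labelSet (Sum.inr (k, h, h')))
    (labelSet (Sum.inr (k, h, h' + 1))) = labelSet (Sum.inl 1) := by decide +kernel

theorem symmDiff_inr_same_right : ∀ k h h', symmDiff (labelSet (Sum.inr (k, h, h')))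
    (labelSet (Sum.inr (k, h + 1, h'))) = labelSet (Sum.inl 0) := by decide +kernel

theorem symmDiff_inr_same_both : ∀ k h h', symmDiff (labelSet (Sum.inr (k, h, h')))
    (labelSet (Sum.inr (k, h + 1, h' + 1))) = Finset.univ := by decide +kernel

theorem symmDiff_inr_add_one : ∀ k h h' g g', symmDiff (labelSet (Sum.inr (k, h, h')))
    (labelSet (Sum.inr (k + 1, g, g'))) = labelSet (Sum.inr (k + 2, h + g, h' + g')) := by
  decide +kernel

variable [NeZero (2 : F)]

/-- The formula for the bracket of the images under `Ψ` of the spaces `V(σ)` and `V(τ)`, for the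
sets `σ ≠ τ` with labels `c` and `c'`, where `c''` is the label of `σ + τ`. -/
def BracketFormula (c c' c'' : Label) : Prop := ∀ v w : Fin 8 → V,
  ⁅P.labelElt c v, P.labelElt c' w⁆ =
    ((epsE8 (labelSet c) (labelSet c') : ℤ) : F) •
      (∏ k ∈ labelSet c ∩ labelSet c', P.form (v k) (w k)) •
        P.labelElt c'' fun i => if i ∈ labelSet c then v i else w i

theorem labelElt_congr {c : Label} {v w : Fin 8 → V} (h : ∀ i ∈ labelSet c, v i = w i) :
    P.labelElt c v = P.labelElt c w := by
  rw [labelElt, labelElt]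
  congr 1
  exact funext fun i => h _ (Finset.mem_image_of_mem _ (Finset.mem_univ i))

variable {P} in
/-- The bracket formula is symmetric under exchange of the two sets: the bracket and `ε` are
antisymmetric, and the product over the two elements of `σ ∩ τ` is symmetric. -/
theorem BracketFormula.swap {c c' c'' : Label} (h : P.BracketFormula c c' c'')
    (hc : symmDiff (labelSet c) (labelSet c') = labelSet c'') : P.BracketFormula c' c c'' := by
  intro v w
  have hne : labelSet c ≠ labelSet c' := fun e =>
    labelSet_ne_empty c'' (by rw [← hc, e]; exact symmDiff_self _)
  have h2 := card_inter_labelSet c c' hne (by rw [hc]; exact labelSet_ne_univ c'')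
  have hp : ∏ k ∈ labelSet c ∩ labelSet c', P.form (w k) (v k) =
      ∏ k ∈ labelSet c' ∩ labelSet c, P.form (v k) (w k) := by
    rw [Finset.inter_comm (labelSet c')]
    simp only [← P.neg_form (v _) (w _)]
    rw [Finset.prod_neg, h2]
    simp
  have hl : P.labelElt c'' (fun i => if i ∈ labelSet c then w i else v i) =
      P.labelElt c'' fun i => if i ∈ labelSet c' then v i else w i := by
    refine P.labelElt_congr fun i hi => ?_
    rw [← hc, Finset.mem_symmDiff] at hi
    rcases hi with ⟨h1, h2⟩ | ⟨h1, h2⟩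
    · rw [if_pos h1, if_neg h2]
    · rw [if_neg h2, if_pos h1]
  rw [Magic.lie_swap, h w v, hp, hl, epsE8_swap c c' hne, Int.cast_neg, neg_smul, neg_neg]

/-- The action of the first `V^{⊗4}` on a summand of `ι_k(S₈ ⊗ S₈)`. -/
theorem bracketFormula_inl_zero_inr (k : Fin 3) (h h' : Fin 2) :
    P.BracketFormula (Sum.inl 0) (Sum.inr (k, h, h')) (Sum.inr (k, h + 1, h')) := by
  intro v w
  refine (Magic.lie_ofTri_iota _ _ _ _).trans ?_
  rw [inter_inl_zero, Finset.prod_pair (left8_injective.ne (pairIdx_zero_ne_one k h)),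
    epsE8_inl_zero, smul_smul]
  change Magic.iota k ((P.tensorTriple fun i => v (left8 i)).1 k _ ⊗ₜ _ + _ ⊗ₜ 0) = _ •
    Magic.iota k (half (h + 1) (if left8 _ ∈ labelSet (Sum.inl 0) then _ else _)
      (if left8 _ ∈ labelSet (Sum.inl 0) then _ else _) ⊗ₜ
        half h' (if right8 _ ∈ labelSet (Sum.inl 0) then _ else _)
      (if right8 _ ∈ labelSet (Sum.inl 0) then _ else _))
  rw [if_pos (left8_mem_labelSet_inl_zero _), if_pos (left8_mem_labelSet_inl_zero _),
    if_neg (right8_notMem_labelSet_inl_zero _), if_neg (right8_notMem_labelSet_inl_zero _),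
    TensorProduct.tmul_zero, add_zero, ← map_smul, tensorTriple_half, ← TensorProduct.smul_tmul']
  rfl

/-- The action of the second `V^{⊗4}` on a summand of `ι_k(S₈ ⊗ S₈)`. -/
theorem bracketFormula_inl_one_inr (k : Fin 3) (h h' : Fin 2) :
    P.BracketFormula (Sum.inl 1) (Sum.inr (k, h, h')) (Sum.inr (k, h, h' + 1)) := by
  intro v w
  refine (Magic.lie_ofTri_iota _ _ _ _).trans ?_
  rw [inter_inl_one, Finset.prod_pair (right8_injective.ne (pairIdx_zero_ne_one k h')),
    epsE8_inl_one, smul_smul]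
  change Magic.iota k (0 ⊗ₜ _ + _ ⊗ₜ (P.tensorTriple fun i => v (right8 i)).1 k _) = _ •
    Magic.iota k (half h (if left8 _ ∈ labelSet (Sum.inl 1) then _ else _)
      (if left8 _ ∈ labelSet (Sum.inl 1) then _ else _) ⊗ₜ
        half (h' + 1) (if right8 _ ∈ labelSet (Sum.inl 1) then _ else _)
      (if right8 _ ∈ labelSet (Sum.inl 1) then _ else _))
  rw [if_neg (left8_notMem_labelSet_inl_one _), if_neg (left8_notMem_labelSet_inl_one _),
    if_pos (right8_mem_labelSet_inl_one _), if_pos (right8_mem_labelSet_inl_one _),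
    TensorProduct.zero_tmul, zero_add, ← map_smul, tensorTriple_half, TensorProduct.tmul_smul]
  rfl

theorem fin_two_ne_add_one : ∀ h : Fin 2, h ≠ h + 1 := by decide

/-- The bracket of two summands of `ι_k(S₈ ⊗ S₈)` that differ in the second `S₈`: only `t'` contributes. -/
theorem bracketFormula_inr_same_left (k : Fin 3) (h h' : Fin 2) :
    P.BracketFormula (Sum.inr (k, h, h')) (Sum.inr (k, h, h' + 1)) (Sum.inl 1) := by
  intro v w
  refine (Magic.lie_iota_iota _ _ _ _ _).trans ?_
  rw [inter_inr_same_left, Finset.prod_pair (left8_injective.ne (pairIdx_zero_ne_one k h)),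
    epsE8_inr_same_left, S8_q, S8_q, P.cayleyForm_half_of_ne (fin_two_ne_add_one h'),
    cayleyForm_half_self, zero_smul, ofTri_right]
  have key := P.theta_pow_t_half_add_one k h'
    fun i => if right8 i ∈ labelSet (Sum.inr (k, h, h')) then v (right8 i) else w (right8 i)
  simp only [mem_labelSet_inr_right, true_or, or_true, if_true, (pairIdx_add_one_ne k h' _).1,
    (pairIdx_add_one_ne k h' _).2, or_self, if_false] at key
  change P.ofRight ((P.form (v (left8 (pairIdx k h 0))) (w (left8 (pairIdx k h 0))) *
    P.form (v (left8 (pairIdx k h 1))) (w (left8 (pairIdx k h 1)))) •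
    (P.S8.theta ^ (k : ℕ)) (P.S8.t (half h' (v (right8 (pairIdx k h' 0)))
      (v (right8 (pairIdx k h' 1)))) (half (h' + 1) (w (right8 (pairIdx k (h' + 1) 0)))
      (w (right8 (pairIdx k (h' + 1) 1)))))) = _ • _ • P.ofRight (P.tensorTriple _)
  rw [key, map_smul, map_smul, smul_comm]
  simp only [← mem_labelSet_inr_right k h h']
  rfl

/-- The bracket of two summands of `ι_k(S₈ ⊗ S₈)` that differ in the first `S₈`: only `t` contributes. -/
theorem bracketFormula_inr_same_right (k : Fin 3) (h h' : Fin 2) :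
    P.BracketFormula (Sum.inr (k, h, h')) (Sum.inr (k, h + 1, h')) (Sum.inl 0) := by
  intro v w
  refine (Magic.lie_iota_iota _ _ _ _ _).trans ?_
  rw [inter_inr_same_right, Finset.prod_pair (right8_injective.ne (pairIdx_zero_ne_one k h')),
    epsE8_inr_same_right, S8_q, S8_q, P.cayleyForm_half_of_ne (fin_two_ne_add_one h),
    cayleyForm_half_self, zero_smul, ofTri_left]
  have key := P.theta_pow_t_half_add_one k h
    fun i => if left8 i ∈ labelSet (Sum.inr (k, h, h')) then v (left8 i) else w (left8 i)
  simp only [mem_labelSet_inr_left, true_or, or_true, if_true, (pairIdx_add_one_ne k h _).1,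
    (pairIdx_add_one_ne k h _).2, or_self, if_false] at key
  change P.ofLeft ((P.form (v (right8 (pairIdx k h' 0))) (w (right8 (pairIdx k h' 0))) *
    P.form (v (right8 (pairIdx k h' 1))) (w (right8 (pairIdx k h' 1)))) •
    (P.S8.theta ^ (k : ℕ)) (P.S8.t (half h (v (left8 (pairIdx k h 0)))
      (v (left8 (pairIdx k h 1)))) (half (h + 1) (w (left8 (pairIdx k (h + 1) 0)))
      (w (left8 (pairIdx k (h + 1) 1)))))) = _ • _ • P.ofLeft (P.tensorTriple _)
  rw [key, map_smul, map_smul, smul_comm]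
  simp only [← mem_labelSet_inr_left k h h']
  rfl

/-- The bracket of a summand of `ι_k(S₈ ⊗ S₈)` and one of `ι_{k+1}(S₈ ⊗ S₈)`: the sign is the product of
the two signs in `paraMul_half`. -/
theorem bracketFormula_inr_add_one (k : Fin 3) (h h' g g' : Fin 2) :
    P.BracketFormula (Sum.inr (k, h, h')) (Sum.inr (k + 1, g, g'))
      (Sum.inr (k + 2, h + g, h' + g')) := by
  intro v w
  refine (Magic.lie_iota_iota_succ _ _ _ _ _).trans ?_
  rw [inter_inr_add_one, Finset.prod_pair (left8_ne_right8 _ _), epsE8_inr_add_one, S8_mul, S8_mul]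
  have e := P.paraMul_half k h g (fun i => v (left8 i)) (fun i => w (left8 i))
    (fun i => if left8 i ∈ labelSet (Sum.inr (k, h, h')) then v (left8 i) else w (left8 i))
    fun i => by simp only [mem_labelSet_inr_left]
  have e' := P.paraMul_half k h' g' (fun i => v (right8 i)) (fun i => w (right8 i))
    (fun i => if right8 i ∈ labelSet (Sum.inr (k, h, h')) then v (right8 i) else w (right8 i))
    fun i => by simp only [mem_labelSet_inr_right]
  have e2 := congrArg₂ (fun X Y => (Magic.iota (k + 2) (X ⊗ₜ[F] Y) : P.E8)) e e'
  refine e2.trans ?_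
  rw [TensorProduct.smul_tmul_smul, map_smul, smul_smul, Int.cast_mul]
  rw [mul_mul_mul_comm]
  rfl

theorem bracketFormula_inl_inr (a : Fin 2) (p : Fin 3 × Fin 2 × Fin 2) (c : Label)
    (hc : symmDiff (labelSet (Sum.inl a)) (labelSet (Sum.inr p)) = labelSet c) :
    P.BracketFormula (Sum.inl a) (Sum.inr p) c := by
  obtain ⟨k, h, h'⟩ := p
  fin_cases a
  · obtain rfl := labelSet_injective (hc.symm.trans (symmDiff_inl_zero_inr k h h'))
    exact P.bracketFormula_inl_zero_inr k h h'
  · obtain rfl := labelSet_injective (hc.symm.trans (symmDiff_inl_one_inr k h h'))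
    exact P.bracketFormula_inl_one_inr k h h'

theorem bracketFormula {c c' c'' : Label}
    (hc : symmDiff (labelSet c) (labelSet c') = labelSet c'') : P.BracketFormula c c' c'' := by
  rcases c with a | ⟨k, h, h'⟩
  · rcases c' with b | p
    · exact absurd hc (symmDiff_inl_inl_ne a b c'')
    · exact P.bracketFormula_inl_inr a p c'' hc
  · rcases c' with b | ⟨j, g, g'⟩
    · rw [symmDiff_comm] at hc
      exact (P.bracketFormula_inl_inr b _ c'' hc).swap hc
    · obtain rfl | rfl | rfl : j = k ∨ j = k + 1 ∨ k = j + 1 := by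
        clear hc
        revert j k
        decide
      · have h2 : ∀ a b : Fin 2, b = a ∨ b = a + 1 := by decide
        obtain rfl | rfl := h2 h g <;> obtain rfl | rfl := h2 h' g'
        · exact absurd hc.symm (by rw [symmDiff_self]; exact labelSet_ne_empty c'')
        · obtain rfl := labelSet_injective (hc.symm.trans (symmDiff_inr_same_left _ _ _))
          exact P.bracketFormula_inr_same_left _ _ _
        · obtain rfl := labelSet_injective (hc.symm.trans (symmDiff_inr_same_right _ _ _))
          exact P.bracketFormula_inr_same_right _ _ _
        · exact absurd (hc.symm.trans (symmDiff_inr_same_both _ _ _)) (labelSet_ne_univ c'')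
      · obtain rfl := labelSet_injective (hc.symm.trans (symmDiff_inr_add_one _ _ _ _ _))
        exact P.bracketFormula_inr_add_one _ _ _ _ _
      · rw [symmDiff_comm] at hc
        obtain rfl := labelSet_injective (hc.symm.trans (symmDiff_inr_add_one _ _ _ _ _))
        exact (P.bracketFormula_inr_add_one _ _ _ _ _).swap hc

/-- The label of the complement of the set with a given label. -/
def complLabel : Label → Label
  | Sum.inl a => Sum.inl (a + 1)
  | Sum.inr (k, h, h') => Sum.inr (k, h + 1, h' + 1)

theorem eq_complLabel : ∀ c c', symmDiff (labelSet c) (labelSet c') = Finset.univ →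
    c' = complLabel c := by decide +kernel

/-- The summands for complementary sets commute: one of them is in each triality Lie algebra, or both
forms vanish. -/
theorem lie_labelMap_eq_zero {c c' : Label}
    (hc : symmDiff (labelSet c) (labelSet c') = Finset.univ) (u z : Fin 4 → V) :
    ⁅P.labelMap c u, P.labelMap c' z⁆ = 0 := by
  obtain rfl := eq_complLabel c c' hc
  rcases c with a | ⟨k, h, h'⟩
  · fin_cases a
    · refine (Magic.lie_ofTri_ofTri _ _).trans ?_
      change Magic.ofTri (P.S8.triLie _ 0, P.S8.triLie 0 _) = 0
      rw [map_zero, map_zero, LinearMap.zero_apply]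
      exact map_zero _
    · refine (Magic.lie_ofTri_ofTri _ _).trans ?_
      change Magic.ofTri (P.S8.triLie 0 _, P.S8.triLie _ 0) = 0
      rw [map_zero, map_zero, LinearMap.zero_apply]
      exact map_zero _
  · refine (Magic.lie_iota_iota _ _ _ _ _).trans ?_
    rw [S8_q, S8_q, P.cayleyForm_half_of_ne (fin_two_ne_add_one h),
      P.cayleyForm_half_of_ne (fin_two_ne_add_one h'), zero_smul, zero_smul]
    exact map_zero _

end

/-! ### The bracket formula -/

section

/-- Linear maps on `V(σ)`, `σ ≠ ∅`, are determined by their values on pure tensors. -/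
theorem VMod.hom_ext {n : ℕ} {σ : Finset (Fin n)} (hσ : σ ≠ ∅) {N : Type*} [AddCommGroup N]
    [Module F N] {f g : P.VMod σ →ₗ[F] N}
    (h : ∀ v, f (VMod.pure P σ v) = g (VMod.pure P σ v)) : f = g := by
  have key : f ∘ₗ (VMod.tensorEquiv P hσ).symm.toLinearMap =
      g ∘ₗ (VMod.tensorEquiv P hσ).symm.toLinearMap := by
    refine PiTensorProduct.ext (MultilinearMap.ext fun u => ?_)
    have hu : (fun i : σ => (fun j => if hj : j ∈ σ then u ⟨j, hj⟩ else 0) (i : Fin n)) = u :=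
      funext fun i => dif_pos i.2
    have := h fun j => if hj : j ∈ σ then u ⟨j, hj⟩ else 0
    rw [VMod.pure, hu] at this
    exact this
  refine LinearMap.ext fun x => ?_
  have := LinearMap.congr_fun key (VMod.tensorEquiv P hσ x)
  simpa using this

theorem VMod.eq_ofSp {n : ℕ} (x : P.VMod (∅ : Finset (Fin n))) :
    x = VMod.ofSp P (x.1 ⟨rfl⟩) :=
  ((VMod.emptyEquiv P).symm_apply_apply x).symm

variable [NeZero (2 : F)]

theorem lie_spE8_labelElt (s : Fin 8 → P.sp) (c : Label) (v : Fin 8 → V) :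
    ⁅P.spE8 s, P.labelElt c v⁆ =
      ∑ j ∈ labelSet c, P.labelElt c (Function.update v j ((s j).1 (v j))) := by
  rw [labelElt, lie_spE8_labelMap, labelSet,
    Finset.sum_image fun i _ j _ h => labelIdx_injective c h]
  refine Finset.sum_congr rfl fun i _ => ?_
  rw [labelElt]
  congr 1
  exact (Function.update_comp_eq_of_injective v (labelIdx_injective c) i _).symm

theorem lie_labelElt_self (c : Label) (v w : Fin 8 → V) :
    ⁅P.labelElt c v, P.labelElt c w⁆ =
      (2⁻¹ : F) • P.spE8 (∑ j ∈ labelSet c, (∏ k ∈ (labelSet c).erase j, P.form (v k) (w k)) •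
        (Pi.single j (P.gamma (v j) (w j)) : Fin 8 → P.sp)) := by
  have hi := labelIdx_injective c
  rw [labelElt, labelElt, lie_labelMap_self, labelSet, Finset.sum_image fun i _ j _ h => hi h]
  congr 2
  refine Finset.sum_congr rfl fun i _ => ?_
  rw [← Pi.single_smul, gammaProd, ← Finset.image_erase hi, Finset.prod_image fun i _ j _ h => hi h,
    ← Finset.mul_prod_erase _ _ (Finset.mem_univ i), if_pos rfl, one_mul]
  congr 2
  exact Finset.prod_congr rfl fun k hk => if_neg (Finset.ne_of_mem_erase hk)

theorem lie_psi_empty_empty (s s' : Fin 8 → P.sp) :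
    ⁅P.psi ∅ (VMod.ofSp P s), P.psi ∅ (VMod.ofSp P s')⁆ =
      P.psi (symmDiff ∅ ∅) (P.phi ∅ ∅ (VMod.ofSp P s) (VMod.ofSp P s')) := by
  rw [psi_of_eq_empty P rfl, psi_of_eq_empty P rfl, psi_of_eq_empty P (symmDiff_self _)]
  refine (P.lie_spE8_spE8 s s').trans (congrArg P.spE8 ?_)
  exact funext fun i => Subtype.ext (P.phi_ofSp_ofSp s s' i).symm

theorem lie_psi_empty_pure (s : Fin 8 → P.sp) {c : Label} {σ : Finset (Fin 8)}
    (hc : labelSet c = σ) (v : Fin 8 → V) :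
    ⁅P.psi ∅ (VMod.ofSp P s), P.psi σ (VMod.pure P σ v)⁆ =
      P.psi (symmDiff ∅ σ) (P.phi ∅ σ (VMod.ofSp P s) (VMod.pure P σ v)) := by
  have hσ : σ ≠ ∅ := hc ▸ labelSet_ne_empty c
  rw [psi_of_eq_empty P rfl, P.psi_pure hc, P.phi_ofSp_pure hσ, map_sum]
  refine (P.lie_spE8_labelElt s c v).trans ?_
  rw [hc]
  exact Finset.sum_congr rfl fun j _ => (P.psi_pure (hc.trans (bot_symmDiff σ).symm) _).symm

theorem lie_psi_pure_empty (s : Fin 8 → P.sp) {c : Label} {σ : Finset (Fin 8)}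
    (hc : labelSet c = σ) (v : Fin 8 → V) :
    ⁅P.psi σ (VMod.pure P σ v), P.psi ∅ (VMod.ofSp P s)⁆ =
      P.psi (symmDiff σ ∅) (P.phi σ ∅ (VMod.pure P σ v) (VMod.ofSp P s)) := by
  have hσ : σ ≠ ∅ := hc ▸ labelSet_ne_empty c
  rw [psi_of_eq_empty P rfl, P.psi_pure hc, P.phi_pure_ofSp hσ, map_neg, map_sum, Magic.lie_swap]
  refine congrArg Neg.neg ((P.lie_spE8_labelElt s c v).trans ?_)
  rw [hc]
  exact Finset.sum_congr rfl fun j _ => (P.psi_pure (hc.trans (symmDiff_bot σ).symm) _).symm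

theorem lie_psi_pure_self {c : Label} {σ : Finset (Fin 8)} (hc : labelSet c = σ)
    (v w : Fin 8 → V) :
    ⁅P.psi σ (VMod.pure P σ v), P.psi σ (VMod.pure P σ w)⁆ =
      -P.psi (symmDiff σ σ) (P.phi σ σ (VMod.pure P σ v) (VMod.pure P σ w)) := by
  have hσ : σ ≠ ∅ := hc ▸ labelSet_ne_empty c
  rw [P.psi_pure hc, P.psi_pure hc, psi_of_eq_empty P (symmDiff_self _), P.phi_pure_self hσ,
    lie_labelElt_self, map_smul, neg_smul, neg_neg, hc]

theorem lie_psi_pure_pure {c c' c'' : Label} {σ τ : Finset (Fin 8)} (hc : labelSet c = σ)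
    (hc' : labelSet c' = τ) (hc'' : labelSet c'' = symmDiff σ τ) (v w : Fin 8 → V) :
    ⁅P.psi σ (VMod.pure P σ v), P.psi τ (VMod.pure P τ w)⁆ =
      ((epsE8 σ τ : ℤ) : F) •
        P.psi (symmDiff σ τ) (P.phi σ τ (VMod.pure P σ v) (VMod.pure P τ w)) := by
  have hσ : σ ≠ ∅ := hc ▸ labelSet_ne_empty c
  have hτ : τ ≠ ∅ := hc' ▸ labelSet_ne_empty c'
  have hne : σ ≠ τ := fun e => labelSet_ne_empty c'' (by rw [hc'', e]; exact symmDiff_self _)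
  rw [P.phi_pure_pure hσ hτ hne, map_smul, P.psi_pure hc'', P.psi_pure hc, P.psi_pure hc']
  subst hc hc'
  exact P.bracketFormula hc''.symm v w

theorem lie_psi_pure {σ τ : Finset (Fin 8)} (hσ : σ ∈ calS) (hτ : τ ∈ calS) (hσ' : σ ≠ ∅)
    (hτ' : τ ≠ ∅) (hστ : symmDiff σ τ ∈ calS) (v w : Fin 8 → V) :
    ⁅P.psi σ (VMod.pure P σ v), P.psi τ (VMod.pure P τ w)⁆ =
      ((epsE8 σ τ : ℤ) : F) •
        P.psi (symmDiff σ τ) (P.phi σ τ (VMod.pure P σ v) (VMod.pure P τ w)) := by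
  obtain ⟨c, hc⟩ := (eq_empty_or_exists_label σ hσ).resolve_left hσ'
  obtain ⟨c', hc'⟩ := (eq_empty_or_exists_label τ hτ).resolve_left hτ'
  obtain h | ⟨c'', hc''⟩ := eq_empty_or_exists_label _ hστ
  · obtain rfl : σ = τ := symmDiff_eq_empty.1 h
    have he : epsE8 σ σ = -1 := by rw [← hc, epsE8_self]
    rw [P.lie_psi_pure_self hc, he, Int.cast_neg, Int.cast_one, neg_smul, one_smul]
  · exact P.lie_psi_pure_pure hc hc' hc'' v w

/-- The bracket formula. Both sides are bilinear, so they are compared on `sp(V)⁸` and on pure tensors. -/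
theorem lie_psi {σ τ : Finset (Fin 8)} (hσ : σ ∈ calS) (hτ : τ ∈ calS)
    (hστ : symmDiff σ τ ∈ calS) (x : P.VMod σ) (y : P.VMod τ) :
    ⁅P.psi σ x, P.psi τ y⁆ = ((epsE8 σ τ : ℤ) : F) • P.psi (symmDiff σ τ) (P.phi σ τ x y) := by
  let f : P.VMod σ →ₗ[F] P.VMod τ →ₗ[F] P.E8 := Magic.bracket.compl₁₂ (P.psi σ) (P.psi τ)
  let g : P.VMod σ →ₗ[F] P.VMod τ →ₗ[F] P.E8 :=
    ((epsE8 σ τ : ℤ) : F) • (P.phi σ τ).compr₂ (P.psi (symmDiff σ τ))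
  suffices h : ∀ x, f x = g x from LinearMap.congr_fun (h x) y
  by_cases hσ' : σ = ∅
  · subst hσ'
    intro x
    rw [VMod.eq_ofSp P x]
    generalize x.1 ⟨rfl⟩ = s
    by_cases hτ' : τ = ∅
    · subst hτ'
      refine LinearMap.ext fun y => ?_
      rw [VMod.eq_ofSp P y]
      refine (P.lie_psi_empty_empty s _).trans ?_
      simp only [g, LinearMap.smul_apply, LinearMap.compr₂_apply, epsE8_empty_left _ hτ,
        Int.cast_one, one_smul]
    · obtain ⟨c, hc⟩ := (eq_empty_or_exists_label τ hτ).resolve_left hτ'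
      refine VMod.hom_ext P hτ' fun v => (P.lie_psi_empty_pure s hc v).trans ?_
      simp only [g, LinearMap.smul_apply, LinearMap.compr₂_apply, epsE8_empty_left _ hτ,
        Int.cast_one, one_smul]
  · suffices h : f = g from fun x => LinearMap.congr_fun h x
    refine VMod.hom_ext P hσ' fun v => ?_
    by_cases hτ' : τ = ∅
    · subst hτ'
      obtain ⟨c, hc⟩ := (eq_empty_or_exists_label σ hσ).resolve_left hσ'
      refine LinearMap.ext fun y => ?_
      rw [VMod.eq_ofSp P y]
      refine (P.lie_psi_pure_empty _ hc v).trans ?_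
      simp only [g, LinearMap.smul_apply, LinearMap.compr₂_apply, epsE8_empty_right _ hσ,
        Int.cast_one, one_smul]
    · exact VMod.hom_ext P hτ' fun w => P.lie_psi_pure hσ hτ hσ' hτ' hστ v w

theorem symmDiff_eq_univ_of_notMem : ∀ σ ∈ calS, ∀ τ ∈ calS, symmDiff σ τ ∉ calS →
    symmDiff σ τ = Finset.univ := by decide +kernel

theorem lie_psi_eq_zero {σ τ : Finset (Fin 8)} (hσ : σ ∈ calS) (hτ : τ ∈ calS)
    (hστ : symmDiff σ τ ∉ calS) (x : P.VMod σ) (y : P.VMod τ) :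
    ⁅P.psi σ x, P.psi τ y⁆ = 0 := by
  have hσ' : σ ≠ ∅ := fun h => hστ (by rw [h]; exact (bot_symmDiff τ).symm ▸ hτ)
  have hτ' : τ ≠ ∅ := fun h => hστ (by rw [h]; exact (symmDiff_bot σ).symm ▸ hσ)
  obtain ⟨c, hc⟩ := (eq_empty_or_exists_label σ hσ).resolve_left hσ'
  obtain ⟨c', hc'⟩ := (eq_empty_or_exists_label τ hτ).resolve_left hτ'
  let f : P.VMod σ →ₗ[F] P.VMod τ →ₗ[F] P.E8 := Magic.bracket.compl₁₂ (P.psi σ) (P.psi τ)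
  suffices h : f = 0 from LinearMap.congr_fun₂ h x y
  refine VMod.hom_ext P hσ' fun v => VMod.hom_ext P hτ' fun w => ?_
  change ⁅P.psi σ (VMod.pure P σ v), P.psi τ (VMod.pure P τ w)⁆ = 0
  rw [P.psi_pure hc, P.psi_pure hc']
  refine P.lie_labelMap_eq_zero ?_ _ _
  rw [hc, hc']
  exact symmDiff_eq_univ_of_notMem _ hσ _ hτ hστ

end

end SymplecticPlane

end E8Model

theorem mainTheorem4 {F V : Type*} [Field F] [NeZero (2 : F)] [AddCommGroup V] [Module F V]
    (P : SymplecticPlane F V) :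
    -- `𝒮` consists of the empty set and of the affine planes of `𝔽₂³`, which are `14` in number
    (Function.Bijective pt ∧ (∀ σ, σ ∈ calS ↔ σ = ∅ ∨ IsAffinePlane σ) ∧
      {σ | IsAffinePlane σ}.ncard = 14) ∧
    -- `𝒮 = χ₄(ℤ₂⁴ ∖ {(0, 0, 0, 1)})`, with `χ₄` injective
    (Function.Injective chi4 ∧ ∀ σ, σ ∈ calS ↔ ∃ x, x ≠ ![0, 0, 0, 1] ∧ chiSet x = σ) ∧
    -- the closed formula for the signs
    (∀ x y, chiSet x ∈ calS → chiSet y ∈ calS → symmDiff (chiSet x) (chiSet y) ∈ calS →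
      epsE8 (chiSet x) (chiSet y) = signE8 x y) ∧
    -- the signs are those of the multiplication table of `𝕆 ⊗ ℝ[ε]`, a twisted group algebra
    (∃ b : Module.Basis (Fin 4 → ZMod 2) ℝ OctEps, (∀ x, b x = octBasis x) ∧
      (∀ x y, b x * b y = signE8 x y • b (x + y)) ∧
      ∀ x y, chiSet x ∈ calS → chiSet y ∈ calS → symmDiff (chiSet x) (chiSet y) ∈ calS →
        chiSet (x + y) = symmDiff (chiSet x) (chiSet y) ∧
        b x * b y = epsE8 (chiSet x) (chiSet y) • b (x + y)) ∧
    -- `𝔢₈ = 𝔤(S₈, S₈)` is a Lie algebra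
    ((∀ X : P.E8, ⁅X, X⁆ = 0) ∧
      ∀ X Y Z : P.E8, ⁅X, ⁅Y, Z⁆⁆ + ⁅Y, ⁅Z, X⁆⁆ + ⁅Z, ⁅X, Y⁆⁆ = 0) ∧
    -- the decomposition `𝔢₈ = ⨁_{σ ∈ 𝒮} V(σ)`
    ∃ Ψ : P.E8Sum ≃ₗ[F] P.E8,
      -- `V(∅) = sp(V)⁸` acts on the copies of `V`
      (∀ s : Fin 8 → P.sp, ∃ d d' : P.S8.tri,
        (∀ k, d.1 k = P.rhoSp fun j => s (left8 (cyc k j))) ∧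
        (∀ k, d'.1 k = P.rhoSp fun j => s (right8 (cyc k j))) ∧
        Ψ (P.inc ⟨∅, empty_mem_calS⟩ (VMod.ofSp P s)) = Magic.ofTri (d, d')) ∧
      -- `V({1, 2, 3, 4})`
      (∀ v : Fin 8 → V, ∃ d : P.S8.tri,
        (∀ k, d.1 k = P.rhoTensor fun j => v (left8 (cyc k j))) ∧
        Ψ (P.inc ⟨{0, 1, 2, 3}, left_mem_calS⟩ (VMod.pure P _ v)) = Magic.ofTri (d, 0)) ∧
      -- `V({5, 6, 7, 8})`
      (∀ v : Fin 8 → V, ∃ d : P.S8.tri,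
        (∀ k, d.1 k = P.rhoTensor fun j => v (right8 (cyc k j))) ∧
        Ψ (P.inc ⟨{4, 5, 6, 7}, right_mem_calS⟩ (VMod.pure P _ v)) = Magic.ofTri (0, d)) ∧
      -- the other `V(σ)`, contained in `ι_k(S₈ ⊗ S₈)`
      (∀ (v : Fin 8 → V) (k : Fin 3) (h h' : Fin 2),
        Ψ (P.inc ⟨mixedSet k h h', mixedSet_mem_calS k h h'⟩ (VMod.pure P _ v)) =
          Magic.iota k
            (half h (v (left8 (pairIdx k h 0))) (v (left8 (pairIdx k h 1))) ⊗ₜ[F]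
              half h' (v (right8 (pairIdx k h' 0))) (v (right8 (pairIdx k h' 1))))) ∧
      -- the bracket
      ∀ (σ τ : {σ // σ ∈ calS}) (x : P.VMod σ.1) (y : P.VMod τ.1),
        (∀ h : symmDiff σ.1 τ.1 ∈ calS, ⁅Ψ (P.inc σ x), Ψ (P.inc τ y)⁆ =
          (epsE8 σ τ : F) • Ψ (P.inc ⟨symmDiff σ.1 τ.1, h⟩ (P.phi σ.1 τ.1 x y))) ∧
        (symmDiff σ.1 τ.1 ∉ calS → symmDiff σ.1 τ.1 = Finset.univ ∧
          ⁅Ψ (P.inc σ x), Ψ (P.inc τ y)⁆ = 0) := by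
  refine ⟨⟨bijective_pt, mem_calS_iff_isAffinePlane, ncard_isAffinePlane⟩,
    ⟨chi4_injective, mem_calS_iff_exists_chiSet⟩, epsE8_chiSet,
    ⟨octEpsBasis, octEpsBasis_apply, fun x y => ?_, fun x y hx hy hxy => ⟨chiSet_add x y, ?_⟩⟩,
    ⟨Magic.lie_self_eq_zero, Magic.jacobi⟩,
    LinearEquiv.ofBijective P.psiSum P.psiSum_bijective, fun s => ?_, fun v => ?_, fun v => ?_,
    fun v k h h' => ?_, fun σ τ x y => ⟨fun h => ?_, fun h => ⟨?_, ?_⟩⟩⟩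
  · simp only [octEpsBasis_apply, octBasis_mul]
  · simp only [octEpsBasis_apply, octBasis_mul, epsE8_chiSet x y hx hy hxy]
  · refine ⟨P.spTriple fun j => s (left8 j), P.spTriple fun j => s (right8 j), fun k => rfl,
      fun k => rfl, ?_⟩
    exact (P.psiSum_inc _ _).trans (P.psi_of_eq_empty rfl _)
  · exact ⟨P.tensorTriple fun j => v (left8 j), fun k => rfl,
      (P.psiSum_inc _ _).trans (P.psi_pure labelSet_left v)⟩
  · exact ⟨P.tensorTriple fun j => v (right8 j), fun k => rfl,
      (P.psiSum_inc _ _).trans (P.psi_pure labelSet_right v)⟩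
  · exact (P.psiSum_inc _ _).trans (P.psi_pure (labelSet_mixed k h h') v)
  · simp only [LinearEquiv.ofBijective_apply, psiSum_inc]
    exact (P.lie_psi σ.2 τ.2 h x y).trans
      (congrArg _ (P.psiSum_inc ⟨symmDiff σ.1 τ.1, h⟩ (P.phi σ.1 τ.1 x y)).symm)
  · exact symmDiff_eq_univ_of_notMem _ σ.2 _ τ.2 h
  · simp only [LinearEquiv.ofBijective_apply, psiSum_inc]
    exact P.lie_psi_eq_zero σ.2 τ.2 h x y
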